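/- For an integer $q\ge 1$ and integers $m,n$ let $$\mathcal K(m,n;q)=\frac1{q^{1/2}}\sum_{\substack{b \bmod q\\ \gcd(b,q)=1}} e\!\left(\frac{mb+n\overline b}{q}\right),\qquad b\overline b\equiv 1 \pmod q,\quad e(x)=e^{2\pi i x},$$ denote the normalised Kloosterman sum. There exists an absolute constant $c>0$ such that for every real $0<\lambda<1$ there exist constants $H(\lambda)>0$ and $C(\lambda)>0$, depending only on $\lambda$, with the following property. Let $q=p^k$, where $p$ is an odd prime and $k>H(\lambda)$ is an integer, let $a$ be an integer with $\gcd(a,p)=1$, and let $U,V,X$ be real numbers with $q^\lambda<U<X$, $q^\lambda<V<X$ and $X<q$. Then for all sequences of complex numbers $(\alpha_m)_{m\ge1}$ and $(\beta_n)_{n\ge1}$ with $|\alpha_m|\le 1$ and $|\beta_n|\le 1$, $$\Bigl|\sum_{\substack{m\ge U,\ n\ge V\\ mn\le X}}\alpha_m\beta_n\,\mathcal K(mn,a;q)\Bigr|\le C(\lambda)\,X\,q^{-c\lambda^3},$$ where the sum is over positive integers $m,n$. -/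

import Mathlib

open scoped BigOperators

/-- The additive character `e(x) = exp(2 π i x)` of a real number `x`. -/
noncomputable def addExp (x : ℝ) : ℂ :=
  Complex.exp (2 * Real.pi * Complex.I * x)

/-- The least non-negative residue of the inverse of `b` modulo `q`
(meaningful when `b` is coprime to `q`). -/
def invMod (q b : ℕ) : ℕ := ((b : ZMod q)⁻¹).val

/-- For `b` coprime to `q`, the number `invMod q b` is an inverse of `b` modulo `q`. -/
theorem mul_invMod {q b : ℕ} (hq : 0 < q) (hb : b.Coprime q) :
    b * invMod q b ≡ 1 [MOD q] := by
  have : NeZero q := ⟨hq.ne'⟩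
  rw [← ZMod.natCast_eq_natCast_iff]
  simp [invMod, ZMod.coe_mul_inv_eq_one b hb]

/-- The normalised Kloosterman sum
`K(m, n; q) = q^(-1/2) * ∑ e((m b + n b') / q)`, where `b` runs over the reduced residue classes
modulo `q` and `b'` is the inverse of `b` modulo `q`. -/
noncomputable def kloosterman (m n : ℤ) (q : ℕ) : ℂ :=
  (1 / (Real.sqrt q : ℂ)) *
    ∑ b ∈ (Finset.range q).filter (fun b => b.Coprime q),
      addExp (((m * (b : ℤ) + n * (invMod q b : ℤ) : ℤ) : ℝ) / (q : ℝ))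

open Classical in
/-- The pairs `(m, n)` of positive integers with `m ≥ U`, `n ≥ V` and `m n ≤ X`. -/
noncomputable def hyperbolicRegion (U V X : ℝ) : Finset (ℕ × ℕ) :=
  (Finset.Icc 1 ⌊X⌋₊ ×ˢ Finset.Icc 1 ⌊X⌋₊).filter
    (fun z => U ≤ (z.1 : ℝ) ∧ V ≤ (z.2 : ℝ) ∧ (z.1 : ℝ) * (z.2 : ℝ) ≤ X)

theorem mem_hyperbolicRegion {U V X : ℝ} {m n : ℕ} :
    (m, n) ∈ hyperbolicRegion U V X ↔
      1 ≤ m ∧ 1 ≤ n ∧ U ≤ (m : ℝ) ∧ V ≤ (n : ℝ) ∧ (m : ℝ) * (n : ℝ) ≤ X := by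
  unfold hyperbolicRegion
  simp only [Finset.mem_filter, Finset.mem_product, Finset.mem_Icc]
  constructor
  · rintro ⟨⟨⟨h1, -⟩, h2, -⟩, h⟩
    exact ⟨h1, h2, h⟩
  · rintro ⟨h1, h2, h3, h4, h5⟩
    have e1 : (1 : ℝ) ≤ m := by exact_mod_cast h1
    have e2 : (1 : ℝ) ≤ n := by exact_mod_cast h2
    exact ⟨⟨⟨h1, Nat.le_floor (by nlinarith)⟩, h2, Nat.le_floor (by nlinarith)⟩, h3, h4, h5⟩

/-- The bilinear sum of Kloosterman sums over a hyperbolic domain,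
`∑ α_m β_n K(m n, a; q)` over `m ≥ U`, `n ≥ V`, `m n ≤ X`. -/
noncomputable def hyperbolicSum (α β : ℕ → ℂ) (a : ℤ) (q : ℕ) (U V X : ℝ) : ℂ :=
  ∑ z ∈ hyperbolicRegion U V X,
    α z.1 * β z.2 * kloosterman ((z.1 : ℤ) * (z.2 : ℤ)) a q

/-!
Bilinear sums of Kloosterman sums modulo a prime power `q = p ^ k` over a hyperbolic region. Losses
of bounded powers of `p` and of logarithms of `q` do not matter, since `k` is large in terms of
`lam`.

**From Kloosterman sums to square roots.** By stationary phase (`sum_units_eq_stationary`), the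
Kloosterman sum at `m n` vanishes, or `m n = a x ^ 2` modulo `q`, and then it is a combination of
`ψ(2 a x)` and `ψ(-2 a x)` with coefficients that depend only on `x` modulo `p`
(`kloosterman_eq_of_sq`, `kloosterman_eq_zero_or_exists_sq`, `localGauss_congr`). For `m` and `n` in
fixed residue classes modulo `p`, the root factors as `x = x₀ F(m) G(n)`, where `F` and `G` are
branches of the `p`-adic square root (`IsSqrtBranch`). The task is to bound bilinear sums of
`ψ(A F(m) G(n))`.

**From bilinear sums to short sums.** After a dyadic decomposition (`sum_hyperbolicRegion_eq`) and
Cauchy's inequality (`norm_bilinear_sq_le`) there remain sums over `m` of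
`ψ(A (G(n) - G(n')) F(m))`, where `G(n) - G(n')` is a unit times `n - n'`. They are averaged over
the shifts `m ↦ m + p ^ s x y` with `x, y < p ^ s`, where `p ^ s` is about `q ^ (1 / (20 e))` and
`e` is about `1 / lam`. Since `p ^ (20 e s) = 0` modulo `q`, the Taylor series of the square root
breaks off (`IsSqrtBranch.add_eq`), and the phase is a polynomial of degree `20 e` in `x y`. Its
coefficients are, up to units, Catalan numbers times `n - n'` and powers of `p ^ s`, so that their
denominators are known up to small powers of `p` (`exists_norm_short_sum_le`).

**Vinogradov's method.** The double sum over `x` and `y` is treated by Vinogradov's bilinear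
inequality (`norm_bilinear_pow_le`): by Hölder's inequality in both variables, it is bounded by the
mean values of Vinogradov's system and by a gain from the denominators of the coefficients of degree
between `10 e` and `12 e`. The mean value theorem (`exists_meanValue_le`) is proved by the classical
iteration modulo a prime `r` of the size of the `d`-th root of the length (`meanValue_add_le`),
based on Linnik's lemma (`card_linnik_le`), hence on Newton's identities.

**The exponent.** The double sum saves a power of `p ^ s` of order `1 / e ^ 2`
(`exists_norm_bilinear_le`), that is, a power of `q` of order `1 / e ^ 3`, or `lam ^ 3`. The lower
bounds for `U` and `V` ensure that `m` and `n` run over ranges longer than a fixed power of `p ^ s`.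
-/

namespace Vinogradov
open Finset

/-! ### Additive energy -/

section Energy
variable {σ τ ι G : Type*}

/-- The energy of a map `Φ` on a finite set `S`: the number of pairs `(x, y)` of elements of `S`
with `Φ x = Φ y`. -/
def energy [DecidableEq G] (Φ : σ → G) (S : Finset σ) : ℕ :=
  #{z ∈ S ×ˢ S | Φ z.1 = Φ z.2}

/-- The energy is the second moment of the sizes of the fibres. -/
theorem energy_eq_sum_sq [DecidableEq G] (Φ : σ → G) (S : Finset σ) (T : Finset G)
    (hT : ∀ x ∈ S, Φ x ∈ T) : energy Φ S = ∑ g ∈ T, #{x ∈ S | Φ x = g} ^ 2 := by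
  unfold energy
  rw [card_eq_sum_card_fiberwise (f := fun z => Φ z.1) (t := T)]
  · refine sum_congr rfl fun g _ => ?_
    rw [sq, ← card_product]
    congr 1
    ext z
    simp only [mem_filter, mem_product]
    constructor
    · rintro ⟨⟨⟨h1, h2⟩, h3⟩, h4⟩
      exact ⟨⟨h1, h4⟩, h2, h3 ▸ h4⟩
    · rintro ⟨⟨h1, h4⟩, h2, h3⟩
      exact ⟨⟨⟨h1, h2⟩, h4.trans h3.symm⟩, h4⟩
  · intro z hz
    simp only [coe_filter, mem_product, Set.mem_ofPred_eq] at hz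
    exact hT _ hz.1.1

theorem energy_le_of_injOn {H : Type*} [DecidableEq G] [DecidableEq H] {Φ : σ → G} {Ψ : τ → H}
    {S : Finset σ} {T : Finset τ} (e : σ → τ) (he : ∀ x ∈ S, e x ∈ T)
    (hinj : Set.InjOn e S)
    (h : ∀ x ∈ S, ∀ y ∈ S, Φ x = Φ y → Ψ (e x) = Ψ (e y)) : energy Φ S ≤ energy Ψ T := by
  unfold energy
  refine card_le_card_of_injOn (fun z => (e z.1, e z.2)) ?_ ?_
  · intro z hz
    simp only [coe_filter, mem_product, Set.mem_ofPred_eq] at hz ⊢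
    exact ⟨⟨he _ hz.1.1, he _ hz.1.2⟩, h _ hz.1.1 _ hz.1.2 hz.2⟩
  · intro z hz w hw hzw
    simp only [coe_filter, mem_product, Set.mem_ofPred_eq] at hz hw
    simp only [Prod.mk.injEq] at hzw
    exact Prod.ext (hinj hz.1.1 hw.1.1 hzw.1) (hinj hz.1.2 hw.1.2 hzw.2)

theorem energy_mono [DecidableEq G] {Φ : σ → G} {S T : Finset σ} (h : S ⊆ T) :
    energy Φ S ≤ energy Φ T :=
  energy_le_of_injOn id (fun _ hx => h hx) Function.injective_id.injOn (fun _ _ _ _ h => h)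

/-- Cauchy's inequality for the fibres over a union. -/
theorem energy_biUnion_le [DecidableEq G] [DecidableEq σ] (Φ : σ → G) (I : Finset ι)
    (S : ι → Finset σ) : energy Φ (I.biUnion S) ≤ #I * ∑ i ∈ I, energy Φ (S i) := by
  classical
  set T := (I.biUnion S).image Φ with hT
  rw [energy_eq_sum_sq Φ _ T (fun x hx => mem_image_of_mem _ hx)]
  have h1 : ∑ i ∈ I, energy Φ (S i) = ∑ i ∈ I, ∑ g ∈ T, #{x ∈ S i | Φ x = g} ^ 2 := by
    refine sum_congr rfl fun i hi => energy_eq_sum_sq Φ _ T fun x hx => ?_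
    exact mem_image_of_mem _ (mem_biUnion.2 ⟨i, hi, hx⟩)
  rw [h1, sum_comm, mul_sum]
  refine sum_le_sum fun g _ => ?_
  refine le_trans (Nat.pow_le_pow_left ?_ 2) (sq_sum_le_card_mul_sum_sq)
  rw [filter_biUnion]
  exact card_biUnion_le

theorem energy_union_le [DecidableEq G] [DecidableEq σ] (Φ : σ → G) (S T : Finset σ) :
    energy Φ (S ∪ T) ≤ 2 * (energy Φ S + energy Φ T) := by
  have := energy_biUnion_le Φ (univ : Finset Bool) (fun b => if b then S else T)
  have h2 : (univ : Finset Bool).biUnion (fun b => if b then S else T) = S ∪ T := by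
    ext x; simp
  rw [h2] at this
  simpa using this

/-- Prescribing a difference other than `0` does not give more pairs than the energy. -/
theorem card_shift_le_energy [AddGroup G] [DecidableEq G] (Φ : σ → G) (S : Finset σ) (g : G) :
    #{z ∈ S ×ˢ S | Φ z.1 = g + Φ z.2} ≤ energy Φ S := by
  classical
  set T := S.image Φ with hT
  have hE := energy_eq_sum_sq Φ S T (fun x hx => mem_image_of_mem _ hx)
  have h1 : #{z ∈ S ×ˢ S | Φ z.1 = g + Φ z.2} =
      ∑ h ∈ T, #{x ∈ S | Φ x = g + h} * #{x ∈ S | Φ x = h} := by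
    rw [card_eq_sum_card_fiberwise (f := fun z => Φ z.2) (t := T)]
    · refine sum_congr rfl fun h _ => ?_
      rw [← card_product]
      congr 1
      ext z
      simp only [mem_filter, mem_product]
      constructor
      · rintro ⟨⟨⟨h1, h2⟩, h3⟩, h4⟩
        exact ⟨⟨h1, h4 ▸ h3⟩, h2, h4⟩
      · rintro ⟨⟨h1, h3⟩, h2, h4⟩
        exact ⟨⟨⟨h1, h2⟩, h4 ▸ h3⟩, h4⟩
    · intro z hz
      simp only [coe_filter, mem_product, Set.mem_ofPred_eq] at hz
      exact mem_image_of_mem _ hz.1.2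
  have h2 : ∑ h ∈ T, #{x ∈ S | Φ x = g + h} ^ 2 ≤ energy Φ S := by
    rw [energy_eq_sum_sq Φ S (T ∪ T.image (g + ·))
      (fun x hx => mem_union_left _ (mem_image_of_mem _ hx))]
    rw [← sum_image (s := T) (g := (g + ·)) (f := fun h => #{x ∈ S | Φ x = h} ^ 2)
      (by intro a _ b _ h; simpa using h)]
    exact sum_le_sum_of_subset (subset_union_right)
  have h3 : 2 * ∑ h ∈ T, #{x ∈ S | Φ x = g + h} * #{x ∈ S | Φ x = h} ≤
      ∑ h ∈ T, #{x ∈ S | Φ x = g + h} ^ 2 + ∑ h ∈ T, #{x ∈ S | Φ x = h} ^ 2 := by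
    rw [mul_sum, ← sum_add_distrib]
    refine sum_le_sum fun h _ => ?_
    have := two_mul_le_add_sq (#{x ∈ S | Φ x = g + h}) (#{x ∈ S | Φ x = h})
    linarith
  omega

/-- If solutions of `Φ x + Ψ u = Φ y + Ψ v` exist only for pairs `(x, y)` with `C (x, y)`, then each
such pair leaves at most the energy of `Ψ` for `(u, v)`. -/
theorem energy_prod_le [AddCommGroup G] [DecidableEq G] (Φ : σ → G) (Ψ : τ → G)
    (S : Finset σ) (T : Finset τ) (C : σ × σ → Prop) [DecidablePred C]
    (hC : ∀ x ∈ S, ∀ y ∈ S, ∀ u ∈ T, ∀ v ∈ T, Φ x + Ψ u = Φ y + Ψ v → C (x, y)) :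
    energy (fun z : σ × τ => Φ z.1 + Ψ z.2) (S ×ˢ T) ≤ #{z ∈ S ×ˢ S | C z} * energy Ψ T := by
  classical
  conv_lhs => unfold energy
  rw [card_eq_sum_card_fiberwise (f := fun z => (z.1.1, z.2.1)) (t := {z ∈ S ×ˢ S | C z})]
  · refine sum_le_card_nsmul _ _ _ fun z _ => ?_
    refine le_trans ?_ (card_shift_le_energy Ψ T (Φ z.2 - Φ z.1))
    refine card_le_card_of_injOn (fun w => (w.1.2, w.2.2)) ?_ ?_
    · rintro ⟨⟨x, u⟩, ⟨y, v⟩⟩ hw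
      simp only [coe_filter, mem_product, mem_filter, Set.mem_ofPred_eq] at hw ⊢
      obtain ⟨⟨⟨⟨_, hu⟩, _, hv⟩, he⟩, rfl⟩ := hw
      refine ⟨⟨hu, hv⟩, ?_⟩
      rw [sub_add_eq_add_sub, ← he]; abel
    · rintro ⟨⟨x, u⟩, ⟨y, v⟩⟩ hw ⟨⟨x', u'⟩, ⟨y', v'⟩⟩ hw' h
      simp only [coe_filter, mem_product, mem_filter, Set.mem_ofPred_eq] at hw hw' h
      obtain ⟨_, rfl⟩ := hw
      have := hw'.2
      simp_all
  · rintro ⟨⟨x, u⟩, ⟨y, v⟩⟩ hz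
    simp only [coe_filter, mem_product, Set.mem_ofPred_eq] at hz ⊢
    exact ⟨⟨hz.1.1.1, hz.1.2.1⟩, hC _ hz.1.1.1 _ hz.1.2.1 _ hz.1.1.2 _ hz.1.2.2 hz.2⟩

/-- Parseval's identity: the energy is a mean square of character sums. -/
theorem sum_norm_sq_eq_card_mul_energy [AddCommGroup G] [Fintype G] [DecidableEq G] (Φ : σ → G)
    (S : Finset σ) :
    ∑ h : AddChar G ℂ, ‖∑ x ∈ S, h (Φ x)‖ ^ 2 = Fintype.card G * energy Φ S := by
  have h1 : ∀ h : AddChar G ℂ, ((‖∑ x ∈ S, h (Φ x)‖ ^ 2 : ℝ) : ℂ) =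
      ∑ z ∈ S ×ˢ S, h (Φ z.1 - Φ z.2) := by
    intro h
    rw [Complex.ofReal_pow, ← Complex.mul_conj', map_sum, sum_mul_sum, ← sum_product']
    refine sum_congr rfl fun z _ => ?_
    rw [sub_eq_add_neg, AddChar.map_add_eq_mul, AddChar.map_neg_eq_conj]
  have h2 : ((∑ h : AddChar G ℂ, ‖∑ x ∈ S, h (Φ x)‖ ^ 2 : ℝ) : ℂ) =
      ((Fintype.card G * energy Φ S : ℝ) : ℂ) := by
    rw [Complex.ofReal_sum]
    simp_rw [h1]
    rw [sum_comm]
    simp_rw [AddChar.sum_apply_eq_ite, sub_eq_zero]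
    rw [← sum_filter, sum_const, energy]
    push_cast
    simp [mul_comm]
  exact_mod_cast h2

end Energy

section Hoelder
variable {α δ ι : Type*}

theorem sum_piFinset_addChar {G κ : Type*} [AddCommGroup G] [Fintype κ] [DecidableEq κ]
    (h : AddChar G ℂ) (γ : α → G) (A : Finset α) :
    ∑ x ∈ Fintype.piFinset (fun _ : κ => A), h (∑ i, γ (x i)) =
      (∑ x ∈ A, h (γ x)) ^ Fintype.card κ := by
  have hp : ∀ x : κ → α, h (∑ i, γ (x i)) = ∏ i, h (γ (x i)) := fun x => by
    have := map_prod h.toMonoidHom (fun i => Multiplicative.ofAdd (γ (x i))) univ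
    rwa [← ofAdd_sum] at this
  simp_rw [hp]
  rw [sum_prod_piFinset A (fun _ x => h (γ x))]
  simp

/-- Hölder's inequality for the energy in a finite group. There the energy is a moment of character
sums, and Hölder's inequality is applied to the sum over the classes. -/
theorem energy_prod_pow_le_finite {G : Type*} [AddCommGroup G] [Fintype G] [DecidableEq G]
    (Φ : δ → G) (D : Finset δ) (γ : α → G) (A : Finset α) (R : Finset ι) (cl : α → ι)
    [DecidableEq ι] (hcl : ∀ x ∈ A, cl x ∈ R) {b : ℕ} (hb : 0 < b) (M : ℕ)
    (hM : ∀ a ∈ R, energy (fun z : δ × (Fin b → α) => Φ z.1 + ∑ i, γ (z.2 i))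
      (D ×ˢ Fintype.piFinset (fun _ => {x ∈ A | cl x = a})) ≤ M) :
    energy (fun z : δ × (Fin b → α) => Φ z.1 + ∑ i, γ (z.2 i))
      (D ×ˢ Fintype.piFinset (fun _ => A)) ≤ #R ^ (2 * b) * M := by
  classical
  have hF : ∀ (B : Finset α) (h : AddChar G ℂ),
      ‖∑ z ∈ D ×ˢ Fintype.piFinset (fun _ : Fin b => B), h (Φ z.1 + ∑ i, γ (z.2 i))‖ ^ 2 =
        ‖∑ x ∈ D, h (Φ x)‖ ^ 2 * ‖∑ x ∈ B, h (γ x)‖ ^ (2 * b) := by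
    intro B h
    rw [sum_product]
    simp_rw [AddChar.map_add_eq_mul, ← mul_sum, ← sum_mul]
    rw [sum_piFinset_addChar, norm_mul, mul_pow, norm_pow, ← pow_mul, Fintype.card_fin, mul_comm b]
  have hpt : ∀ h : AddChar G ℂ, ‖∑ x ∈ A, h (γ x)‖ ^ (2 * b) ≤
      (#R : ℝ) ^ (2 * b - 1) * ∑ a ∈ R, ‖∑ x ∈ A with cl x = a, h (γ x)‖ ^ (2 * b) := by
    intro h
    rw [← sum_fiberwise_of_maps_to hcl]
    refine le_trans (pow_le_pow_left₀ (norm_nonneg _) (norm_sum_le _ _) _) ?_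
    have := pow_sum_le_card_mul_sum_pow (s := R)
      (f := fun a => ‖∑ x ∈ A with cl x = a, h (γ x)‖) (fun _ _ => norm_nonneg _) (2 * b - 1)
    rwa [show 2 * b - 1 + 1 = 2 * b by omega] at this
  have hG : (0 : ℝ) < Fintype.card G := by exact_mod_cast Fintype.card_pos
  have key : (Fintype.card G : ℝ) * (energy (fun z : δ × (Fin b → α) => Φ z.1 + ∑ i, γ (z.2 i))
      (D ×ˢ Fintype.piFinset (fun _ => A)) : ℝ) ≤ Fintype.card G * ((#R : ℝ) ^ (2 * b) * M) := by
    rw [← sum_norm_sq_eq_card_mul_energy]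
    simp_rw [hF A]
    calc _ ≤ ∑ h : AddChar G ℂ, ‖∑ x ∈ D, h (Φ x)‖ ^ 2 * ((#R : ℝ) ^ (2 * b - 1) *
          ∑ a ∈ R, ‖∑ x ∈ A with cl x = a, h (γ x)‖ ^ (2 * b)) :=
          sum_le_sum fun h _ => mul_le_mul_of_nonneg_left (hpt h) (by positivity)
      _ = (#R : ℝ) ^ (2 * b - 1) * ∑ a ∈ R, ∑ h : AddChar G ℂ,
            ‖∑ x ∈ D, h (Φ x)‖ ^ 2 * ‖∑ x ∈ A with cl x = a, h (γ x)‖ ^ (2 * b) := by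
          rw [sum_comm, mul_sum]
          refine sum_congr rfl fun h _ => ?_
          rw [mul_sum, mul_sum, mul_sum]
          exact sum_congr rfl fun a _ => by ring
      _ ≤ (#R : ℝ) ^ (2 * b - 1) * ∑ a ∈ R, (Fintype.card G * M : ℝ) := by
          refine mul_le_mul_of_nonneg_left (sum_le_sum fun a ha => ?_) (by positivity)
          simp_rw [← hF]
          rw [sum_norm_sq_eq_card_mul_energy]
          exact mul_le_mul_of_nonneg_left (by exact_mod_cast hM a ha) hG.le
      _ = _ := by
          rw [sum_const, nsmul_eq_mul]
          have : (#R : ℝ) ^ (2 * b) = (#R : ℝ) ^ (2 * b - 1) * #R := by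
            rw [← pow_succ]; congr 1; omega
          rw [this]; ring
  have := le_of_mul_le_mul_left key hG
  exact_mod_cast this

/-- A finite set of integer vectors embeds into `(ZMod Q) ^ ι` for large `Q`, so that energies in
`ℤ ^ ι` are energies in a finite group. -/
theorem exists_zmod_cast_injOn {ι σ : Type*} [Fintype ι] (Φ : σ → ι → ℤ) (S : Finset σ) :
    ∃ Q : ℕ, 0 < Q ∧ ∀ x ∈ S, ∀ y ∈ S,
      ((fun j => (Φ x j : ZMod Q)) = fun j => (Φ y j : ZMod Q)) ↔ Φ x = Φ y := by
  refine ⟨1 + ∑ z ∈ S ×ˢ S, ∑ j, (Φ z.1 j - Φ z.2 j).natAbs, by omega, fun x hx y hy =>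
    ⟨fun h => ?_, fun h => by rw [h]⟩⟩
  funext j
  have hj := congrFun h j
  rw [← sub_eq_zero, ← Int.cast_sub, ZMod.intCast_zmod_eq_zero_iff_dvd] at hj
  have h1 : (Φ x j - Φ y j).natAbs ≤ ∑ z ∈ S ×ˢ S, ∑ j, (Φ z.1 j - Φ z.2 j).natAbs :=
    (single_le_sum (f := fun j => (Φ x j - Φ y j).natAbs) (fun _ _ => Nat.zero_le _)
      (mem_univ j)).trans
      (single_le_sum (f := fun z : σ × σ => ∑ j, (Φ z.1 j - Φ z.2 j).natAbs)
        (fun _ _ => Nat.zero_le _) (mk_mem_product hx hy))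
  have h2 := Int.eq_zero_of_abs_lt_dvd hj (by rw [Int.abs_eq_natAbs]; omega)
  omega

/-- Hölder's inequality for the number of solutions of an additive system: if `A` is cut into the
classes `{x ∈ A | cl x = a}`, `a ∈ R`, then the variables from `A` may all be restricted to one and
the same class, at the cost of a factor `#R ^ (2 b)`. -/
theorem energy_prod_pow_le {κ : Type*} [Fintype κ] (Φ : δ → κ → ℤ) (D : Finset δ)
    (γ : α → κ → ℤ) (A : Finset α) (R : Finset ι) (cl : α → ι) [DecidableEq ι]
    (hcl : ∀ x ∈ A, cl x ∈ R) {b : ℕ} (hb : 0 < b) (M : ℕ)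
    (hM : ∀ a ∈ R, energy (fun z : δ × (Fin b → α) => Φ z.1 + ∑ i, γ (z.2 i))
      (D ×ˢ Fintype.piFinset (fun _ => {x ∈ A | cl x = a})) ≤ M) :
    energy (fun z : δ × (Fin b → α) => Φ z.1 + ∑ i, γ (z.2 i))
      (D ×ˢ Fintype.piFinset (fun _ => A)) ≤ #R ^ (2 * b) * M := by
  classical
  set Ψ : δ × (Fin b → α) → κ → ℤ := fun z => Φ z.1 + ∑ i, γ (z.2 i) with hΨ
  obtain ⟨Q, hQ, hinj⟩ := exists_zmod_cast_injOn Ψ (D ×ˢ Fintype.piFinset (fun _ => A))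
  have : NeZero Q := ⟨hQ.ne'⟩
  have hcast : ∀ z, (fun j => (Ψ z j : ZMod Q)) =
      (fun j => (Φ z.1 j : ZMod Q)) + ∑ i, (fun j => (γ (z.2 i) j : ZMod Q)) := by
    intro z; funext j
    simp [hΨ, Finset.sum_apply]
  have hsub : ∀ a, D ×ˢ Fintype.piFinset (fun _ : Fin b => {x ∈ A | cl x = a}) ⊆
      D ×ˢ Fintype.piFinset (fun _ => A) := fun a =>
    product_subset_product_right (Fintype.piFinset_subset _ _ fun _ => filter_subset _ _)
  have := energy_prod_pow_le_finite (fun (z : δ) (j : κ) => (Φ z j : ZMod Q)) D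
    (fun x j => (γ x j : ZMod Q)) A R cl hcl hb M (fun a ha => by
      refine le_trans (energy_le_of_injOn id (fun _ h => h) Function.injective_id.injOn ?_)
        (hM a ha)
      intro x hx y hy h
      simp_rw [← hcast] at h
      exact (hinj x (hsub a hx) y (hsub a hy)).1 h)
  refine le_trans (energy_le_of_injOn id (fun _ h => h) Function.injective_id.injOn ?_) this
  intro x hx y hy h
  simp_rw [id, ← hcast]
  rw [h]

end Hoelder

/-! ### Power sums and Linnik's lemma -/

section Newton
variable {R : Type*} [CommRing R]

theorem aeval_esymm_congr_of_psum {n : ℕ} {x y : Fin n → R}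
    (hu : ∀ j : ℕ, 1 ≤ j → j ≤ n → IsUnit (j : R))
    (h : ∀ j : ℕ, 1 ≤ j → j ≤ n → ∑ i, x i ^ j = ∑ i, y i ^ j) (k : ℕ) (hk : k ≤ n) :
    MvPolynomial.aeval x (MvPolynomial.esymm (Fin n) ℤ k) =
      MvPolynomial.aeval y (MvPolynomial.esymm (Fin n) ℤ k) := by
  induction k using Nat.strong_induction_on with
  | _ k ih =>
    rcases Nat.eq_zero_or_pos k with rfl | hpos
    · simp
    have key : ∀ z : Fin n → R, (k : R) * MvPolynomial.aeval z (MvPolynomial.esymm (Fin n) ℤ k) =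
        (-1) ^ (k + 1) * ∑ a ∈ antidiagonal k with a.1 < k,
          (-1) ^ a.1 * MvPolynomial.aeval z (MvPolynomial.esymm (Fin n) ℤ a.1) *
            ∑ i, z i ^ a.2 := by
      intro z
      have := congrArg (MvPolynomial.aeval z) (MvPolynomial.mul_esymm_eq_sum (Fin n) ℤ k)
      simpa [MvPolynomial.psum] using this
    refine (hu k hpos hk).mul_left_cancel ?_
    rw [key x, key y]
    congr 1
    refine sum_congr rfl fun a ha => ?_
    simp only [mem_filter, HasAntidiagonal.mem_antidiagonal] at ha
    rw [ih a.1 ha.2 (by omega), h a.2 (by omega) (by omega)]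

/-- Two tuples with the same power sums have the same monic polynomial, as long as the integers up
to the length are invertible (Newton's identities). -/
theorem prod_sub_eq_of_psum {n : ℕ} {x y : Fin n → R}
    (hu : ∀ j : ℕ, 1 ≤ j → j ≤ n → IsUnit (j : R))
    (h : ∀ j : ℕ, 1 ≤ j → j ≤ n → ∑ i, x i ^ j = ∑ i, y i ^ j) (t : R) :
    ∏ i, (t - x i) = ∏ i, (t - y i) := by
  have key : ∀ z : Fin n → R, ∏ i, (t - z i) = ∑ j ∈ range (n + 1), (-1) ^ j *
      (MvPolynomial.aeval z (MvPolynomial.esymm (Fin n) ℤ j) * t ^ (n - j)) := by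
    intro z
    have := congrArg (Polynomial.eval t)
      (Multiset.prod_X_sub_X_eq_sum_esymm ((univ : Finset (Fin n)).val.map z))
    rw [Multiset.map_map] at this
    change Polynomial.eval t (∏ i, (Polynomial.X - Polynomial.C (z i))) = _ at this
    simp only [Polynomial.eval_prod, Polynomial.eval_sub, Polynomial.eval_X, Polynomial.eval_C,
      Polynomial.eval_finsetSum, Multiset.card_map, card_val, card_univ, Fintype.card_fin,
      Polynomial.eval_mul, Polynomial.eval_pow, Polynomial.eval_neg, Polynomial.eval_one] at this
    simp only [MvPolynomial.aeval_esymm_eq_multiset_esymm]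
    exact this
  rw [key x, key y]
  refine sum_congr rfl fun j hj => ?_
  rw [aeval_esymm_congr_of_psum hu h j (by simpa [Nat.lt_succ_iff] using hj)]

end Newton

section Linnik

theorem isUnit_natCast_zmod_pow {r n m : ℕ} (hr : r.Prime) (h0 : 0 < m) (hm : m < r) :
    IsUnit (m : ZMod (r ^ n)) := by
  rw [ZMod.isUnit_iff_coprime]
  exact Nat.Coprime.pow_right _
    (((Nat.Prime.coprime_iff_not_dvd hr).2 (Nat.not_dvd_of_pos_of_lt h0 hm)).symm)

theorem isUnit_intCast_zmod_pow {r n : ℕ} (hr : r.Prime) {m : ℤ} (h : ¬ (r : ℤ) ∣ m) :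
    IsUnit (m : ZMod (r ^ n)) := by
  have h1 : IsUnit ((m.natAbs : ℕ) : ZMod (r ^ n)) := by
    rw [ZMod.isUnit_iff_coprime]
    refine Nat.Coprime.pow_right _ ((Nat.Prime.coprime_iff_not_dvd hr).2 fun hd => h ?_).symm
    exact Int.natCast_dvd.2 hd
  rcases Int.natAbs_eq m with hm | hm
  · rw [hm, Int.cast_natCast]; exact h1
  · rw [hm, Int.cast_neg, Int.cast_natCast]; exact h1.neg

/-- If two integer tuples have the same power sums modulo `r ^ n` and the entries of the first are
distinct modulo `r`, then every entry of the second is congruent modulo `r ^ n` to an entry of the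
first. -/
theorem exists_modEq_of_psum {r n : ℕ} (hr : r.Prime) (hn : n < r) (hn0 : 0 < n) {x y : Fin n → ℤ}
    (hx : ∀ i j, (r : ℤ) ∣ x i - x j → i = j)
    (h : ∀ j : ℕ, 1 ≤ j → j ≤ n →
      ∑ i, (x i : ZMod (r ^ n)) ^ j = ∑ i, (y i : ZMod (r ^ n)) ^ j) (l : Fin n) :
    ∃ i, (y l : ZMod (r ^ n)) = x i := by
  have h0 := prod_sub_eq_of_psum (fun j h1 h2 => isUnit_natCast_zmod_pow hr h1 (by omega)) h
    (y l : ZMod (r ^ n))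
  rw [prod_eq_zero (f := fun i => (y l : ZMod (r ^ n)) - y i) (mem_univ l) (sub_self _)] at h0
  have hd : ∃ i, (r : ℤ) ∣ y l - x i := by
    by_contra! hcon
    have : IsUnit (∏ i, ((y l : ZMod (r ^ n)) - x i)) := by
      rw [IsUnit.prod_univ_iff]
      intro i
      have := isUnit_intCast_zmod_pow (n := n) hr (hcon i)
      simpa using this
    rw [h0] at this
    have hc : Nontrivial (ZMod (r ^ n)) := by
      have : Fact (1 < r ^ n) := ⟨Nat.one_lt_pow hn0.ne' hr.one_lt⟩
      infer_instance
    exact not_isUnit_zero this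
  obtain ⟨i, hi⟩ := hd
  refine ⟨i, ?_⟩
  rw [← mul_prod_erase univ _ (mem_univ i)] at h0
  have hu : IsUnit (∏ j ∈ univ.erase i, ((y l : ZMod (r ^ n)) - x j)) := by
    rw [IsUnit.prod_iff]
    intro j hj
    have hnd : ¬ (r : ℤ) ∣ y l - x j := by
      intro hd
      have := hx i j (by have := dvd_sub hd hi; simpa using this)
      exact (mem_erase.1 hj).1 this.symm
    have := isUnit_intCast_zmod_pow (n := n) hr hnd
    simpa using this
  exact sub_eq_zero.1 (hu.mul_left_eq_zero.1 h0)

/-- **Linnik's lemma**. The number of tuples below `N ≤ r ^ n`, distinct modulo `r`, whose `j`-th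
power sum (about the point `a`) is prescribed modulo `r ^ j` for `1 ≤ j ≤ n`. -/
theorem card_linnik_le {r n N : ℕ} (hr : r.Prime) (hn : n < r) (hn0 : 0 < n) (hN : N ≤ r ^ n)
    (a : ℤ) (c : ℕ → ℤ) :
    #{x ∈ Fintype.piFinset (fun _ : Fin n => range N) |
      (∀ i j, x i % r = x j % r → i = j) ∧
      ∀ j : ℕ, 1 ≤ j → j ≤ n → (r : ℤ) ^ j ∣ ∑ i, ((x i : ℤ) - a) ^ j - c j} ≤
      r ^ (n * (n - 1) / 2) * n ^ n := by
  classical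
  have hr0 : 0 < r := hr.pos
  have : NeZero (r ^ n) := ⟨(pow_pos hr0 n).ne'⟩
  set S := {x ∈ Fintype.piFinset (fun _ : Fin n => range N) |
      (∀ i j, x i % r = x j % r → i = j) ∧
      ∀ j : ℕ, 1 ≤ j → j ≤ n → (r : ℤ) ^ j ∣ ∑ i, ((x i : ℤ) - a) ^ j - c j} with hS
  -- The power sums modulo `r ^ n` are `c j + r ^ j * t` with `t < r ^ (n - j)`.
  set T : Finset (Fin n → ZMod (r ^ n)) := Fintype.piFinset fun j : Fin n =>
    (range (r ^ (n - (j + 1)))).image fun t : ℕ =>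
      ((c (j + 1) : ℤ) : ZMod (r ^ n)) + (r : ZMod (r ^ n)) ^ (j + 1 : ℕ) * (t : ZMod (r ^ n))
    with hT
  set f : (Fin n → ℕ) → Fin n → ZMod (r ^ n) := fun x j =>
    ∑ i, (((x i : ℤ) - a : ℤ) : ZMod (r ^ n)) ^ (j + 1 : ℕ) with hf
  have hTcard : #T ≤ r ^ (n * (n - 1) / 2) := by
    rw [hT, Fintype.card_piFinset]
    calc _ ≤ ∏ j : Fin n, r ^ (n - (j + 1)) :=
          prod_le_prod' fun j _ => card_image_le.trans (card_range _).le
      _ = r ^ (n * (n - 1) / 2) := by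
          rw [prod_pow_eq_pow_sum, ← Finset.sum_range_id,
            Fin.sum_univ_eq_sum_range (fun j => n - (j + 1)) n,
            ← Finset.sum_range_reflect (fun i => i) n]
          congr 1
          exact sum_congr rfl fun j _ => by omega
  have hmaps : ∀ x ∈ S, f x ∈ T := by
    intro x hx
    simp only [hS, mem_filter] at hx
    rw [hT, Fintype.mem_piFinset]
    intro j
    obtain ⟨t, ht⟩ := hx.2.2 (j + 1) (by omega) (by omega)
    rw [mem_image]
    have hm : (0 : ℤ) < (r : ℤ) ^ (n - (j + 1 : ℕ)) := by positivity
    refine ⟨(t % (r : ℤ) ^ (n - (j + 1 : ℕ))).toNat, ?_, ?_⟩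
    · rw [mem_range]
      have h1 := Int.emod_lt_of_pos t hm
      have h2 := Int.emod_nonneg t hm.ne'
      have : ((r ^ (n - (j + 1 : ℕ)) : ℕ) : ℤ) = (r : ℤ) ^ (n - (j + 1 : ℕ)) := by push_cast; rfl
      omega
    · have h2 := Int.emod_nonneg t hm.ne'
      have h3 : (((t % (r : ℤ) ^ (n - (j + 1 : ℕ))).toNat : ℤ)) =
        t % (r : ℤ) ^ (n - (j + 1 : ℕ)) := Int.toNat_of_nonneg h2
      have h4 : (f x j : ZMod (r ^ n)) = ((c (j + 1) + (r : ℤ) ^ (j + 1 : ℕ) * t : ℤ) :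
          ZMod (r ^ n)) := by
        rw [← ht]; simp [hf]
      rw [h4]
      have h5 : ((t % (r : ℤ) ^ (n - (j + 1 : ℕ))).toNat : ZMod (r ^ n)) =
          ((t % (r : ℤ) ^ (n - (j + 1 : ℕ)) : ℤ) : ZMod (r ^ n)) := by
        rw [← h3]; simp
      rw [h5, ← sub_eq_zero]
      have h6 : t = t % (r : ℤ) ^ (n - (j + 1 : ℕ)) + (r : ℤ) ^ (n - (j + 1 : ℕ)) *
        (t / (r : ℤ) ^ (n - (j + 1 : ℕ))) := (Int.emod_add_mul_ediv _ _).symm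
      have h7 : ((r : ℤ) ^ n : ℤ) = (r : ℤ) ^ (j + 1 : ℕ) * (r : ℤ) ^ (n - (j + 1 : ℕ)) := by
        rw [← pow_add]; congr 1; omega
      have h8 : ∀ u : ℤ, (((r : ℤ) ^ (j + 1 : ℕ) * ((r : ℤ) ^ (n - (j + 1 : ℕ)) * u) : ℤ) :
          ZMod (r ^ n)) = 0 := by
        intro u
        rw [ZMod.intCast_zmod_eq_zero_iff_dvd]
        refine ⟨u, ?_⟩
        push_cast
        rw [h7]; ring
      have h9 := h8 (t / (r : ℤ) ^ (n - (j + 1 : ℕ)))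
      have h10 := congrArg (Int.cast : ℤ → ZMod (r ^ n)) h6
      rw [Int.cast_add, Int.cast_mul] at h10
      rw [Int.cast_mul, Int.cast_mul] at h9
      rw [Int.cast_add, Int.cast_mul, h10]
      push_cast at h9 ⊢
      linear_combination -h9
  refine (card_le_mul_card_image_of_maps_to hmaps (n ^ n) ?_).trans ?_
  · intro g _
    rcases ({x ∈ S | f x = g}).eq_empty_or_nonempty with he | ⟨x, hx⟩
    · rw [he]; simp
    rw [mem_filter] at hx
    have hex : ∀ y ∈ ({x ∈ S | f x = g} : Finset _), ∃ σ : Fin n → Fin n, ∀ l, y l = x (σ l) := by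
      intro y hy
      rw [mem_filter] at hy
      have hxS := hx.1
      have hyS := hy.1
      simp only [hS, mem_filter, Fintype.mem_piFinset, mem_range] at hxS hyS
      have : ∀ l, ∃ i, (((y l : ℤ) - a : ℤ) : ZMod (r ^ n)) = ((x i : ℤ) - a : ℤ) := by
        refine exists_modEq_of_psum hr hn hn0 ?_ ?_
        · intro i j hij
          refine hxS.2.1 i j ?_
          have : (r : ℤ) ∣ (x i : ℤ) - x j := by simpa using hij
          exact (Nat.modEq_iff_dvd.2 this).symm
        · intro j h1 h2
          have e := congrFun (hx.2.trans hy.2.symm) ⟨j - 1, by omega⟩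
          simpa [hf, Nat.sub_add_cancel h1] using e
      choose σ hσ using this
      refine ⟨σ, fun l => ?_⟩
      have h1 := hσ l
      push_cast at h1
      have h2 : ((y l : ℕ) : ZMod (r ^ n)) = (x (σ l) : ℕ) := by
        have := sub_left_injective h1
        exact_mod_cast this
      rw [ZMod.natCast_eq_natCast_iff] at h2
      exact Nat.ModEq.eq_of_lt_of_lt h2 ((hyS.1 l).trans_le hN) ((hxS.1 _).trans_le hN)
    have : Nonempty (Fin n → Fin n) := ⟨id⟩
    choose! s hs using hex
    calc _ ≤ #(univ : Finset (Fin n → Fin n)) := by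
          refine card_le_card_of_injOn s (fun _ _ => mem_coe.2 (mem_univ _)) ?_
          intro y hy z hz h
          funext l
          rw [hs y hy l, hs z hz l, h]
      _ = n ^ n := by simp
  · rw [mul_comm]
    exact Nat.mul_le_mul_right _ hTcard

end Linnik

/-! ### Vinogradov's mean value theorem -/

section MeanValue

/-- The point `(1, x, x ^ 2, …, x ^ d)` of the moment curve. With the constant coordinate included,
the translations of `x` act linearly. -/
def moments (d x : ℕ) : Fin (d + 1) → ℤ := fun j => (x : ℤ) ^ (j : ℕ)

/-- The number of solutions of **Vinogradov's system** `x₁ʲ + ⋯ + x_bʲ = y₁ʲ + ⋯ + y_bʲ`,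
`0 ≤ j ≤ d`, in integers `0 ≤ xᵢ, yᵢ < N`. -/
def meanValue (d b N : ℕ) : ℕ :=
  energy (fun x : Fin b → ℕ => ∑ i, moments d (x i)) (Fintype.piFinset fun _ => range N)

/-- Translation invariance of Vinogradov's system: the powers of `x - a` up to the `d`-th depend
linearly on the powers of `x`. -/
theorem exists_hom_moments (d j : ℕ) (hj : j ≤ d) (a : ℤ) :
    ∃ L : (Fin (d + 1) → ℤ) →+ ℤ, ∀ x : ℕ, L (moments d x) = ((x : ℤ) - a) ^ j := by
  set f : Polynomial ℤ := (Polynomial.X - Polynomial.C a) ^ j with hf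
  have hdeg : f.natDegree < d + 1 := by
    rw [hf, Polynomial.natDegree_pow, Polynomial.natDegree_X_sub_C]; omega
  refine ⟨AddMonoidHom.mk' (fun v => ∑ k : Fin (d + 1), f.coeff k * v k) ?_, fun x => ?_⟩
  · intro v w
    simp [mul_add, sum_add_distrib]
  · have := Polynomial.eval_eq_sum_range' hdeg (x : ℤ)
    rw [Finset.sum_range] at this
    simp only [AddMonoidHom.mk'_apply, moments]
    rw [← this, hf]
    simp

theorem sum_sub_pow_eq_of_moments {d j : ℕ} (hj : j ≤ d) (a : ℤ) {κ : Type*} [Fintype κ]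
    {x y : κ → ℕ} (h : ∑ i, moments d (x i) = ∑ i, moments d (y i)) :
    ∑ i, ((x i : ℤ) - a) ^ j = ∑ i, ((y i : ℤ) - a) ^ j := by
  obtain ⟨L, hL⟩ := exists_hom_moments d j hj a
  have := congrArg L h
  simpa [map_sum, hL] using this

/-- By translation and dilation invariance, the solutions of Vinogradov's system in a residue class
modulo `r` correspond to solutions in a shorter interval. -/
theorem energy_class_le (d b N r a : ℕ) (hr : 0 < r) :
    energy (fun x : Fin b → ℕ => ∑ i, moments d (x i))
      (Fintype.piFinset fun _ => {x ∈ range N | x % r = a}) ≤ meanValue d b (N / r + 1) := by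
  refine energy_le_of_injOn (fun x i => x i / r) ?_ ?_ ?_
  · intro x hx
    simp only [Fintype.mem_piFinset, mem_filter, mem_range] at hx ⊢
    exact fun i => Nat.lt_succ_of_le (Nat.div_le_div_right (hx i).1.le)
  · intro x hx y hy h
    simp only [mem_coe, Fintype.mem_piFinset, mem_filter, mem_range] at hx hy
    funext i
    rw [← Nat.div_add_mod (x i) r, ← Nat.div_add_mod (y i) r, (hx i).2, (hy i).2,
      show x i / r = y i / r from congrFun h i]
  · intro x hx y hy h
    simp only [Fintype.mem_piFinset, mem_filter, mem_range] at hx hy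
    funext j
    have h1 := sum_sub_pow_eq_of_moments (j := j) (by omega) a h
    have hz : ∀ u : ℕ, u % r = a → (u : ℤ) - a = r * (u / r : ℕ) := by
      intro u hu
      have := Nat.div_add_mod u r
      rw [hu] at this
      have h2 : ((r * (u / r) + a : ℕ) : ℤ) = u := by rw [this]
      push_cast at h2 ⊢
      linarith
    have hs : ∀ w : Fin b → ℕ, (∀ i, w i < N ∧ w i % r = a) →
        ∑ i, ((w i : ℤ) - a) ^ (j : ℕ) =
          (r : ℤ) ^ (j : ℕ) * ∑ i, ((w i / r : ℕ) : ℤ) ^ (j : ℕ) := by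
      intro w hw
      rw [mul_sum]
      exact sum_congr rfl fun i _ => by rw [hz _ (hw i).2, mul_pow]
    rw [hs x hx, hs y hy] at h1
    have hr' : (r : ℤ) ≠ 0 := by exact_mod_cast hr.ne'
    have h2 := mul_left_cancel₀ (pow_ne_zero _ hr') h1
    simpa [Finset.sum_apply, moments] using h2

/-- If all variables of the second block are congruent to `a` modulo `r`, the `j`-th power sum of
the first block about `a` is determined modulo `r ^ j`, and Linnik's lemma counts the first
block. -/
theorem energy_distinct_class_le {d b N r : ℕ} (a : ℕ) (hr : r.Prime) (hd : d < r) (hd0 : 0 < d)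
    (hN : N ≤ r ^ d) :
    energy (fun z : (Fin d → ℕ) × (Fin b → ℕ) => ∑ i, moments d (z.1 i) + ∑ i, moments d (z.2 i))
      ({x ∈ Fintype.piFinset (fun _ : Fin d => range N) | ∀ i j, x i % r = x j % r → i = j} ×ˢ
        Fintype.piFinset fun _ => {x ∈ range N | x % r = a}) ≤
      N ^ d * (r ^ (d * (d - 1) / 2) * d ^ d) * meanValue d b (N / r + 1) := by
  classical
  set D := {x ∈ Fintype.piFinset (fun _ : Fin d => range N) | ∀ i j, x i % r = x j % r → i = j}
    with hD
  refine (energy_prod_le (fun x : Fin d → ℕ => ∑ i, moments d (x i))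
    (fun x : Fin b → ℕ => ∑ i, moments d (x i)) D _
    (fun z => ∀ j : ℕ, 1 ≤ j → j ≤ d →
      (r : ℤ) ^ j ∣ ∑ i, ((z.1 i : ℤ) - a) ^ j - ∑ i, ((z.2 i : ℤ) - a) ^ j) ?_).trans ?_
  · intro x _ y _ u hu v hv h j _ hj
    simp only [Fintype.mem_piFinset, mem_filter, mem_range] at hu hv
    obtain ⟨L, hL⟩ := exists_hom_moments d j hj a
    have h1 := congrArg L h
    simp only [map_add, map_sum, hL] at h1
    have hdvd : ∀ w : Fin b → ℕ, (∀ i, w i < N ∧ w i % r = a) →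
        (r : ℤ) ^ j ∣ ∑ i, ((w i : ℤ) - a) ^ j := by
      intro w hw
      refine dvd_sum fun i _ => pow_dvd_pow_of_dvd ?_ _
      have := (hw i).2
      rw [← this]
      have := Nat.mod_modEq (w i) r
      exact (Nat.modEq_iff_dvd.1 this)
    have h2 : ∑ i, ((x i : ℤ) - a) ^ j - ∑ i, ((y i : ℤ) - a) ^ j =
        ∑ i, ((v i : ℤ) - a) ^ j - ∑ i, ((u i : ℤ) - a) ^ j := by linarith
    rw [h2]
    exact dvd_sub (hdvd v hv) (hdvd u hu)
  · refine Nat.mul_le_mul ?_ (energy_class_le d b N r a hr.pos)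
    have hDN : #D ≤ N ^ d := by
      refine (card_filter_le _ _).trans ?_
      simp [Fintype.card_piFinset]
    refine le_trans ?_ (Nat.mul_le_mul_right _ hDN)
    rw [mul_comm]
    refine card_le_mul_card_image_of_maps_to (f := Prod.snd) (t := D) ?_ _ ?_
    · intro z hz
      exact (mem_product.1 (mem_filter.1 hz).1).2
    · intro y _
      refine le_trans ?_ (card_linnik_le hr hd hd0 hN a (fun j => ∑ i, ((y i : ℤ) - a) ^ j))
      refine card_le_card_of_injOn Prod.fst ?_ ?_
      · rintro ⟨x, y'⟩ hz
        simp only [coe_filter, mem_filter, mem_product, Set.mem_ofPred_eq, hD] at hz ⊢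
        obtain ⟨⟨⟨hx, _⟩, hc⟩, rfl⟩ := hz
        exact ⟨hx.1, hx.2, hc⟩
      · rintro ⟨x, y'⟩ hz ⟨x', y''⟩ hz' h
        simp only [coe_filter, mem_filter, Set.mem_ofPred_eq] at hz hz' h
        rw [h, hz.2, hz'.2]

theorem meanValue_add_le_pow_mul (d c b N : ℕ) :
    meanValue d (c + b) N ≤ N ^ (2 * c) * meanValue d b N := by
  classical
  calc meanValue d (c + b) N ≤ energy (fun z : (Fin c → ℕ) × (Fin b → ℕ) =>
        ∑ i, moments d (z.1 i) + ∑ i, moments d (z.2 i))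
        (Fintype.piFinset (fun _ => range N) ×ˢ Fintype.piFinset fun _ => range N) := by
        refine energy_le_of_injOn
          (fun x => (fun i => x (Fin.castAdd b i), fun i => x (Fin.natAdd c i))) ?_ ?_ ?_
        · intro x hx
          simp only [Fintype.mem_piFinset, mem_product] at hx ⊢
          exact ⟨fun i => hx _, fun i => hx _⟩
        · intro x _ y _ h
          simp only [Prod.mk.injEq] at h
          funext i
          exact Fin.addCases (fun i => congrFun h.1 i) (fun i => congrFun h.2 i) i
        · intro x _ y _ h
          simpa [Fin.sum_univ_add] using h
    _ ≤ #{z ∈ Fintype.piFinset (fun _ : Fin c => range N) ×ˢ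
          Fintype.piFinset (fun _ : Fin c => range N) | True} * meanValue d b N :=
        energy_prod_le (fun x : Fin c → ℕ => ∑ i, moments d (x i))
          (fun x : Fin b → ℕ => ∑ i, moments d (x i)) _ _ (fun _ => True) (by simp)
    _ = _ := by
        simp [Fintype.card_piFinset, two_mul, pow_add]

/-- The variables may be moved into one residue class modulo `r`, at a cost depending only on the
number of classes in which they lie. -/
theorem energy_few_classes_le {d B N r : ℕ} (hB : 0 < B) (hr : 0 < r) (R : Finset ℕ) :
    energy (fun x : Fin B → ℕ => ∑ i, moments d (x i))
      (Fintype.piFinset fun _ => {x ∈ range N | x % r ∈ R}) ≤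
      #R ^ (2 * B) * meanValue d B (N / r + 1) := by
  have h := energy_prod_pow_le (fun _ : Unit => (0 : Fin (d + 1) → ℤ)) {()} (moments d)
    {x ∈ range N | x % r ∈ R} R (fun x => x % r) (fun x hx => (mem_filter.1 hx).2) hB
    (meanValue d B (N / r + 1)) ?_
  · refine le_trans (energy_le_of_injOn (fun x => ((), x)) ?_ ?_ ?_) h
    · intro x hx; simpa using hx
    · intro x _ y _ h; simpa using h
    · intro x _ y _ h; simpa using h
  · intro a _
    refine le_trans (energy_le_of_injOn (fun z => z.2) ?_ ?_ ?_) (energy_class_le d B N r a hr)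
    · intro x hx
      simp only [mem_product, Fintype.mem_piFinset, mem_filter] at hx ⊢
      exact fun i => ⟨(hx.2 i).1.1, (hx.2 i).2⟩
    · intro x _ y _ h
      exact Prod.ext rfl h
    · intro x _ y _ h
      simpa using h

/-- If `f` takes at least `n` values, its arguments can be permuted so that the first `n` values are
distinct. -/
theorem exists_perm_of_card_image {n b : ℕ} (f : Fin (n + b) → ℕ) (h : n ≤ #(univ.image f)) :
    ∃ σ : Equiv.Perm (Fin (n + b)), ∀ i j : Fin n,
      f (σ (Fin.castAdd b i)) = f (σ (Fin.castAdd b j)) → i = j := by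
  classical
  obtain ⟨T, hT, hTc⟩ := exists_subset_card_eq h
  have hT' : ∀ t : T, ∃ i, f i = t := fun t => by simpa using mem_image.1 (hT t.2)
  choose g hg using hT'
  let e : Fin n ≃ T := (T.equivFinOfCardEq hTc).symm
  have hinj : Function.Injective (fun i => g (e i)) := by
    intro i j hij
    have := congrArg f hij
    simp only [hg] at this
    exact e.injective (Subtype.ext this)
  have hinj2 : Function.Injective (Fin.castAdd b : Fin n → Fin (n + b)) :=
    Fin.castAdd_injective n b
  let E : {x // x ∈ Set.range (Fin.castAdd b : Fin n → Fin (n + b))} ≃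
      {x // x ∈ Set.range (fun i => g (e i))} :=
    (Equiv.ofInjective _ hinj2).symm.trans (Equiv.ofInjective _ hinj)
  refine ⟨E.extendSubtype, fun i j hij => ?_⟩
  have hE : ∀ i : Fin n, E.extendSubtype (Fin.castAdd b i) = g (e i) := by
    intro i
    rw [Equiv.extendSubtype_apply_of_mem _ _ ⟨i, rfl⟩]
    have : (Equiv.ofInjective _ hinj2).symm ⟨Fin.castAdd b i, ⟨i, rfl⟩⟩ = i :=
      Equiv.ofInjective_symm_apply hinj2 i
    simp only [E, Equiv.trans_apply, this, Equiv.ofInjective_apply]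
  rw [hE, hE, hg, hg] at hij
  exact e.injective (Subtype.ext hij)

/-- One step of Vinogradov's iteration: modulo a prime `r` with `r ^ d ≥ N`, either `d` of the
variables are distinct, and Linnik's lemma applies, or the variables lie in fewer than `d`
classes. -/
theorem meanValue_add_le {d b N r : ℕ} (hr : r.Prime) (hd : d < r) (hd0 : 0 < d) (hN0 : 0 < N)
    (hN : N ≤ r ^ d) (hb : d ^ 2 ≤ b) :
    meanValue d (d + b) N ≤
      2 * ((d + b).factorial ^ 2 * d ^ d + 4 ^ d * d ^ (2 * (d + b))) *
        (r ^ (2 * b + d * (d - 1) / 2) * N ^ d * meanValue d b (N / r + 1)) := by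
  classical
  have hb0 : 0 < b := lt_of_lt_of_le (by positivity) hb
  have hr0 := hr.pos
  set J := meanValue d b (N / r + 1) with hJ
  set P := Fintype.piFinset (fun _ : Fin (d + b) => range N) with hP
  set W : Equiv.Perm (Fin (d + b)) → Finset (Fin (d + b) → ℕ) := fun σ =>
    {x ∈ P | ∀ i j : Fin d, x (σ (Fin.castAdd b i)) % r = x (σ (Fin.castAdd b j)) % r → i = j}
    with hW
  set I : Finset ℕ → Finset (Fin (d + b) → ℕ) := fun R =>
    Fintype.piFinset fun _ => {x ∈ range N | x % r ∈ R} with hI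
  have hcover : P ⊆ univ.biUnion W ∪ (powersetCard (d - 1) (range r)).biUnion I := by
    intro x hx
    rw [mem_union]
    rcases le_or_gt d #(univ.image fun i => x i % r) with h | h
    · left
      obtain ⟨σ, hσ⟩ := exists_perm_of_card_image (fun i => x i % r) h
      exact mem_biUnion.2 ⟨σ, mem_univ _, mem_filter.2 ⟨hx, hσ⟩⟩
    · right
      have hsub : (univ.image fun i => x i % r) ⊆ range r := by
        intro y hy
        obtain ⟨i, _, rfl⟩ := mem_image.1 hy
        exact mem_range.2 (Nat.mod_lt _ hr0)
      obtain ⟨R, hR1, hR2, hR3⟩ := exists_subsuperset_card_eq hsub (n := d - 1) (by omega)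
        (by rw [card_range]; omega)
      refine mem_biUnion.2 ⟨R, mem_powersetCard.2 ⟨hR2, hR3⟩, ?_⟩
      rw [hP, Fintype.mem_piFinset] at hx
      rw [hI, Fintype.mem_piFinset]
      exact fun i => mem_filter.2 ⟨hx i, hR1 (mem_image_of_mem _ (mem_univ i))⟩
  have hWσ : ∀ σ, energy (fun x : Fin (d + b) → ℕ => ∑ i, moments d (x i)) (W σ) ≤
      r ^ (2 * b) * (N ^ d * (r ^ (d * (d - 1) / 2) * d ^ d) * J) := by
    intro σ
    have h1 := energy_prod_pow_le (fun x : Fin d → ℕ => ∑ i, moments d (x i))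
      {x ∈ Fintype.piFinset (fun _ : Fin d => range N) | ∀ i j, x i % r = x j % r → i = j}
      (moments d) (range N) (range r) (fun x => x % r)
      (fun x _ => mem_range.2 (Nat.mod_lt _ hr0)) hb0 _
      (fun a _ => energy_distinct_class_le (b := b) a hr hd hd0 hN)
    rw [card_range] at h1
    refine le_trans (energy_le_of_injOn (fun x => (fun i => x (σ (Fin.castAdd b i)),
      fun i => x (σ (Fin.natAdd d i)))) ?_ ?_ ?_) h1
    · intro x hx
      simp only [hW, hP, mem_filter, Fintype.mem_piFinset, mem_product] at hx ⊢
      exact ⟨⟨fun i => hx.1 _, hx.2⟩, fun i => hx.1 _⟩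
    · intro x _ y _ h
      simp only [Prod.mk.injEq] at h
      have h2 : ∀ i, x (σ i) = y (σ i) := fun i =>
        Fin.addCases (fun i => congrFun h.1 i) (fun i => congrFun h.2 i) i
      funext i
      simpa using h2 (σ.symm i)
    · intro x _ y _ h
      simp only at h ⊢
      rw [← Equiv.sum_comp σ, ← Equiv.sum_comp σ (fun i => moments d (y i)), Fin.sum_univ_add,
        Fin.sum_univ_add] at h
      exact h
  have hNr : N / r + 1 ≤ 2 * r ^ (d - 1) := by
    have h1 : N / r ≤ r ^ (d - 1) := by
      refine Nat.div_le_of_le_mul ?_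
      rw [← pow_succ', Nat.sub_add_cancel hd0]; exact hN
    have h2 : 1 ≤ r ^ (d - 1) := Nat.one_le_pow _ _ hr0
    omega
  have hIR : ∀ R ∈ powersetCard (d - 1) (range r),
      energy (fun x : Fin (d + b) → ℕ => ∑ i, moments d (x i)) (I R) ≤
        d ^ (2 * (d + b)) * ((2 * r ^ (d - 1)) ^ (2 * d) * J) := by
    intro R hR
    refine (energy_few_classes_le (by omega) hr0 R).trans (Nat.mul_le_mul ?_ ?_)
    · refine Nat.pow_le_pow_left ?_ _
      rw [(mem_powersetCard.1 hR).2]; omega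
    · exact (meanValue_add_le_pow_mul d d b _).trans
        (Nat.mul_le_mul_right _ (Nat.pow_le_pow_left hNr _))
  have h1 : energy (fun x : Fin (d + b) → ℕ => ∑ i, moments d (x i)) (univ.biUnion W) ≤
      (d + b).factorial ^ 2 * (r ^ (2 * b) * (N ^ d * (r ^ (d * (d - 1) / 2) * d ^ d) * J)) := by
    refine (energy_biUnion_le _ _ _).trans ?_
    refine (Nat.mul_le_mul_left _ (sum_le_card_nsmul _ _ _ fun σ _ => hWσ σ)).trans (le_of_eq ?_)
    rw [card_univ, Fintype.card_perm, Fintype.card_fin, smul_eq_mul]; ring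
  have h2 : energy (fun x : Fin (d + b) → ℕ => ∑ i, moments d (x i))
      ((powersetCard (d - 1) (range r)).biUnion I) ≤
      (r ^ (d - 1)) ^ 2 * (d ^ (2 * (d + b)) * ((2 * r ^ (d - 1)) ^ (2 * d) * J)) := by
    refine (energy_biUnion_le _ _ _).trans ?_
    refine (Nat.mul_le_mul_left _ (sum_le_card_nsmul _ _ _ hIR)).trans ?_
    rw [card_powersetCard, card_range, smul_eq_mul, ← mul_assoc, ← sq]
    exact Nat.mul_le_mul_right _ (Nat.pow_le_pow_left (Nat.choose_le_pow _ _) _)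
  have h3 : (r ^ (d - 1)) ^ 2 * (d ^ (2 * (d + b)) * ((2 * r ^ (d - 1)) ^ (2 * d) * J)) ≤
      4 ^ d * d ^ (2 * (d + b)) * (r ^ (2 * b + d * (d - 1) / 2) * N ^ d * J) := by
    have e1 : (r ^ (d - 1)) ^ 2 * (r ^ (d - 1)) ^ (2 * d) ≤ r ^ (2 * b + d * (d - 1) / 2) := by
      rw [← pow_mul, ← pow_mul, ← pow_add]
      refine Nat.pow_le_pow_right hr0 ?_
      obtain ⟨e, rfl⟩ : ∃ e, d = e + 1 := ⟨d - 1, by omega⟩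
      simp only [Nat.add_sub_cancel]
      have : e * 2 + e * (2 * (e + 1)) ≤ 2 * b := by nlinarith
      omega
    have e2 : 1 ≤ N ^ d := Nat.one_le_pow _ _ hN0
    calc _ = 4 ^ d * d ^ (2 * (d + b)) *
            (((r ^ (d - 1)) ^ 2 * (r ^ (d - 1)) ^ (2 * d)) * 1 * J) := by
          rw [mul_pow 2, pow_mul 2 2 d]; ring
      _ ≤ _ := by gcongr
  have h4 : (d + b).factorial ^ 2 * (r ^ (2 * b) * (N ^ d * (r ^ (d * (d - 1) / 2) * d ^ d) * J)) =
      (d + b).factorial ^ 2 * d ^ d * (r ^ (2 * b + d * (d - 1) / 2) * N ^ d * J) := by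
    rw [pow_add]; ring
  calc meanValue d (d + b) N ≤ _ := energy_mono hcover
    _ ≤ _ := energy_union_le _ _ _
    _ ≤ 2 * ((d + b).factorial ^ 2 * d ^ d * (r ^ (2 * b + d * (d - 1) / 2) * N ^ d * J) +
        4 ^ d * d ^ (2 * (d + b)) * (r ^ (2 * b + d * (d - 1) / 2) * N ^ d * J)) := by
        rw [← h4]
        exact Nat.mul_le_mul_left _ (add_le_add h1 (h2.trans h3))
    _ = _ := by ring

theorem meanValue_le_pow (d b N : ℕ) : meanValue d b N ≤ N ^ (2 * b) := by
  refine (card_filter_le _ _).trans ?_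
  simp [Fintype.card_piFinset, two_mul, pow_add]

/-- A prime of the size of the `d`-th root of `N`, from Bertrand's postulate. -/
theorem exists_prime_of_root {d N : ℕ} (hd : 0 < d) (hN : 0 < N) :
    ∃ r : ℕ, r.Prime ∧ d < r ∧ N ≤ r ^ d ∧ (N : ℝ) ^ (1 / d : ℝ) ≤ r ∧
      (r : ℝ) ≤ (2 * d + 4) * (N : ℝ) ^ (1 / d : ℝ) := by
  set y : ℝ := (N : ℝ) ^ (1 / d : ℝ) with hy
  have hN1 : (1 : ℝ) ≤ N := by exact_mod_cast hN
  have hy1 : 1 ≤ y := Real.one_le_rpow hN1 (by positivity)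
  obtain ⟨r, hr, h1, h2⟩ := Nat.exists_prime_lt_and_le_two_mul (d + ⌈y⌉₊) (by omega)
  have h3 : y ≤ r := (Nat.le_ceil y).trans (by exact_mod_cast (by omega : ⌈y⌉₊ ≤ r))
  refine ⟨r, hr, by omega, ?_, h3, ?_⟩
  · have h4 : y ^ d = N := by
      rw [hy, ← Real.rpow_natCast, ← Real.rpow_mul (by positivity), one_div,
        inv_mul_cancel₀ (by positivity), Real.rpow_one]
    have h5 : (N : ℝ) ≤ (r : ℝ) ^ d := by
      rw [← h4]; exact pow_le_pow_left₀ (by linarith) h3 _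
    exact_mod_cast h5
  · have h4 : (r : ℝ) ≤ 2 * (d + ⌈y⌉₊) := by exact_mod_cast h2
    have h5 := Nat.ceil_lt_add_one (by linarith : 0 ≤ y)
    have h6 : (0 : ℝ) ≤ d := by positivity
    nlinarith

/-- **Vinogradov's mean value theorem**, with the excess `d (d + 1) / 2 * (1 - 1 / d) ^ l` for
`d ^ 2 + l d` pairs of variables. -/
theorem exists_meanValue_le {d : ℕ} (hd : 0 < d) (l : ℕ) :
    ∃ C : ℝ, 0 < C ∧ ∀ N : ℕ, 0 < N → (meanValue d (d ^ 2 + l * d) N : ℝ) ≤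
      C * (N : ℝ) ^ (2 * (d ^ 2 + l * d) - d * (d + 1) / 2 * (1 - (1 - 1 / d) ^ l) : ℝ) := by
  have hd1 : (1 : ℝ) ≤ d := by exact_mod_cast hd
  have hrho0 : (0 : ℝ) ≤ 1 - 1 / d := by
    rw [sub_nonneg, div_le_one (by linarith)]; exact hd1
  have hrho1 : (1 - 1 / d : ℝ) ≤ 1 := by
    rw [sub_le_self_iff]; positivity
  induction l with
  | zero =>
    refine ⟨1, one_pos, fun N hN => ?_⟩
    have h := meanValue_le_pow d (d ^ 2 + 0 * d) N
    have h2 : (2 * (d ^ 2 + (0 : ℕ) * d) - d * (d + 1) / 2 * (1 - (1 - 1 / d) ^ 0) : ℝ) =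
      ((2 * (d ^ 2 + 0 * d) : ℕ) : ℝ) := by push_cast; simp
    rw [h2, Real.rpow_natCast, one_mul]
    exact_mod_cast h
  | succ l ih =>
    obtain ⟨C, hC, ih⟩ := ih
    set E : ℝ := 2 * (d ^ 2 + l * d) - d * (d + 1) / 2 * (1 - (1 - 1 / d) ^ l) with hE
    have hE0 : 0 ≤ E := by
      have h1 : (0 : ℝ) ≤ (1 - 1 / d) ^ l := pow_nonneg hrho0 l
      have h2 : (0 : ℝ) ≤ l * d := by positivity
      have h3 : (d * (d + 1) / 2 : ℝ) * (1 - (1 - 1 / d) ^ l) ≤ d * (d + 1) / 2 * 1 := by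
        gcongr; linarith
      nlinarith
    set b := d ^ 2 + l * d with hb
    set m := 2 * b + d * (d - 1) / 2 with hm
    set K : ℕ := 2 * ((d + b).factorial ^ 2 * d ^ d + 4 ^ d * d ^ (2 * (d + b))) with hK
    have hK0 : 0 < K := by positivity
    refine ⟨K * ((2 * d + 4) ^ m * (C * 2 ^ E)), by positivity, fun N hN => ?_⟩
    obtain ⟨r, hr, hdr, hNr, hr1, hr2⟩ := exists_prime_of_root hd hN
    set y : ℝ := (N : ℝ) ^ (1 / d : ℝ) with hy
    have hN1 : (1 : ℝ) ≤ N := by exact_mod_cast hN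
    have hN0 : (0 : ℝ) < N := by linarith
    have hy1 : 1 ≤ y := Real.one_le_rpow hN1 (by positivity)
    have hstep := meanValue_add_le (b := b) hr hdr hd hN hNr (by rw [hb]; omega)
    rw [show d ^ 2 + (l + 1) * d = d + b by rw [hb]; ring]
    have hN' : ((N / r + 1 : ℕ) : ℝ) ≤ 2 * (N : ℝ) ^ (1 - 1 / d : ℝ) := by
      have h1 : ((N / r : ℕ) : ℝ) ≤ (N : ℝ) / r := Nat.cast_div_le
      have h2 : (N : ℝ) / r ≤ N / y := by gcongr
      have h3 : (N : ℝ) / y = (N : ℝ) ^ (1 - 1 / d : ℝ) := by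
        rw [Real.rpow_sub hN0, Real.rpow_one]
      have h4 : (1 : ℝ) ≤ (N : ℝ) ^ (1 - 1 / d : ℝ) := Real.one_le_rpow hN1 hrho0
      push_cast
      linarith
    have hJ := ih (N / r + 1) (Nat.succ_pos _)
    have hmd : (m : ℝ) = 2 * (d ^ 2 + l * d) + d * (d - 1) / 2 := by
      have h2 : 2 ∣ d * (d - 1) := (Nat.even_mul_pred_self d).two_dvd
      obtain ⟨t, ht⟩ := h2
      have ht' : (d : ℝ) * (d - 1) = 2 * t := by
        have := congrArg (Nat.cast : ℕ → ℝ) ht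
        push_cast [Nat.cast_sub (show 1 ≤ d by omega)] at this
        exact this
      rw [hm, hb, ht, Nat.mul_div_cancel_left _ two_pos, ht']
      push_cast
      ring
    calc (meanValue d (d + b) N : ℝ)
        ≤ K * ((r : ℝ) ^ m * (N : ℝ) ^ d * meanValue d b (N / r + 1)) := by
          exact_mod_cast hstep
      _ ≤ K * (((2 * d + 4) * y) ^ m * (N : ℝ) ^ d *
            (C * (2 * (N : ℝ) ^ (1 - 1 / d : ℝ)) ^ E)) := by
          gcongr
          refine hJ.trans ?_
          gcongr
      _ = K * ((2 * d + 4) ^ m * (C * 2 ^ E)) *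
            (y ^ m * (N : ℝ) ^ d * ((N : ℝ) ^ (1 - 1 / d : ℝ)) ^ E) := by
          rw [mul_pow, Real.mul_rpow (by norm_num) (by positivity)]; ring
      _ = _ := by
          congr 1
          rw [hy, ← Real.rpow_natCast, ← Real.rpow_natCast, ← Real.rpow_mul hN0.le,
            ← Real.rpow_mul hN0.le, ← Real.rpow_add hN0, ← Real.rpow_add hN0]
          congr 1
          rw [hmd, hE]
          push_cast
          have : (d : ℝ) ≠ 0 := by positivity
          rw [pow_succ (1 - 1 / (d : ℝ)) l]
          generalize (1 - 1 / (d : ℝ)) ^ l = w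
          field_simp
          ring

end MeanValue

/-! ### Vinogradov's bilinear inequality for polynomial phases -/

section Bilinear

variable {R : Type*} [CommRing R]

theorem norm_sum_addChar_pow [Finite R] {α : Type*} (ψ : AddChar R ℂ) (A : Finset α) (g : α → R)
    (b : ℕ) :
    ((‖∑ x ∈ A, ψ (g x)‖ ^ (2 * b) : ℝ) : ℂ) =
      ∑ z ∈ Fintype.piFinset (fun _ : Fin b => A) ×ˢ Fintype.piFinset (fun _ : Fin b => A),
        ψ (∑ i, g (z.1 i) - ∑ i, g (z.2 i)) := by
  rw [pow_mul, Complex.ofReal_pow, Complex.ofReal_pow, ← Complex.mul_conj', mul_pow, ← map_pow]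
  have h := sum_piFinset_addChar (κ := Fin b) ψ g A
  rw [Fintype.card_fin] at h
  rw [← h, map_sum, sum_mul_sum, ← sum_product']
  refine sum_congr rfl fun z _ => ?_
  rw [sub_eq_add_neg, AddChar.map_add_eq_mul, AddChar.map_neg_eq_conj]

theorem sum_range_addChar_eq_zero {ψ : AddChar R ℂ} {u c : R} {n : ℕ} (h1 : ψ u ≠ 1)
    (hn : (n : R) * u = 0) : ∑ t ∈ range n, ψ (u * ((t : R) - c)) = 0 := by
  have h2 : ∀ t : ℕ, ψ (u * ((t : R) - c)) = ψ u ^ t * ψ (-(u * c)) := by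
    intro t
    rw [← AddChar.map_nsmul_eq_pow, ← AddChar.map_add_eq_mul, nsmul_eq_mul]
    congr 1; ring
  simp_rw [h2]
  rw [← sum_mul, geom_sum_eq h1, ← AddChar.map_nsmul_eq_pow, nsmul_eq_mul, hn]
  simp

/-- The differences of the power sums of the two halves of a pair of tuples. -/
def momentDiff (d b : ℕ) (z : (Fin b → ℕ) × (Fin b → ℕ)) : Fin (d + 1) → ℤ :=
  ∑ i, moments d (z.1 i) - ∑ i, moments d (z.2 i)

theorem card_momentDiff_eq_le (d b P : ℕ) (X : Fin (d + 1) → ℤ) :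
    #{z ∈ Fintype.piFinset (fun _ : Fin b => range P) ×ˢ Fintype.piFinset (fun _ => range P) |
      momentDiff d b z = X} ≤ meanValue d b P := by
  refine le_trans (le_of_eq ?_) (card_shift_le_energy
    (fun x : Fin b → ℕ => ∑ i, moments d (x i)) (Fintype.piFinset fun _ => range P) X)
  congr 1
  ext z
  simp only [mem_filter, momentDiff, sub_eq_iff_eq_add]

theorem momentDiff_add_mem {d b P : ℕ} (hb : 0 < b) (hP : 0 < P)
    {z : (Fin b → ℕ) × (Fin b → ℕ)}
    (hz : z ∈ Fintype.piFinset (fun _ : Fin b => range P) ×ˢ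
      Fintype.piFinset (fun _ : Fin b => range P)) (j : Fin (d + 1)) :
    ∃ t < 3 * b * P ^ (j : ℕ), (t : ℤ) = momentDiff d b z j + b * P ^ (j : ℕ) := by
  simp only [mem_product, Fintype.mem_piFinset, mem_range] at hz
  have key : ∀ x : Fin b → ℕ, (∀ i, x i < P) →
      0 ≤ ∑ i, (x i : ℤ) ^ (j : ℕ) ∧ ∑ i, (x i : ℤ) ^ (j : ℕ) ≤ b * (P : ℤ) ^ (j : ℕ) := by
    intro x hx
    refine ⟨sum_nonneg fun i _ => by positivity, ?_⟩
    calc ∑ i, (x i : ℤ) ^ (j : ℕ) ≤ ∑ _i : Fin b, (P : ℤ) ^ (j : ℕ) :=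
          sum_le_sum fun i _ => pow_le_pow_left₀ (by positivity) (by exact_mod_cast (hx i).le) _
      _ = _ := by simp
  have h1 := key z.1 hz.1
  have h2 := key z.2 hz.2
  have h3 : momentDiff d b z j = ∑ i, (z.1 i : ℤ) ^ (j : ℕ) - ∑ i, (z.2 i : ℤ) ^ (j : ℕ) := by
    simp [momentDiff, moments, Finset.sum_apply]
  have h4 : (0 : ℤ) < b * (P : ℤ) ^ (j : ℕ) := by positivity
  refine ⟨(momentDiff d b z j + b * P ^ (j : ℕ)).toNat, ?_, ?_⟩
  · have : ((3 * b * P ^ (j : ℕ) : ℕ) : ℤ) = 3 * (b * (P : ℤ) ^ (j : ℕ)) := by push_cast; ring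
    omega
  · rw [Int.toNat_of_nonneg]; omega

/-- **Vinogradov's bilinear inequality** for `∑ ψ(∑ⱼ aⱼ (x y)ʲ)`. For the degrees `j ∈ W` the
coefficient `aⱼ` has exact denominator `r j`, which is gained over the trivial estimate. -/
theorem norm_bilinear_pow_le [Finite R] {d b P : ℕ} (hb : 0 < b) (hP : 0 < P) (ψ : AddChar R ℂ)
    (a : Fin (d + 1) → R) (W : Finset (Fin (d + 1))) (r : Fin (d + 1) → ℕ)
    (hr : ∀ j ∈ W, r j ∣ P ^ (j : ℕ)) (har : ∀ j ∈ W, (r j : R) * a j = 0)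
    (hψ : ∀ j ∈ W, ∀ x : ℤ, ψ (a j * x) = 1 → (r j : ℤ) ∣ x) :
    ‖∑ x ∈ range P, ∑ y ∈ range P, ψ (∑ j, a j * ((x : R) * y) ^ (j : ℕ))‖ ^ (2 * b * (2 * b)) *
        ∏ j ∈ W, (r j : ℝ) ≤
      (P : ℝ) ^ (4 * b * (2 * b - 1)) * (meanValue d b P : ℝ) ^ 2 *
        ∏ j : Fin (d + 1), (3 * b * (P : ℝ) ^ (j : ℕ)) ^ 2 := by
  classical
  set Z := Fintype.piFinset (fun _ : Fin b => range P) ×ˢ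
    Fintype.piFinset (fun _ : Fin b => range P) with hZ
  set J := meanValue d b P with hJ
  set T : (Fin (d + 1) → ℤ) → ℂ := fun X =>
    ∑ y ∈ range P, ψ (∑ j, a j * (X j : R) * (y : R) ^ (j : ℕ)) with hT
  set B : Finset (Fin (d + 1) → ℕ) :=
    Fintype.piFinset fun j => range (3 * b * P ^ (j : ℕ)) with hB
  set s : (Fin (d + 1) → ℕ) → Fin (d + 1) → ℤ := fun t j => (t j : ℤ) - b * P ^ (j : ℕ) with hs
  have hcardZ : (#Z : ℝ) = (P : ℝ) ^ (2 * b) := by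
    rw [hZ, card_product]; simp [Fintype.card_piFinset, two_mul, pow_add]
  have hexp : ∀ X : Fin (d + 1) → ℤ, ∀ z : (Fin b → ℕ) × (Fin b → ℕ),
      ∑ i, ∑ j, a j * (X j : R) * (z.1 i : R) ^ (j : ℕ) -
        ∑ i, ∑ j, a j * (X j : R) * (z.2 i : R) ^ (j : ℕ) =
      ∑ j, a j * (X j : R) * (momentDiff d b z j : R) := by
    intro X z
    rw [sum_comm, sum_comm (f := fun i j => a j * (X j : R) * (z.2 i : R) ^ (j : ℕ)),
      ← sum_sub_distrib]
    refine sum_congr rfl fun j _ => ?_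
    simp [momentDiff, moments, Finset.sum_apply, mul_sub, mul_sum]
  -- Hölder in `y`
  have h1 : ‖∑ x ∈ range P, ∑ y ∈ range P, ψ (∑ j, a j * ((x : R) * y) ^ (j : ℕ))‖ ^ (2 * b) ≤
      (P : ℝ) ^ (2 * b - 1) * ∑ z ∈ Z, ‖T (momentDiff d b z)‖ := by
    rw [sum_comm]
    refine (pow_le_pow_left₀ (norm_nonneg _) (norm_sum_le _ _) _).trans ?_
    have h := pow_sum_le_card_mul_sum_pow (s := range P)
      (f := fun y => ‖∑ x ∈ range P, ψ (∑ j, a j * ((x : R) * y) ^ (j : ℕ))‖)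
      (fun _ _ => norm_nonneg _) (2 * b - 1)
    rw [show 2 * b - 1 + 1 = 2 * b by omega, card_range] at h
    refine h.trans (mul_le_mul_of_nonneg_left ?_ (by positivity))
    have h2 : ((∑ y ∈ range P, ‖∑ x ∈ range P, ψ (∑ j, a j * ((x : R) * y) ^ (j : ℕ))‖ ^ (2 * b) :
        ℝ) : ℂ) = ∑ z ∈ Z, T (momentDiff d b z) := by
      rw [Complex.ofReal_sum]
      simp_rw [norm_sum_addChar_pow]
      rw [sum_comm]
      refine sum_congr rfl fun z _ => sum_congr rfl fun y _ => ?_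
      congr 1
      have := hexp (fun j => (y : ℤ) ^ (j : ℕ)) z
      push_cast at this
      rw [show (∑ j, a j * (momentDiff d b z j : R) * (y : R) ^ (j : ℕ)) =
        ∑ j, a j * (y : R) ^ (j : ℕ) * (momentDiff d b z j : R) from
        sum_congr rfl fun j _ => by ring, ← this]
      congr 1 <;> exact sum_congr rfl fun i _ => sum_congr rfl fun j _ => by ring
    have h3 : (∑ y ∈ range P, ‖∑ x ∈ range P, ψ (∑ j, a j * ((x : R) * y) ^ (j : ℕ))‖ ^ (2 * b)) =
        ‖∑ z ∈ Z, T (momentDiff d b z)‖ := by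
      rw [← h2, Complex.norm_real, Real.norm_of_nonneg]
      exact sum_nonneg fun _ _ => by positivity
    rw [h3]
    exact norm_sum_le _ _
  -- Hölder in the power sums
  have h2 : (∑ z ∈ Z, ‖T (momentDiff d b z)‖) ^ (2 * b) ≤
      ((P : ℝ) ^ (2 * b)) ^ (2 * b - 1) * (J * ∑ t ∈ B, ‖T (s t)‖ ^ (2 * b)) := by
    have h := pow_sum_le_card_mul_sum_pow (s := Z)
      (f := fun z => ‖T (momentDiff d b z)‖) (fun _ _ => norm_nonneg _) (2 * b - 1)
    rw [show 2 * b - 1 + 1 = 2 * b by omega, hcardZ] at h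
    refine h.trans (mul_le_mul_of_nonneg_left ?_ (by positivity))
    have hmaps : ∀ z ∈ Z, momentDiff d b z ∈ B.image s := by
      intro z hz
      choose t ht1 ht2 using fun j => momentDiff_add_mem (d := d) hb hP hz j
      refine mem_image.2 ⟨t, ?_, ?_⟩
      · rw [hB, Fintype.mem_piFinset]; exact fun j => mem_range.2 (ht1 j)
      · funext j; simp only [hs]; rw [ht2]; ring
    have hsinj : Set.InjOn s B := by
      intro t _ t' _ h
      funext j
      have := congrFun h j
      simp only [hs] at this
      omega
    rw [← sum_fiberwise_of_maps_to hmaps, sum_image hsinj, mul_sum]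
    refine sum_le_sum fun t _ => ?_
    calc _ = ∑ z ∈ Z with momentDiff d b z = s t, ‖T (s t)‖ ^ (2 * b) :=
          sum_congr rfl fun z hz => by rw [(mem_filter.1 hz).2]
      _ ≤ _ := by
          rw [sum_const, nsmul_eq_mul]
          refine mul_le_mul_of_nonneg_right ?_ (by positivity)
          exact_mod_cast card_momentDiff_eq_le d b P (s t)
  -- Orthogonality in the degrees of `W`
  have h3 : ∑ t ∈ B, ‖T (s t)‖ ^ (2 * b) ≤
      #{z ∈ Z | ∀ j ∈ W, (r j : ℤ) ∣ momentDiff d b z j} *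
        ∏ j : Fin (d + 1), (3 * b * (P : ℝ) ^ (j : ℕ)) := by
    have e1 : ((∑ t ∈ B, ‖T (s t)‖ ^ (2 * b) : ℝ) : ℂ) = ∑ z ∈ Z, ∏ j : Fin (d + 1),
        ∑ t ∈ range (3 * b * P ^ (j : ℕ)),
          ψ (a j * (momentDiff d b z j : R) * ((t : R) - (b * P ^ (j : ℕ) : ℕ))) := by
      rw [Complex.ofReal_sum]
      simp_rw [hT, norm_sum_addChar_pow]
      rw [sum_comm]
      refine sum_congr rfl fun z _ => ?_
      rw [prod_univ_sum]
      refine sum_congr rfl fun t _ => ?_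
      rw [hexp]
      have hp : ∀ g : Fin (d + 1) → R, ψ (∑ j, g j) = ∏ j, ψ (g j) := fun g => by
        have := map_prod ψ.toMonoidHom (fun j => Multiplicative.ofAdd (g j)) univ
        rwa [← ofAdd_sum] at this
      rw [hp]
      refine prod_congr rfl fun j _ => ?_
      congr 1
      simp only [hs]
      push_cast
      ring
    have e2 : (∑ t ∈ B, ‖T (s t)‖ ^ (2 * b)) = ‖((∑ t ∈ B, ‖T (s t)‖ ^ (2 * b) : ℝ) : ℂ)‖ := by
      rw [Complex.norm_real, Real.norm_of_nonneg]
      exact sum_nonneg fun _ _ => by positivity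
    rw [e2, e1]
    refine (norm_sum_le _ _).trans ?_
    rw [← nsmul_eq_mul, ← sum_const, sum_filter]
    refine sum_le_sum fun z _ => ?_
    rw [norm_prod]
    split_ifs with hz
    · refine prod_le_prod (fun _ _ => norm_nonneg _) fun j _ => ?_
      refine (norm_sum_le _ _).trans ?_
      simp [AddChar.norm_apply]
    · push Not at hz
      obtain ⟨j, hj, hnd⟩ := hz
      refine (prod_eq_zero (mem_univ j) ?_).le
      rw [norm_eq_zero]
      refine sum_range_addChar_eq_zero (fun h => hnd (hψ j hj _ h)) ?_
      obtain ⟨m, hm⟩ := hr j hj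
      rw [hm]
      push_cast
      linear_combination (3 * b * m * (momentDiff d b z j : R)) * har j hj
  -- Counting the power sums divisible by the denominators
  have h4 : (#{z ∈ Z | ∀ j ∈ W, (r j : ℤ) ∣ momentDiff d b z j} : ℝ) * ∏ j ∈ W, (r j : ℝ) ≤
      J * ∏ j : Fin (d + 1), (3 * b * (P : ℝ) ^ (j : ℕ)) := by
    set B' : Finset (Fin (d + 1) → ℕ) := Fintype.piFinset fun j =>
      {t ∈ range (3 * b * P ^ (j : ℕ)) | j ∈ W → r j ∣ t} with hB'
    have hmaps : ∀ z ∈ {z ∈ Z | ∀ j ∈ W, (r j : ℤ) ∣ momentDiff d b z j},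
        momentDiff d b z ∈ B'.image s := by
      intro z hz
      rw [mem_filter] at hz
      choose t ht1 ht2 using fun j => momentDiff_add_mem (d := d) hb hP hz.1 j
      refine mem_image.2 ⟨t, ?_, ?_⟩
      · rw [hB', Fintype.mem_piFinset]
        refine fun j => mem_filter.2 ⟨mem_range.2 (ht1 j), fun hj => ?_⟩
        have h1 : (r j : ℤ) ∣ (t j : ℤ) := by
          rw [ht2]
          refine dvd_add (hz.2 j hj) (Dvd.dvd.mul_left ?_ _)
          exact_mod_cast hr j hj
        exact_mod_cast h1
      · funext j; simp only [hs]; rw [ht2]; ring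
    have hc1 : #{z ∈ Z | ∀ j ∈ W, (r j : ℤ) ∣ momentDiff d b z j} ≤ J * #B' := by
      refine (card_le_mul_card_image_of_maps_to hmaps J ?_).trans
        (Nat.mul_le_mul_left _ card_image_le)
      intro X _
      refine le_trans (card_le_card ?_) (card_momentDiff_eq_le d b P X)
      exact filter_subset_filter _ (filter_subset _ _)
    have hc2 : (#B' : ℝ) * ∏ j ∈ W, (r j : ℝ) = ∏ j : Fin (d + 1), (3 * b * (P : ℝ) ^ (j : ℕ)) := by
      rw [hB', Fintype.card_piFinset, Nat.cast_prod,
        show ∏ j ∈ W, (r j : ℝ) = ∏ j : Fin (d + 1), if j ∈ W then (r j : ℝ) else 1 by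
          rw [prod_ite_mem, univ_inter], ← prod_mul_distrib]
      refine prod_congr rfl fun j _ => ?_
      split_ifs with hj
      · obtain ⟨m, hm⟩ := hr j hj
        have hr0 : 0 < r j := Nat.pos_of_ne_zero fun h => by
          rw [h, zero_mul] at hm
          exact (pow_pos hP _).ne' hm
        have : #{t ∈ range (3 * b * P ^ (j : ℕ)) | j ∈ W → r j ∣ t} = 3 * b * m := by
          have e : {t ∈ range (3 * b * P ^ (j : ℕ)) | j ∈ W → r j ∣ t} =
              (range (3 * b * m)).image (r j * ·) := by
            ext t
            simp only [mem_filter, mem_range, mem_image, hj, true_imp_iff, hm]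
            constructor
            · rintro ⟨h1, u, rfl⟩
              refine ⟨u, ?_, rfl⟩
              refine lt_of_mul_lt_mul_left (a := r j) ?_ hr0.le
              linarith
            · rintro ⟨u, hu, rfl⟩
              refine ⟨?_, dvd_mul_right _ _⟩
              have := Nat.mul_lt_mul_of_pos_left hu hr0
              linarith
          rw [e, card_image_of_injective _ (fun x y h => Nat.eq_of_mul_eq_mul_left hr0 h),
            card_range]
        rw [this]
        have hm' : (P : ℝ) ^ (j : ℕ) = r j * m := by exact_mod_cast hm
        rw [hm']; push_cast; ring
      · simp [hj]
    calc _ ≤ (J * #B' : ℝ) * ∏ j ∈ W, (r j : ℝ) := by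
          refine mul_le_mul_of_nonneg_right ?_ (by positivity)
          exact_mod_cast hc1
      _ = _ := by rw [mul_assoc, hc2]
  calc _ = (‖∑ x ∈ range P, ∑ y ∈ range P, ψ (∑ j, a j * ((x : R) * y) ^ (j : ℕ))‖ ^ (2 * b)) ^
          (2 * b) * ∏ j ∈ W, (r j : ℝ) := by rw [← pow_mul]
    _ ≤ ((P : ℝ) ^ (2 * b - 1) * ∑ z ∈ Z, ‖T (momentDiff d b z)‖) ^ (2 * b) *
          ∏ j ∈ W, (r j : ℝ) := by gcongr
    _ ≤ ((P : ℝ) ^ (2 * b - 1)) ^ (2 * b) * (((P : ℝ) ^ (2 * b)) ^ (2 * b - 1) * (J *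
          (#{z ∈ Z | ∀ j ∈ W, (r j : ℤ) ∣ momentDiff d b z j} *
            ∏ j : Fin (d + 1), (3 * b * (P : ℝ) ^ (j : ℕ))))) * ∏ j ∈ W, (r j : ℝ) := by
        rw [mul_pow]
        gcongr
        refine h2.trans ?_
        gcongr
    _ = ((P : ℝ) ^ (2 * b - 1)) ^ (2 * b) * ((P : ℝ) ^ (2 * b)) ^ (2 * b - 1) * J *
          (∏ j : Fin (d + 1), (3 * b * (P : ℝ) ^ (j : ℕ))) *
          (#{z ∈ Z | ∀ j ∈ W, (r j : ℤ) ∣ momentDiff d b z j} * ∏ j ∈ W, (r j : ℝ)) := by ring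
    _ ≤ ((P : ℝ) ^ (2 * b - 1)) ^ (2 * b) * ((P : ℝ) ^ (2 * b)) ^ (2 * b - 1) * J *
          (∏ j : Fin (d + 1), (3 * b * (P : ℝ) ^ (j : ℕ))) *
          (J * ∏ j : Fin (d + 1), (3 * b * (P : ℝ) ^ (j : ℕ))) := by gcongr
    _ = _ := by
        rw [prod_pow, ← pow_mul, ← pow_mul]
        have : (P : ℝ) ^ (4 * b * (2 * b - 1)) =
            (P : ℝ) ^ ((2 * b - 1) * (2 * b)) * (P : ℝ) ^ (2 * b * (2 * b - 1)) := by
          rw [← pow_add]; congr 1; ring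
        rw [this]; ring

end Bilinear

/-! ### The bilinear inequality with the mean value bound inserted -/

section Weyl

/-- The mean value theorem for `6 d ^ 2` pairs of variables, with one per cent of the critical
exponent as excess. -/
theorem exists_meanValue_six_le {d : ℕ} (hd : 0 < d) :
    ∃ C : ℝ, 0 < C ∧ ∀ N : ℕ, 0 < N → (meanValue d (6 * d ^ 2) N : ℝ) ≤
      C * (N : ℝ) ^ (2 * (6 * d ^ 2) - 99 / 200 * (d * (d + 1)) : ℝ) := by
  obtain ⟨C, hC, h⟩ := exists_meanValue_le hd (5 * d)
  refine ⟨C, hC, fun N hN => ?_⟩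
  have h1 := h N hN
  rw [show d ^ 2 + 5 * d * d = 6 * d ^ 2 by ring] at h1
  refine h1.trans (mul_le_mul_of_nonneg_left ?_ hC.le)
  have hd1 : (1 : ℝ) ≤ d := by exact_mod_cast hd
  have hrho0 : (0 : ℝ) ≤ 1 - 1 / d := by
    rw [sub_nonneg, div_le_one (by linarith)]; exact hd1
  -- `exp (-5) < 1 / 100`
  have hexp : (1 - 1 / d : ℝ) ^ (5 * d) ≤ 1 / 100 := by
    have h2 : (1 - 1 / d : ℝ) ≤ Real.exp (-(1 / d)) := by
      have := Real.add_one_le_exp (-(1 / d : ℝ)); linarith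
    have h3 : (1 - 1 / d : ℝ) ^ (5 * d) ≤ Real.exp (-(1 / d)) ^ (5 * d) :=
      pow_le_pow_left₀ hrho0 h2 _
    have h4 : Real.exp (-(1 / d : ℝ)) ^ (5 * d) = (Real.exp 1 ^ 5)⁻¹ := by
      rw [← Real.exp_nat_mul, ← Real.exp_nat_mul, ← Real.exp_neg]
      congr 1
      push_cast
      field_simp
    have h5 : (2.7 : ℝ) ≤ Real.exp 1 := by linarith [Real.exp_one_gt_d9]
    have h6 : (100 : ℝ) ≤ Real.exp 1 ^ 5 :=
      le_trans (by norm_num) (pow_le_pow_left₀ (by norm_num) h5 5)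
    rw [h4] at h3
    refine h3.trans ?_
    rw [one_div]
    exact inv_anti₀ (by norm_num) h6
  refine Real.rpow_le_rpow_of_exponent_le (by exact_mod_cast hN) ?_
  have h7 : (0 : ℝ) ≤ d * (d + 1) / 2 := by positivity
  push_cast
  nlinarith

/-- A double sum `∑ ψ(∑ⱼ aⱼ (x y)ʲ)` of degree `20 e` is shorter than trivial by a power of `P`
proportional to `1 / e ^ 2`, provided that the coefficients of degree between `10 e` and `12 e`
have denominators between `P ^ (5 e)` and `P ^ j`. -/
theorem exists_norm_bilinear_le {e : ℕ} (he : 0 < e) :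
    ∃ C : ℝ, 0 < C ∧ ∀ (R : Type) [CommRing R] [Finite R] (P : ℕ) (_ : 0 < P) (ψ : AddChar R ℂ)
      (a : Fin (20 * e + 1) → R) (r : Fin (20 * e + 1) → ℕ),
      (∀ j : Fin (20 * e + 1), 10 * e ≤ (j : ℕ) → (j : ℕ) ≤ 12 * e →
        r j ∣ P ^ (j : ℕ) ∧ P ^ (5 * e) ≤ r j ∧ (r j : R) * a j = 0 ∧
          ∀ x : ℤ, ψ (a j * x) = 1 → (r j : ℤ) ∣ x) →
      ‖∑ x ∈ range P, ∑ y ∈ range P, ψ (∑ j, a j * ((x : R) * y) ^ (j : ℕ))‖ ≤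
        C * (P : ℝ) ^ (2 - 1 / (4608000 * e ^ 2) : ℝ) := by
  set d := 20 * e with hd
  obtain ⟨C₁, hC₁, hJ⟩ := exists_meanValue_six_le (d := d) (by omega)
  set b := 6 * d ^ 2 with hb
  have hb0 : 0 < b := by positivity
  set n := 2 * b * (2 * b) with hn
  have hn0 : 0 < n := by positivity
  set K : ℝ := C₁ ^ 2 * (3 * b) ^ (2 * (d + 1)) with hK
  have hK0 : 0 < K := by positivity
  refine ⟨K ^ (1 / n : ℝ), by positivity, ?_⟩
  intro R _ _ P hP ψ a r h
  set S := ‖∑ x ∈ range P, ∑ y ∈ range P, ψ (∑ j, a j * ((x : R) * y) ^ (j : ℕ))‖ with hS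
  have hP1 : (1 : ℝ) ≤ P := by exact_mod_cast hP
  have hP0 : (0 : ℝ) < P := by linarith
  set W : Finset (Fin (d + 1)) := {j | 10 * e ≤ (j : ℕ) ∧ (j : ℕ) ≤ 12 * e} with hW
  have hW' : ∀ j ∈ W, 10 * e ≤ (j : ℕ) ∧ (j : ℕ) ≤ 12 * e := fun j hj => (mem_filter.1 hj).2
  have hWcard : 2 * e ≤ #W := by
    have : #(Finset.Icc (10 * e) (12 * e)) ≤ #W := by
      refine card_le_card_of_injOn (fun j => Fin.ofNat (d + 1) j) ?_ ?_
      · intro j hj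
        have := Finset.mem_Icc.1 hj
        have h2 : j % (d + 1) = j := Nat.mod_eq_of_lt (by omega)
        simp only [hW, coe_filter, mem_univ, true_and, Set.mem_ofPred_eq, Fin.val_ofNat, h2]
        exact this
      · intro i hi j hj hij
        have h1 := Finset.mem_Icc.1 hi
        have h2 := Finset.mem_Icc.1 hj
        have := congrArg Fin.val hij
        simp only [Fin.val_ofNat] at this
        rwa [Nat.mod_eq_of_lt (by omega), Nat.mod_eq_of_lt (by omega)] at this
    rw [Nat.card_Icc] at this
    omega
  have main := norm_bilinear_pow_le (d := d) hb0 hP ψ a W r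
    (fun j hj => (h j (hW' j hj).1 (hW' j hj).2).1)
    (fun j hj => (h j (hW' j hj).1 (hW' j hj).2).2.2.1)
    (fun j hj => (h j (hW' j hj).1 (hW' j hj).2).2.2.2)
  have hprod : (P : ℝ) ^ (10 * e ^ 2) ≤ ∏ j ∈ W, (r j : ℝ) := by
    calc (P : ℝ) ^ (10 * e ^ 2) ≤ ((P : ℝ) ^ (5 * e)) ^ #W := by
          rw [← pow_mul]
          refine pow_le_pow_right₀ hP1 ?_
          nlinarith
      _ = ∏ j ∈ W, (P : ℝ) ^ (5 * e) := by rw [prod_const]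
      _ ≤ _ := prod_le_prod (fun _ _ => by positivity) fun j hj => by
          exact_mod_cast (h j (hW' j hj).1 (hW' j hj).2).2.1
  have hprod2 : ∏ j : Fin (d + 1), (3 * b * (P : ℝ) ^ (j : ℕ)) ^ 2 =
      (3 * b) ^ (2 * (d + 1)) * (P : ℝ) ^ (d * (d + 1)) := by
    rw [prod_pow, prod_mul_distrib, prod_const, card_univ, Fintype.card_fin,
      prod_pow_eq_pow_sum, Fin.sum_univ_eq_sum_range (fun j => j) (d + 1), mul_pow, ← pow_mul,
      ← pow_mul, Finset.sum_range_id_mul_two]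
    congr 2 <;> simp [mul_comm]
  -- The denominators gain `P ^ (10 e ^ 2)`, and the excess of the mean value theorem costs at most
  -- `P ^ (d (d + 1) / 100)`, which is at most `P ^ (5 e ^ 2)`.
  have hE : S ^ n ≤ K * (P : ℝ) ^ (2 * n - 5 * e ^ 2 : ℝ) := by
    have h1 : S ^ n * (P : ℝ) ^ (10 * e ^ 2) ≤ (P : ℝ) ^ (4 * b * (2 * b - 1)) *
        (C₁ * (P : ℝ) ^ (2 * (6 * d ^ 2) - 99 / 200 * (d * (d + 1)) : ℝ)) ^ 2 *
        ((3 * b) ^ (2 * (d + 1)) * (P : ℝ) ^ (d * (d + 1))) := by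
      rw [← hprod2]
      refine le_trans (mul_le_mul_of_nonneg_left hprod (by positivity)) (main.trans ?_)
      gcongr
      exact hJ P hP
    have h2 : (P : ℝ) ^ (4 * b * (2 * b - 1)) *
        (C₁ * (P : ℝ) ^ (2 * (6 * d ^ 2) - 99 / 200 * (d * (d + 1)) : ℝ)) ^ 2 *
        ((3 * b) ^ (2 * (d + 1)) * (P : ℝ) ^ (d * (d + 1))) =
        K * (P : ℝ) ^ (2 * n + 1 / 100 * (d * (d + 1)) : ℝ) := by
      rw [hK, mul_pow, ← Real.rpow_natCast (P : ℝ) (4 * b * (2 * b - 1)),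
        ← Real.rpow_natCast (P : ℝ) (d * (d + 1)), ← Real.rpow_mul_natCast hP0.le]
      rw [show (2 * n + 1 / 100 * (d * (d + 1)) : ℝ) = ((4 * b * (2 * b - 1) : ℕ) : ℝ) +
        (2 * (6 * d ^ 2) - 99 / 200 * (d * (d + 1))) * (2 : ℕ) + ((d * (d + 1) : ℕ) : ℝ) by
          rw [hn]
          push_cast [Nat.cast_sub (show 1 ≤ 2 * b by omega)]
          rw [hb]; push_cast; ring, Real.rpow_add hP0, Real.rpow_add hP0]
      ring
    rw [h2, ← le_div_iff₀ (by positivity)] at h1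
    refine h1.trans (le_of_eq_of_le (mul_div_assoc _ _ _) ?_)
    refine mul_le_mul_of_nonneg_left ?_ hK0.le
    rw [← Real.rpow_natCast (P : ℝ) (10 * e ^ 2), ← Real.rpow_sub hP0]
    refine Real.rpow_le_rpow_of_exponent_le hP1 ?_
    have he1 : (1 : ℝ) ≤ e := by exact_mod_cast he
    rw [hd]
    push_cast
    nlinarith
  have hS0 : 0 ≤ S := norm_nonneg _
  have hnR : (n : ℝ) ≠ 0 := by positivity
  calc S = (S ^ n) ^ (1 / n : ℝ) := by
        rw [← Real.rpow_natCast S n, ← Real.rpow_mul hS0, mul_one_div_cancel hnR, Real.rpow_one]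
    _ ≤ (K * (P : ℝ) ^ (2 * n - 5 * e ^ 2 : ℝ)) ^ (1 / n : ℝ) :=
        Real.rpow_le_rpow (by positivity) hE (by positivity)
    _ = _ := by
        rw [Real.mul_rpow hK0.le (by positivity), ← Real.rpow_mul hP0.le]
        congr 2
        rw [hn, hb, hd]
        push_cast
        field_simp
        ring

end Weyl

/-! ### The Taylor series of the square root -/

section SquareRoot
variable {R : Type*} [CommRing R]

/-- The Taylor polynomial of degree `n` of `√(1 - 4 w)`, whose coefficients are given by the
Catalan numbers. -/
def sqrtTaylor (n : ℕ) (w : R) : R := 1 - 2 * ∑ j ∈ range n, (catalan j : R) * w ^ (j + 1)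

/-- The generating polynomial of the Catalan numbers satisfies `f = 1 + w f ^ 2` up to terms with
`w ^ n`. -/
theorem sqrtTaylor_sq {n : ℕ} {w : R} (hw : w ^ n = 0) : sqrtTaylor n w ^ 2 = 1 - 4 * w := by
  set f : Polynomial R := ∑ j ∈ range n, Polynomial.C (catalan j : R) * Polynomial.X ^ j with hf
  have hc : ∀ m, m < n → f.coeff m = catalan m := by
    intro m hm
    simp [hf, Polynomial.coeff_X_pow, hm]
  have hdvd : (Polynomial.X : Polynomial R) ^ n ∣ f * f * Polynomial.X + 1 - f := by
    rw [Polynomial.X_pow_dvd_iff]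
    intro m hm
    rw [Polynomial.coeff_sub, Polynomial.coeff_add, hc m hm]
    cases m with
    | zero => simp
    | succ m =>
      rw [Polynomial.coeff_mul_X, Polynomial.coeff_mul, Polynomial.coeff_one, catalan_succ']
      push_cast
      rw [add_zero, sub_eq_zero]
      refine sum_congr rfl fun x hx => ?_
      have := HasAntidiagonal.mem_antidiagonal.1 hx
      rw [hc _ (by omega), hc _ (by omega)]
  have h0 : f.eval w * f.eval w * w + 1 - f.eval w = 0 := by
    obtain ⟨g, hg⟩ := hdvd
    have := congrArg (Polynomial.eval w) hg
    simpa [hw] using this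
  have h1 : sqrtTaylor n w = 1 - 2 * (f.eval w * w) := by
    rw [sqrtTaylor, hf, Polynomial.eval_finsetSum, sum_mul]
    congr 2
    refine sum_congr rfl fun j _ => ?_
    simp [pow_succ, mul_assoc]
  rw [h1]
  linear_combination (4 * w) * h0

theorem exists_sqrtTaylor_eq (n : ℕ) {p w : R} (h : p ∣ w) : ∃ t, sqrtTaylor n w = 1 + p * t := by
  obtain ⟨v, rfl⟩ := h
  refine ⟨-2 * ∑ j ∈ range n, (catalan j : R) * (v * (p * v) ^ j), ?_⟩
  rw [sqrtTaylor, sub_eq_add_neg, mul_sum, mul_sum, mul_sum, ← sum_neg_distrib]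
  congr 1
  refine sum_congr rfl fun j _ => ?_
  rw [pow_succ]; ring

/-- Two square roots of the same unit that agree modulo a nilpotent element are equal. -/
theorem eq_of_sq_eq_of_nilpotent {p x y t : R} (hp : IsNilpotent p) (h2 : IsUnit (2 : R))
    (hx : IsUnit x) (hsq : x ^ 2 = y ^ 2) (hxy : x = y + p * t) : x = y := by
  have h1 : IsUnit (x + y) := by
    have : x + y = 2 * x - p * t := by rw [hxy]; ring
    have hnil : IsNilpotent (-(p * t)) := ((Commute.all p t).isNilpotent_mul_right hp).neg
    rw [this, sub_eq_add_neg]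
    exact hnil.isUnit_add_left_of_commute (h2.mul hx) (Commute.all _ _)
  have h3 : (x - y) * (x + y) = 0 := by linear_combination hsq
  exact sub_eq_zero.1 (h1.mul_left_eq_zero.1 h3)

end SquareRoot

/-! ### Branches of the square root modulo a prime power, and short sums -/

section ShortSums

theorem exists_eq_pow_mul_not_dvd {p : ℕ} (hp : p.Prime) {N : ℤ} (hN : N ≠ 0) :
    ∃ (t : ℕ) (M : ℤ), N = (p : ℤ) ^ t * M ∧ ¬ (p : ℤ) ∣ M := by
  have hfin : FiniteMultiplicity (p : ℤ) N :=
    Int.finiteMultiplicity_iff.2 ⟨by simpa using hp.one_lt.ne', hN⟩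
  obtain ⟨M, h1, h2⟩ := hfin.exists_eq_pow_mul_and_not_dvd
  exact ⟨_, M, h1, h2⟩

/-- A unit times `p ^ t` has the exact denominator `p ^ (k - t)` modulo `p ^ k`. -/
theorem denominator_zmod_pow {p k t : ℕ} (hp : p.Prime) {u : ZMod (p ^ k)} (hu : IsUnit u) {M : ℤ}
    (hM : ¬ (p : ℤ) ∣ M) :
    ((p ^ (k - t) : ℕ) : ZMod (p ^ k)) * (u * ((p : ℤ) ^ t * M : ℤ)) = 0 ∧
      ∀ x : ℤ, u * ((p : ℤ) ^ t * M : ℤ) * x = 0 → ((p ^ (k - t) : ℕ) : ℤ) ∣ x := by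
  constructor
  · have : ((p ^ (k - t) : ℕ) : ZMod (p ^ k)) * ((p : ℤ) ^ t * M : ℤ) = 0 := by
      have h1 : (((p ^ (k - t) * p ^ t : ℕ) : ℤ) * M : ℤ) =
          (p ^ (k - t) : ℕ) * ((p : ℤ) ^ t * M) := by
        push_cast; ring
      rw [← Int.cast_natCast (p ^ (k - t)), ← Int.cast_mul, ← h1,
        ZMod.intCast_zmod_eq_zero_iff_dvd]
      refine Dvd.dvd.mul_right ?_ _
      rw [← pow_add]
      exact_mod_cast pow_dvd_pow p (by omega : k ≤ k - t + t)
    linear_combination u * this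
  · intro x hx
    rcases le_or_gt k t with hkt | hkt
    · rw [Nat.sub_eq_zero_of_le hkt]; simp
    rw [mul_assoc, ← Int.cast_mul] at hx
    have h1 := hu.mul_right_eq_zero.1 hx
    rw [ZMod.intCast_zmod_eq_zero_iff_dvd, mul_assoc] at h1
    have h2 : ((p ^ k : ℕ) : ℤ) = (p : ℤ) ^ t * (p ^ (k - t) : ℕ) := by
      push_cast; rw [← pow_add]; congr 1; omega
    rw [h2] at h1
    have hp0 : (p : ℤ) ≠ 0 := by exact_mod_cast hp.ne_zero
    have h3 := (mul_dvd_mul_iff_left (pow_ne_zero t hp0)).1 h1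
    have hc : IsCoprime ((p ^ (k - t) : ℕ) : ℤ) M := by
      push_cast
      exact IsCoprime.pow_left ((Prime.coprime_iff_not_dvd (Nat.prime_iff_prime_int.1 hp)).2 hM)
    exact hc.dvd_of_dvd_mul_left h3

/-- `F m` is, for `m ≡ μ` modulo `p`, the square root of `m / μ` modulo `q` that is congruent to `1`
modulo `p`. -/
def IsSqrtBranch (p q μ : ℕ) (F : ℕ → ZMod q) : Prop :=
  ∀ m : ℕ, m % p = μ → F m ^ 2 * (μ : ZMod q) = m ∧ ∃ t, F m = 1 + (p : ZMod q) * t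

theorem isUnit_natCast_of_mod {p k m μ : ℕ} (hp : p.Prime) (hμ : 0 < μ) (hm : m % p = μ) :
    IsUnit (m : ZMod (p ^ k)) := by
  have h : ¬ (p : ℤ) ∣ (m : ℤ) := by
    rw [Int.natCast_dvd_natCast, Nat.dvd_iff_mod_eq_zero]; omega
  simpa using isUnit_intCast_zmod_pow (n := k) hp h

theorem isUnit_four_zmod {p k : ℕ} (hodd : Odd p) :
    IsUnit (2 : ZMod (p ^ k)) ∧ IsUnit (4 : ZMod (p ^ k)) := by
  have h2 : IsUnit (2 : ZMod (p ^ k)) := by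
    have h : ((2 : ℕ) : ZMod (p ^ k)) = 2 := by norm_num
    rw [← h, ZMod.isUnit_iff_coprime]
    exact Nat.Coprime.pow_right _ (Nat.coprime_two_left.2 hodd)
  refine ⟨h2, ?_⟩
  have := h2.mul h2
  norm_num at this
  exact this

theorem natCast_pow_eq_zero (p k : ℕ) : (p : ZMod (p ^ k)) ^ k = 0 := by
  rw [← Nat.cast_pow, ZMod.natCast_self]

theorem exists_isSqrtBranch {p k μ : ℕ} (hp : p.Prime) (hodd : Odd p) (hμ : 0 < μ) (hμp : μ < p) :
    ∃ F, IsSqrtBranch p (p ^ k) μ F := by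
  have hu : IsUnit (4 * (μ : ZMod (p ^ k))) := (isUnit_four_zmod hodd).2.mul
    (isUnit_natCast_of_mod hp hμ (Nat.mod_eq_of_lt hμp))
  obtain ⟨i, hi⟩ := hu.exists_left_inv
  refine ⟨fun m => sqrtTaylor k (i * ((μ : ZMod (p ^ k)) - m)), fun m hm => ?_⟩
  have hdiv : (p : ZMod (p ^ k)) ∣ i * ((μ : ZMod (p ^ k)) - m) := by
    have h := congrArg (Nat.cast : ℕ → ZMod (p ^ k)) (Nat.div_add_mod m p)
    rw [hm] at h
    push_cast at h
    exact ⟨-(i * (m / p : ℕ)), by rw [← h]; ring⟩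
  refine ⟨?_, exists_sqrtTaylor_eq k hdiv⟩
  rw [sqrtTaylor_sq]
  · linear_combination ((m : ZMod (p ^ k)) - μ) * hi
  · obtain ⟨t, ht⟩ := hdiv
    rw [ht, mul_pow, natCast_pow_eq_zero, zero_mul]

theorem IsSqrtBranch.isUnit {p k μ : ℕ} {F : ℕ → ZMod (p ^ k)} (hF : IsSqrtBranch p (p ^ k) μ F)
    (hp : p.Prime) (hμ : 0 < μ) {m : ℕ} (hm : m % p = μ) : IsUnit (F m) := by
  have h := isUnit_natCast_of_mod (k := k) hp hμ hm
  rw [← (hF m hm).1, sq] at h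
  exact isUnit_of_mul_isUnit_left (isUnit_of_mul_isUnit_left h)

/-- The local expansion of the square root around `m`. It breaks off because `p ^ (s d) = 0`, and it
holds exactly because the branch is determined by its square and its residue modulo `p`. -/
theorem IsSqrtBranch.add_eq {p k μ d s : ℕ} {F : ℕ → ZMod (p ^ k)}
    (hF : IsSqrtBranch p (p ^ k) μ F) (hp : p.Prime) (hodd : Odd p) (hμ : 0 < μ) (hμp : μ < p)
    (hs : 0 < s) (hds : k ≤ d * s) {m : ℕ} (hm : m % p = μ) {i : ZMod (p ^ k)}
    (hi : i * (4 * m) = 1) (z : ℕ) :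
    F (m + p ^ s * z) = F m * sqrtTaylor d (-(p : ZMod (p ^ k)) ^ s * z * i) := by
  set w : ZMod (p ^ k) := -(p : ZMod (p ^ k)) ^ s * z * i with hw
  have hm' : (m + p ^ s * z) % p = μ := by
    obtain ⟨s', rfl⟩ : ∃ s', s = s' + 1 := ⟨s - 1, by omega⟩
    rw [pow_succ', mul_assoc, Nat.add_mul_mod_self_left, hm]
  have hpn : IsNilpotent (p : ZMod (p ^ k)) := ⟨k, natCast_pow_eq_zero p k⟩
  obtain ⟨e1, t1, ht1⟩ := hF m hm
  obtain ⟨e2, t2, ht2⟩ := hF _ hm'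
  have hpw : (p : ZMod (p ^ k)) ∣ w := by
    obtain ⟨s', rfl⟩ : ∃ s', s = s' + 1 := ⟨s - 1, by omega⟩
    exact ⟨-(p : ZMod (p ^ k)) ^ s' * z * i, by rw [hw, pow_succ]; ring⟩
  obtain ⟨t3, ht3⟩ := exists_sqrtTaylor_eq d hpw
  have hwd : w ^ d = 0 := by
    have : ((p : ZMod (p ^ k)) ^ s) ^ d = 0 := by
      rw [← pow_mul, mul_comm, ← Nat.add_sub_of_le hds, pow_add, natCast_pow_eq_zero, zero_mul]
    rw [hw, neg_mul, neg_mul, mul_assoc, neg_pow, mul_pow, this]; ring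
  refine eq_of_sq_eq_of_nilpotent hpn (isUnit_four_zmod hodd).1 (hF.isUnit hp hμ hm') ?_
    (t := t2 - t1 - t3 - p * (t1 * t3)) ?_
  · have hμu : IsUnit (μ : ZMod (p ^ k)) :=
      isUnit_natCast_of_mod hp hμ (Nat.mod_eq_of_lt hμp)
    refine hμu.mul_right_cancel ?_
    rw [e2, mul_pow, sqrtTaylor_sq hwd]
    push_cast
    rw [hw]
    linear_combination -(1 + 4 * (p : ZMod (p ^ k)) ^ s * z * i) * e1 -
      (p : ZMod (p ^ k)) ^ s * z * hi
  · rw [ht1, ht2, ht3]; ring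

theorem norm_sum_Ico_sub_shift_le {h : ℕ → ℂ} (hh : ∀ m, ‖h m‖ ≤ 1) (A B t : ℕ) :
    ‖∑ m ∈ Ico A B, h m - ∑ m ∈ Ico A B, h (m + t)‖ ≤ 2 * t := by
  have key : ∀ S : Finset ℕ, ∀ c, S ⊆ Ico c (c + t) → ‖∑ m ∈ S, h m‖ ≤ t := by
    intro S c hS
    calc ‖∑ m ∈ S, h m‖ ≤ ∑ _m ∈ S, (1 : ℝ) := norm_sum_le_of_le _ fun m _ => hh m
      _ = #S := by simp
      _ ≤ t := by
          have := card_le_card hS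
          rw [Nat.card_Ico, Nat.add_sub_cancel_left] at this
          exact_mod_cast this
  rw [Finset.sum_Ico_add' h A B t, ← sum_sdiff_sub_sum_sdiff, two_mul]
  refine (norm_sub_le _ _).trans (add_le_add (key _ A ?_) (key _ B ?_)) <;>
  · intro m hm
    simp only [mem_sdiff, Finset.mem_Ico] at hm ⊢
    omega

/-- Sums over a short interval of `ψ(u D √(m / μ))`, where `D` is an integer not divisible by a
large power of `p`. The sum is averaged over the shifts `m ↦ m + p ^ s x y`. The phase is then a
polynomial in `x y` of degree `20 e`, whose coefficients have denominators that are known from the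
powers of `p` in the Catalan numbers and in `D`. -/
theorem exists_norm_short_sum_le {e : ℕ} (he : 0 < e) :
    ∃ C : ℝ, 0 < C ∧ ∀ (p k s μ : ℕ) [NeZero (p ^ k)], p.Prime → Odd p → 44 ≤ s → k ≤ 20 * e * s →
      20 * e * s ≤ k + 20 * e → 0 < μ → μ < p → ∀ F, IsSqrtBranch p (p ^ k) μ F →
      ∀ (u : ZMod (p ^ k)) (D : ℤ), IsUnit u → ¬ (p : ℤ) ^ (k / 10 + 1) ∣ D → ∀ A B : ℕ,
        ‖∑ m ∈ Ico A B with m % p = μ, ZMod.stdAddChar (u * (D : ZMod (p ^ k)) * F m)‖ ≤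
          2 * (p : ℝ) ^ (3 * s) +
            (B - A : ℕ) * (C * ((p : ℝ) ^ s) ^ (-(1 / (4608000 * e ^ 2)) : ℝ)) := by
  obtain ⟨C, hC, hW⟩ := exists_norm_bilinear_le he
  refine ⟨C, hC, ?_⟩
  intro p k s μ _ hp hodd hs hks hsk hμ hμp F hF u D hu hD A B
  set P := p ^ s with hP
  have hP0 : 0 < P := pow_pos hp.pos s
  have hPR : (0 : ℝ) < P := by exact_mod_cast hP0
  set h : ℕ → ℂ := fun m =>
    if m % p = μ then ZMod.stdAddChar (u * (D : ZMod (p ^ k)) * F m) else 0 with hh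
  have hh1 : ∀ m, ‖h m‖ ≤ 1 := by
    intro m
    simp only [hh]
    split_ifs
    · rw [AddChar.norm_apply]
    · simp
  have hD0 : D ≠ 0 := fun h0 => hD (h0 ▸ dvd_zero _)
  -- the sum over the shifts, for fixed `m`
  have hm : ∀ m, ‖∑ x ∈ range P, ∑ y ∈ range P, h (m + p ^ s * (x * y))‖ ≤
      C * (P : ℝ) ^ (2 - 1 / (4608000 * e ^ 2) : ℝ) := by
    intro m
    by_cases hmμ : m % p = μ
    swap
    · have : ∀ z, h (m + p ^ s * z) = 0 := by
        intro z
        obtain ⟨s', rfl⟩ : ∃ s', s = s' + 1 := ⟨s - 1, by omega⟩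
        simp only [hh]
        rw [if_neg]
        rw [pow_succ', mul_assoc, Nat.add_mul_mod_self_left]
        exact hmμ
      simp only [this, sum_const_zero, norm_zero]
      positivity
    have hmu : IsUnit (4 * (m : ZMod (p ^ k))) :=
      (isUnit_four_zmod hodd).2.mul (isUnit_natCast_of_mod hp hμ hmμ)
    obtain ⟨i, hi⟩ := hmu.exists_left_inv
    have hiu : IsUnit i := IsUnit.of_mul_eq_one _ hi
    have hFm := hF.isUnit hp hμ hmμ
    set a : Fin (20 * e + 1) → ZMod (p ^ k) := fun j =>
      if (j : ℕ) = 0 then u * (D : ZMod (p ^ k)) * F m else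
      (-2 * u * F m * (-i) ^ (j : ℕ)) *
        ((catalan (j - 1) : ℤ) * ((p : ℤ) ^ (s * j) * D) : ℤ) with ha
    have hexp : ∀ x y : ℕ, h (m + p ^ s * (x * y)) =
        ZMod.stdAddChar (∑ j, a j * ((x : ZMod (p ^ k)) * (y : ZMod (p ^ k))) ^ (j : ℕ)) := by
      intro x y
      have hmod : (m + p ^ s * (x * y)) % p = μ := by
        obtain ⟨s', rfl⟩ : ∃ s', s = s' + 1 := ⟨s - 1, by omega⟩
        rw [pow_succ', mul_assoc, Nat.add_mul_mod_self_left, hmμ]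
      simp only [hh]
      rw [if_pos hmod]
      congr 1
      rw [hF.add_eq hp hodd hμ hμp (by omega) hks hmμ hi, Fin.sum_univ_succ, sqrtTaylor, mul_sum,
        Finset.sum_range]
      simp only [ha, Fin.val_zero, if_true, pow_zero, mul_one, Fin.val_succ, Nat.succ_ne_zero,
        if_false, Nat.add_sub_cancel]
      rw [mul_sub, mul_sub, mul_one, sub_eq_add_neg, mul_sum, mul_sum, ← sum_neg_distrib]
      congr 1
      refine sum_congr rfl fun j _ => ?_
      push_cast
      rw [pow_mul, show (-(p : ZMod (p ^ k)) ^ s * ((x : ZMod (p ^ k)) * y) * i) =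
        (p : ZMod (p ^ k)) ^ s * (-i) * (x * y) by ring,
        mul_pow, mul_pow]
      ring
    simp_rw [hexp]
    obtain ⟨β, D', hDD, hD'⟩ := exists_eq_pow_mul_not_dvd hp hD0
    have hβ : β ≤ k / 10 := by
      by_contra hcon
      exact hD (hDD ▸ Dvd.dvd.mul_right (pow_dvd_pow _ (by omega)) _)
    have hcat0 : ∀ n, (catalan n : ℤ) ≠ 0 := by
      intro n hn
      have h1 := succ_mul_catalan_eq_centralBinom n
      have h2 := Nat.centralBinom_pos n
      rw [show catalan n = 0 by exact_mod_cast hn] at h1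
      omega
    choose α c hc hc' using fun n => exists_eq_pow_mul_not_dvd hp (hcat0 n)
    -- a crude bound for the powers of `p` in the Catalan numbers, from their size
    have hα : ∀ n, α n ≤ 2 * n := by
      intro n
      have h1 : p ^ α n ∣ catalan n := by
        have : (p : ℤ) ^ α n ∣ (catalan n : ℤ) := ⟨_, hc n⟩
        exact_mod_cast this
      have h2 : p ^ α n ≤ catalan n :=
        Nat.le_of_dvd (Nat.pos_of_ne_zero (by exact_mod_cast hcat0 n)) h1
      have h3 : catalan n ≤ 4 ^ n := by
        refine le_trans ?_ (Nat.centralBinom_le_four_pow n)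
        rw [← succ_mul_catalan_eq_centralBinom n]
        nlinarith
      have h4 : 2 ^ α n ≤ 2 ^ (2 * n) := by
        calc 2 ^ α n ≤ p ^ α n := Nat.pow_le_pow_left hp.two_le _
          _ ≤ 4 ^ n := h2.trans h3
          _ = 2 ^ (2 * n) := by rw [pow_mul]; norm_num
      exact (Nat.pow_le_pow_iff_right one_lt_two).1 h4
    refine hW (ZMod (p ^ k)) P hP0 ZMod.stdAddChar a
      (fun j => p ^ (k - (s * j + α (j - 1) + β))) ?_
    intro j hj1 hj2
    have hj0 : (j : ℕ) ≠ 0 := by omega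
    have hu' : IsUnit (-2 * u * F m * (-i) ^ (j : ℕ)) :=
      (((isUnit_four_zmod hodd).1.neg.mul hu).mul hFm).mul (hiu.neg.pow _)
    have haj : a j = (-2 * u * F m * (-i) ^ (j : ℕ)) *
        ((p : ℤ) ^ (s * j + α (j - 1) + β) * (c (j - 1) * D') : ℤ) := by
      simp only [ha]
      rw [if_neg hj0]
      congr 2
      conv_lhs => rw [hDD, hc]
      ring
    have hnd : ¬ (p : ℤ) ∣ c (j - 1) * D' := by
      intro hdvd
      rcases (Nat.prime_iff_prime_int.1 hp).dvd_or_dvd hdvd with h1 | h1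
      · exact hc' _ h1
      · exact hD' h1
    have hden := denominator_zmod_pow (t := s * j + α (j - 1) + β) hp hu' hnd
    have hαj := hα (j - 1)
    -- For `j ≤ 12 e` the exponent `s j + α + β` is at most `12 e s + 24 e + 2 e s`, which leaves
    -- a denominator of at least `p ^ (6 e s - 44 e)`; this is why `44 ≤ s` is needed.
    have hes : e * 10 * s ≤ j * s := Nat.mul_le_mul_right s (by omega)
    have hes2 : j * s ≤ e * 12 * s := Nat.mul_le_mul_right s (by omega)
    have hes3 : e * 44 ≤ e * s := Nat.mul_le_mul_left e hs
    refine ⟨?_, ?_, ?_, ?_⟩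
    · rw [hP, ← pow_mul]
      refine pow_dvd_pow _ ?_
      rw [mul_comm s j]
      have : 20 * e * s = 2 * (e * 10 * s) := by ring
      omega
    · rw [hP, ← pow_mul]
      refine Nat.pow_le_pow_right hp.pos ?_
      have h1 : 20 * e * s = 20 * (e * s) := by ring
      have h2 : e * 12 * s = 12 * (e * s) := by ring
      have h3 : s * (5 * e) = 5 * (e * s) := by ring
      rw [mul_comm s j]
      omega
    · rw [haj]; exact hden.1
    · intro x hx
      refine hden.2 x ?_
      rw [← haj]
      exact ZMod.injective_stdAddChar (by rw [hx, AddChar.map_zero_eq_one])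
  have hsum : ∑ m ∈ Ico A B with m % p = μ, ZMod.stdAddChar (u * (D : ZMod (p ^ k)) * F m) =
      ∑ m ∈ Ico A B, h m := by
    rw [sum_filter]
  rw [hsum]
  have h1 : (P : ℂ) ^ 2 * ∑ m ∈ Ico A B, h m =
      ∑ x ∈ range P, ∑ y ∈ range P,
        (∑ m ∈ Ico A B, h m - ∑ m ∈ Ico A B, h (m + p ^ s * (x * y))) +
      ∑ m ∈ Ico A B, ∑ x ∈ range P, ∑ y ∈ range P, h (m + p ^ s * (x * y)) := by
    simp_rw [sum_sub_distrib]
    have : ∑ m ∈ Ico A B, ∑ x ∈ range P, ∑ y ∈ range P, h (m + p ^ s * (x * y)) =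
        ∑ x ∈ range P, ∑ y ∈ range P, ∑ m ∈ Ico A B, h (m + p ^ s * (x * y)) := by
      rw [sum_comm]
      exact sum_congr rfl fun x _ => sum_comm
    rw [this, sub_add_cancel]
    simp only [sum_const, card_range, nsmul_eq_mul]
    ring
  have h2 : (P : ℝ) ^ 2 * ‖∑ m ∈ Ico A B, h m‖ ≤ (P : ℝ) ^ 2 * (2 * P ^ 3) +
      (B - A : ℕ) * (C * (P : ℝ) ^ (2 - 1 / (4608000 * e ^ 2) : ℝ)) := by
    have : (P : ℝ) ^ 2 * ‖∑ m ∈ Ico A B, h m‖ = ‖(P : ℂ) ^ 2 * ∑ m ∈ Ico A B, h m‖ := by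
      rw [norm_mul]; simp
    rw [this, h1]
    refine (norm_add_le _ _).trans (add_le_add ?_ ?_)
    · refine (norm_sum_le _ _).trans ?_
      calc _ ≤ ∑ x ∈ range P, ∑ y ∈ range P, (2 * P ^ 3 : ℝ) := by
            refine sum_le_sum fun x hx => (norm_sum_le _ _).trans (sum_le_sum fun y hy => ?_)
            refine (norm_sum_Ico_sub_shift_le hh1 A B _).trans ?_
            have h3 : p ^ s * (x * y) ≤ P ^ 3 := by
              rw [← hP, pow_succ', sq]
              exact Nat.mul_le_mul_left _ (Nat.mul_le_mul (mem_range.1 hx).le (mem_range.1 hy).le)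
            have h4 : ((p ^ s * (x * y) : ℕ) : ℝ) ≤ ((P ^ 3 : ℕ) : ℝ) := by exact_mod_cast h3
            push_cast at h4 ⊢
            linarith
        _ = _ := by simp; ring
    · refine (norm_sum_le _ _).trans ?_
      refine (sum_le_sum fun m _ => hm m).trans (le_of_eq ?_)
      simp
  have hPp : (P : ℝ) = (p : ℝ) ^ s := by rw [hP]; push_cast; rfl
  rw [← hPp]
  rw [show (p : ℝ) ^ (3 * s) = (P : ℝ) ^ 3 by rw [hPp, ← pow_mul, mul_comm]]
  have h3 : (P : ℝ) ^ (2 - 1 / (4608000 * e ^ 2) : ℝ) =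
      (P : ℝ) ^ 2 * (P : ℝ) ^ (-(1 / (4608000 * e ^ 2)) : ℝ) := by
    rw [sub_eq_add_neg, Real.rpow_add hPR]; norm_num
  rw [h3] at h2
  refine le_of_mul_le_mul_left (h2.trans (le_of_eq ?_)) (by positivity : (0 : ℝ) < (P : ℝ) ^ 2)
  ring

end ShortSums

/-! ### Kloosterman sums modulo prime powers -/

section Kloosterman

theorem kloosterman_eq_sum_units (m n : ℤ) (q : ℕ) [NeZero q] :
    kloosterman m n q = (1 / (Real.sqrt q : ℂ)) *
      ∑ b : (ZMod q)ˣ, ZMod.stdAddChar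
        ((m : ZMod q) * (b : ZMod q) + (n : ZMod q) * ((b⁻¹ : (ZMod q)ˣ) : ZMod q)) := by
  unfold kloosterman
  congr 1
  symm
  have hq : 0 < q := NeZero.pos q
  refine sum_bij (fun b _ => (b : ZMod q).val) ?_ ?_ ?_ ?_
  · intro b _
    exact mem_filter.2 ⟨mem_range.2 (ZMod.val_lt _), ZMod.val_coe_unit_coprime b⟩
  · intro b _ c _ h
    exact Units.ext (ZMod.val_injective q h)
  · intro b hb
    rw [mem_filter, mem_range] at hb
    refine ⟨ZMod.unitOfCoprime b hb.2, mem_univ _, ?_⟩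
    rw [ZMod.coe_unitOfCoprime, ZMod.val_cast_of_lt hb.1]
  · intro b _
    have h1 : ((invMod q (b : ZMod q).val : ℕ) : ZMod q) = ((b⁻¹ : (ZMod q)ˣ) : ZMod q) := by
      rw [invMod, ZMod.natCast_zmod_val, ZMod.natCast_zmod_val, ZMod.inv_coe_unit]
    have h2 : ((m : ZMod q) * (b : ZMod q) + (n : ZMod q) * ((b⁻¹ : (ZMod q)ˣ) : ZMod q)) =
        ((m * ((b : ZMod q).val : ℤ) + n * (invMod q (b : ZMod q).val : ℤ) : ℤ) : ZMod q) := by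
      push_cast
      rw [h1, ZMod.natCast_zmod_val]
    rw [h2, ZMod.stdAddChar_coe, addExp]
    congr 1
    push_cast
    ring

variable {p k : ℕ}

theorem isUnit_or_dvd_zmod (hp : p.Prime) (z : ZMod (p ^ k)) :
    IsUnit z ∨ (p : ZMod (p ^ k)) ∣ z := by
  have : NeZero (p ^ k) := ⟨(pow_pos hp.pos k).ne'⟩
  by_cases h : (p : ℤ) ∣ (z.val : ℤ)
  · right
    obtain ⟨t, ht⟩ := Int.natCast_dvd_natCast.1 h
    exact ⟨(t : ZMod (p ^ k)), by rw [← Nat.cast_mul, ← ht, ZMod.natCast_zmod_val]⟩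
  · left
    have := isUnit_intCast_zmod_pow (n := k) hp h
    rwa [Int.cast_natCast, ZMod.natCast_zmod_val] at this

theorem not_isUnit_of_dvd_zmod (hp : p.Prime) (hk : 0 < k) {z : ZMod (p ^ k)}
    (h : (p : ZMod (p ^ k)) ∣ z) : ¬ IsUnit z := by
  intro hu
  have h1 : IsUnit ((p : ZMod (p ^ k)) ^ k) := (isUnit_of_dvd_unit h hu).pow k
  rw [natCast_pow_eq_zero] at h1
  have : Fact (1 < p ^ k) := ⟨Nat.one_lt_pow hk.ne' hp.one_lt⟩
  exact not_isUnit_zero h1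

theorem dvd_of_pow_mul_eq_zero (hp : p.Prime) {κ h : ℕ} (hk : k = κ + h) {z : ZMod (p ^ k)}
    (hz : (p : ZMod (p ^ k)) ^ κ * z = 0) : ∃ t < p ^ κ, z = (p : ZMod (p ^ k)) ^ h * (t : ℕ) := by
  have : NeZero (p ^ k) := ⟨(pow_pos hp.pos k).ne'⟩
  have h1 : p ^ k ∣ p ^ κ * z.val := by
    rw [← ZMod.natCast_eq_zero_iff]
    push_cast
    rwa [ZMod.natCast_zmod_val]
  have h1' : p ^ κ * p ^ h ∣ p ^ κ * z.val := by rw [← pow_add, ← hk]; exact h1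
  obtain ⟨t, ht⟩ := Nat.dvd_of_mul_dvd_mul_left (pow_pos hp.pos κ) h1'
  refine ⟨t, ?_, ?_⟩
  · have h2 := ZMod.val_lt z
    have h3 : p ^ h * t < p ^ h * p ^ κ := by rw [← pow_add, add_comm, ← hk, ← ht]; exact h2
    exact lt_of_mul_lt_mul_left h3 (Nat.zero_le _)
  · rw [← Nat.cast_pow, ← Nat.cast_mul, ← ht, ZMod.natCast_zmod_val]

/-- The method of stationary phase: averaging over the substitutions `b ↦ b (1 + p ^ κ t)` kills all
`b` with `p ^ κ (m b - a / b) ≠ 0`. -/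
theorem sum_units_eq_stationary [NeZero (p ^ k)] {κ : ℕ} (hκ : k ≤ 2 * κ) (m a : ZMod (p ^ k)) :
    ∑ b : (ZMod (p ^ k))ˣ,
        ZMod.stdAddChar (m * (b : ZMod (p ^ k)) + a * ((b⁻¹ : (ZMod (p ^ k))ˣ) : ZMod (p ^ k))) =
      ∑ b : (ZMod (p ^ k))ˣ with (p : ZMod (p ^ k)) ^ κ *
        (m * ((b : (ZMod (p ^ k))ˣ) : ZMod (p ^ k)) -
          a * ((b⁻¹ : (ZMod (p ^ k))ˣ) : ZMod (p ^ k))) = 0,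
        ZMod.stdAddChar
          (m * (b : ZMod (p ^ k)) + a * ((b⁻¹ : (ZMod (p ^ k))ˣ) : ZMod (p ^ k))) := by
  have hpκ : (p : ZMod (p ^ k)) ^ κ * (p : ZMod (p ^ k)) ^ κ = 0 := by
    rw [← pow_add, ← two_mul, ← Nat.add_sub_of_le hκ, pow_add, natCast_pow_eq_zero, zero_mul]
  set f : (ZMod (p ^ k))ˣ → ℂ := fun b =>
    ZMod.stdAddChar (m * (b : ZMod (p ^ k)) + a * ((b⁻¹ : (ZMod (p ^ k))ˣ) : ZMod (p ^ k))) with hf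
  set y : (ZMod (p ^ k))ˣ → ZMod (p ^ k) := fun b =>
    (p : ZMod (p ^ k)) ^ κ *
      (m * (b : ZMod (p ^ k)) - a * ((b⁻¹ : (ZMod (p ^ k))ˣ) : ZMod (p ^ k))) with hy
  have h1 : ∀ t : ZMod (p ^ k), ∑ b, f b = ∑ b, f b * ZMod.stdAddChar (t * y b) := by
    intro t
    let u : (ZMod (p ^ k))ˣ := ⟨1 + p ^ κ * t, 1 - p ^ κ * t,
      by linear_combination (-t ^ 2) * hpκ, by linear_combination (-t ^ 2) * hpκ⟩
    rw [← Equiv.sum_comp (Equiv.mulRight u)]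
    refine sum_congr rfl fun b _ => ?_
    simp only [hf, hy, Equiv.coe_mulRight]
    rw [← AddChar.map_add_eq_mul, mul_inv]
    congr 1
    have e1 : (u : ZMod (p ^ k)) = 1 + p ^ κ * t := rfl
    have e2 : ((u⁻¹ : (ZMod (p ^ k))ˣ) : ZMod (p ^ k)) = 1 - p ^ κ * t := rfl
    rw [Units.val_mul, Units.val_mul, e1, e2]
    ring
  have h2 : (p ^ k : ℂ) * ∑ b, f b = (p ^ k : ℂ) * ∑ b with y b = 0, f b := by
    calc (p ^ k : ℂ) * ∑ b, f b = ∑ _t : ZMod (p ^ k), ∑ b, f b := by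
          rw [sum_const, card_univ, ZMod.card, nsmul_eq_mul]; push_cast; rfl
      _ = ∑ t : ZMod (p ^ k), ∑ b, f b * ZMod.stdAddChar (t * y b) :=
          sum_congr rfl fun t _ => h1 t
      _ = _ := by
          rw [sum_comm]
          simp_rw [← mul_sum, AddChar.sum_mulShift _ (ZMod.isPrimitive_stdAddChar (p ^ k))]
          rw [sum_filter, mul_sum]
          refine sum_congr rfl fun b _ => ?_
          split_ifs
          · rw [ZMod.card]; push_cast; ring
          · simp
  have hq : (p ^ k : ℂ) ≠ 0 := by
    have := NeZero.ne (p ^ k)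
    exact_mod_cast this
  exact mul_left_cancel₀ hq h2

/-- The normalised quadratic Gauss sum over the solutions of `p ^ κ n = 0`, where `κ = ⌈k / 2⌉`. -/
noncomputable def localGauss (p k : ℕ) [NeZero (p ^ k)] (y : ZMod (p ^ k)) : ℂ :=
  (1 / (Real.sqrt (p ^ k : ℕ) : ℂ)) *
    ∑ n : ZMod (p ^ k) with (p : ZMod (p ^ k)) ^ ((k + 1) / 2) * n = 0,
      ZMod.stdAddChar (y * n ^ 2)

theorem norm_localGauss_le [NeZero (p ^ k)] (hp : p.Prime) (y : ZMod (p ^ k)) :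
    ‖localGauss p k y‖ ≤ Real.sqrt p := by
  set κ := (k + 1) / 2 with hκ
  have hq : (0 : ℝ) < (p ^ k : ℕ) := by exact_mod_cast pow_pos hp.pos k
  have hcard : #{n : ZMod (p ^ k) | (p : ZMod (p ^ k)) ^ κ * n = 0} ≤ p ^ κ := by
    calc _ ≤ #((range (p ^ κ)).image fun t : ℕ =>
            (p : ZMod (p ^ k)) ^ (k - κ) * (t : ZMod (p ^ k))) := by
          refine card_le_card fun n hn => ?_
          obtain ⟨t, ht, h⟩ := dvd_of_pow_mul_eq_zero hp (by omega : k = κ + (k - κ))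
            (mem_filter.1 hn).2
          exact mem_image.2 ⟨t, mem_range.2 ht, h.symm⟩
      _ ≤ _ := card_image_le.trans (card_range _).le
  have h1 : ‖∑ n : ZMod (p ^ k) with (p : ZMod (p ^ k)) ^ κ * n = 0,
      ZMod.stdAddChar (y * n ^ 2)‖ ≤ (p : ℝ) ^ κ := by
    refine (norm_sum_le _ _).trans ?_
    simp only [AddChar.norm_apply, sum_const, nsmul_eq_mul, mul_one]
    exact_mod_cast hcard
  have h2 : (p : ℝ) ^ κ ≤ Real.sqrt p * Real.sqrt (p ^ k : ℕ) := by
    rw [← Real.sqrt_mul (by positivity)]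
    refine Real.le_sqrt_of_sq_le ?_
    rw [← pow_mul]
    push_cast
    rw [← pow_succ']
    exact pow_le_pow_right₀ (by exact_mod_cast hp.one_lt.le) (by omega)
  rw [localGauss, norm_mul, norm_div, norm_one, Complex.norm_real,
    Real.norm_of_nonneg (Real.sqrt_nonneg _), one_div, inv_mul_le_iff₀ (Real.sqrt_pos.2 hq)]
  linarith

/-- The Gauss sum depends only on the residue of `y` modulo `p`. -/
theorem localGauss_congr [NeZero (p ^ k)] (hp : p.Prime) {y z t : ZMod (p ^ k)}
    (h : y = z + p * t) : localGauss p k y = localGauss p k z := by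
  unfold localGauss
  congr 1
  refine sum_congr rfl fun n hn => ?_
  obtain ⟨s, -, rfl⟩ := dvd_of_pow_mul_eq_zero hp
    (by omega : k = (k + 1) / 2 + (k - (k + 1) / 2)) (mem_filter.1 hn).2
  congr 1
  have h0 : (p : ZMod (p ^ k)) * ((p : ZMod (p ^ k)) ^ (k - (k + 1) / 2)) ^ 2 = 0 := by
    rw [← pow_mul, ← pow_succ', ← Nat.add_sub_of_le
      (by omega : k ≤ (k - (k + 1) / 2) * 2 + 1), pow_add, natCast_pow_eq_zero, zero_mul]
  rw [h]
  linear_combination (t * (s : ZMod (p ^ k)) ^ 2) * h0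

/-- Evaluation of the Kloosterman sum at a square: the stationary points are near `1 / x` and
`-1 / x`. -/
theorem kloosterman_eq_of_sq [NeZero (p ^ k)] (hp : p.Prime) (hodd : Odd p) (hk : 3 ≤ k) {M a : ℤ}
    (x : (ZMod (p ^ k))ˣ) (ha : IsUnit (a : ZMod (p ^ k))) (hM : (M : ZMod (p ^ k)) = a * x ^ 2) :
    kloosterman M a (p ^ k) =
      localGauss p k (a * x) * ZMod.stdAddChar (2 * (a * x : ZMod (p ^ k))) +
      localGauss p k (-(a * x)) * ZMod.stdAddChar (-(2 * (a * x : ZMod (p ^ k)))) := by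
  set κ := (k + 1) / 2 with hκ
  have h2u : IsUnit (2 : ZMod (p ^ k)) := (isUnit_four_zmod hodd).1
  have hpκ : (p : ZMod (p ^ k)) ^ κ ≠ 0 := by
    rw [← Nat.cast_pow, Ne, ZMod.natCast_eq_zero_iff]
    intro h
    have := (Nat.pow_dvd_pow_iff_le_right hp.one_lt).1 h
    omega
  have hann : ∀ n : ZMod (p ^ k), (p : ZMod (p ^ k)) ^ κ * n = 0 → n ^ 3 = 0 := by
    intro n hn
    obtain ⟨s, -, rfl⟩ := dvd_of_pow_mul_eq_zero hp (by omega : k = κ + (k - κ)) hn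
    rw [mul_pow, ← pow_mul, ← Nat.add_sub_of_le (by omega : k ≤ (k - κ) * 3), pow_add,
      natCast_pow_eq_zero, zero_mul, zero_mul]
  rw [kloosterman_eq_sum_units, sum_units_eq_stationary (κ := κ) (by omega),
    localGauss, localGauss, mul_assoc, mul_assoc, ← mul_add]
  congr 1
  set y : ZMod (p ^ k) := a * x with hy
  have hyu : IsUnit y := ha.mul x.isUnit
  -- the substitution `b = c / x`
  have hsub : ∑ b : (ZMod (p ^ k))ˣ with (p : ZMod (p ^ k)) ^ κ *
        ((M : ZMod (p ^ k)) * ((b : (ZMod (p ^ k))ˣ) : ZMod (p ^ k)) -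
          (a : ZMod (p ^ k)) * ((b⁻¹ : (ZMod (p ^ k))ˣ) : ZMod (p ^ k))) = 0,
        ZMod.stdAddChar ((M : ZMod (p ^ k)) * (b : ZMod (p ^ k)) +
          (a : ZMod (p ^ k)) * ((b⁻¹ : (ZMod (p ^ k))ˣ) : ZMod (p ^ k))) =
      ∑ c : (ZMod (p ^ k))ˣ with (p : ZMod (p ^ k)) ^ κ *
        ((((c : (ZMod (p ^ k))ˣ) : ZMod (p ^ k)) - 1) * ((c : ZMod (p ^ k)) + 1)) = 0,
        ZMod.stdAddChar (y * ((c : ZMod (p ^ k)) + ((c⁻¹ : (ZMod (p ^ k))ˣ) : ZMod (p ^ k)))) := by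
    rw [sum_filter, sum_filter, ← Equiv.sum_comp (Equiv.mulRight x⁻¹)]
    refine sum_congr rfl fun c _ => ?_
    have hxx : (x : ZMod (p ^ k)) * ((x⁻¹ : (ZMod (p ^ k))ˣ) : ZMod (p ^ k)) = 1 := x.mul_inv
    have hcc : (c : ZMod (p ^ k)) * ((c⁻¹ : (ZMod (p ^ k))ˣ) : ZMod (p ^ k)) = 1 := c.mul_inv
    have e1 : (M : ZMod (p ^ k)) * ((c * x⁻¹ : (ZMod (p ^ k))ˣ) : ZMod (p ^ k)) = y * c := by
      rw [hM, hy, Units.val_mul]; linear_combination (a * x * c : ZMod (p ^ k)) * hxx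
    have e2 : (a : ZMod (p ^ k)) * (((c * x⁻¹)⁻¹ : (ZMod (p ^ k))ˣ) : ZMod (p ^ k)) =
        y * ((c⁻¹ : (ZMod (p ^ k))ˣ) : ZMod (p ^ k)) := by
      rw [mul_inv, inv_inv, hy, Units.val_mul]; ring
    refine if_congr ?_ (by rw [Equiv.coe_mulRight, e1, e2, ← mul_add]) rfl
    rw [Equiv.coe_mulRight, e1, e2, ← mul_sub]
    constructor
    · intro h
      have h3 : y * ((p : ZMod (p ^ k)) ^ κ * (((c : ZMod (p ^ k)) - 1) * (c + 1))) = 0 := by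
        linear_combination c * h + y * (p : ZMod (p ^ k)) ^ κ * hcc
      exact hyu.mul_right_eq_zero.1 h3
    · intro h
      linear_combination (y * ((c⁻¹ : (ZMod (p ^ k))ˣ) : ZMod (p ^ k))) * h -
        (y * (p : ZMod (p ^ k)) ^ κ * c) * hcc
  rw [hsub]
  -- inverse of a stationary point
  have hinv : ∀ (c : (ZMod (p ^ k))ˣ) (n : ZMod (p ^ k)), (p : ZMod (p ^ k)) ^ κ * n = 0 →
      (c : ZMod (p ^ k)) = 1 + n →
      (c : ZMod (p ^ k)) + ((c⁻¹ : (ZMod (p ^ k))ˣ) : ZMod (p ^ k)) = 2 + n ^ 2 := by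
    intro c n hn hc
    have h3 := hann n hn
    have h4 : ((c⁻¹ : (ZMod (p ^ k))ˣ) : ZMod (p ^ k)) = 1 - n + n ^ 2 := by
      refine (c.eq_inv_of_mul_eq_one_right ?_).symm
      rw [hc]; linear_combination h3
    rw [h4, hc]; ring
  have hunit : ∀ n : ZMod (p ^ k), (p : ZMod (p ^ k)) ^ κ * n = 0 →
      ∃ c : (ZMod (p ^ k))ˣ, (c : ZMod (p ^ k)) = 1 + n := by
    intro n hn
    have h3 := hann n hn
    exact ⟨⟨1 + n, 1 - n + n ^ 2, by linear_combination h3, by linear_combination h3⟩, rfl⟩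
  have hsplit : ∀ c : (ZMod (p ^ k))ˣ, (p : ZMod (p ^ k)) ^ κ *
      (((c : ZMod (p ^ k)) - 1) * ((c : ZMod (p ^ k)) + 1)) = 0 →
      ¬ (p : ZMod (p ^ k)) ^ κ * ((c : ZMod (p ^ k)) - 1) = 0 →
      (p : ZMod (p ^ k)) ^ κ * ((c : ZMod (p ^ k)) + 1) = 0 := by
    intro c h1 h2
    rcases isUnit_or_dvd_zmod hp ((c : ZMod (p ^ k)) + 1) with h3 | h3
    · exact absurd (h3.mul_left_eq_zero.1 (by rw [← h1]; ring)) h2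
    rcases isUnit_or_dvd_zmod hp ((c : ZMod (p ^ k)) - 1) with h4 | h4
    · exact h4.mul_left_eq_zero.1 (by rw [← h1]; ring)
    · have h5 := dvd_sub h3 h4
      rw [show (c : ZMod (p ^ k)) + 1 - (c - 1) = 2 by ring] at h5
      exact absurd h2u (not_isUnit_of_dvd_zmod hp (by omega) h5)
  rw [← sum_filter_add_sum_filter_not _ (fun c : (ZMod (p ^ k))ˣ =>
    (p : ZMod (p ^ k)) ^ κ * ((c : ZMod (p ^ k)) - 1) = 0), sum_mul, sum_mul]
  congr 1
  · refine sum_bij (fun c _ => (c : ZMod (p ^ k)) - 1) ?_ ?_ ?_ ?_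
    · intro c hc
      rw [filter_filter, mem_filter] at hc
      exact mem_filter.2 ⟨mem_univ _, hc.2.2⟩
    · intro c _ c' _ h
      exact Units.ext (sub_left_injective h)
    · intro n hn
      have hn' := (mem_filter.1 hn).2
      obtain ⟨c, hc⟩ := hunit n hn'
      have e : (c : ZMod (p ^ k)) - 1 = n := by rw [hc]; ring
      refine ⟨c, ?_, e⟩
      rw [filter_filter, mem_filter, ← mul_assoc, e, hn', zero_mul]
      exact ⟨mem_univ _, rfl, rfl⟩
    · intro c hc
      rw [filter_filter, mem_filter] at hc
      rw [hinv c _ hc.2.2 (by ring), ← AddChar.map_add_eq_mul]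
      congr 1; ring
  · refine sum_bij (fun c _ => -(c : ZMod (p ^ k)) - 1) ?_ ?_ ?_ ?_
    · intro c hc
      rw [filter_filter, mem_filter] at hc
      refine mem_filter.2 ⟨mem_univ _, ?_⟩
      linear_combination -(hsplit c hc.2.1 hc.2.2)
    · intro c _ c' _ h
      exact Units.ext (neg_injective (sub_left_injective h))
    · intro n hn
      have hn' := (mem_filter.1 hn).2
      obtain ⟨c, hc⟩ := hunit n hn'
      refine ⟨-c, ?_, by rw [Units.val_neg, hc]; ring⟩
      rw [filter_filter, mem_filter, Units.val_neg, hc]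
      refine ⟨mem_univ _, by linear_combination (n + 2) * hn', fun h => hpκ ?_⟩
      exact h2u.mul_left_eq_zero.1 (by linear_combination -h - hn')
    · intro c hc
      rw [filter_filter, mem_filter] at hc
      have h1 := hinv (-c) (-(c : ZMod (p ^ k)) - 1)
        (by linear_combination -(hsplit c hc.2.1 hc.2.2)) (by rw [Units.val_neg]; ring)
      rw [inv_neg, Units.val_neg, Units.val_neg] at h1
      rw [← AddChar.map_add_eq_mul]
      congr 1
      linear_combination (-y) * h1

/-- On the residue classes of `μ` and `ν` modulo `p` the Kloosterman sums vanish, or `μ ν / a` is a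
square modulo `p ^ k`. -/
theorem kloosterman_eq_zero_or_exists_sq [NeZero (p ^ k)] (hp : p.Prime) (hodd : Odd p)
    (hk : 2 ≤ k) {a : ℤ} (ha : IsUnit (a : ZMod (p ^ k))) (μ ν : ℕ) :
    (∀ m n : ℕ, m % p = μ → n % p = ν → kloosterman ((m : ℤ) * n) a (p ^ k) = 0) ∨
      (0 < μ ∧ 0 < ν ∧
        ∃ x : (ZMod (p ^ k))ˣ, (a : ZMod (p ^ k)) * x ^ 2 = (μ : ZMod (p ^ k)) * ν) := by
  by_cases hex : ∃ (m n : ℕ) (b : (ZMod (p ^ k))ˣ), m % p = μ ∧ n % p = ν ∧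
      (p : ZMod (p ^ k)) ^ ((k + 1) / 2) *
        ((((m : ℤ) * n : ℤ) : ZMod (p ^ k)) * (b : ZMod (p ^ k)) -
        a * ((b⁻¹ : (ZMod (p ^ k))ˣ) : ZMod (p ^ k))) = 0
  swap
  · left
    intro m n hm hn
    rw [kloosterman_eq_sum_units, sum_units_eq_stationary (κ := (k + 1) / 2) (by omega),
      filter_eq_empty_iff.2, sum_empty, mul_zero]
    intro b _ hb
    exact hex ⟨m, n, b, hm, hn, hb⟩
  · right
    obtain ⟨m, n, b, hm, hn, hb⟩ := hex
    have hbb : (b : ZMod (p ^ k)) * ((b⁻¹ : (ZMod (p ^ k))ˣ) : ZMod (p ^ k)) = 1 := b.mul_inv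
    obtain ⟨t, -, ht⟩ := dvd_of_pow_mul_eq_zero hp
      (by omega : k = (k + 1) / 2 + (k - (k + 1) / 2)) hb
    obtain ⟨h', hh'⟩ : ∃ h', k - (k + 1) / 2 = h' + 1 := ⟨k - (k + 1) / 2 - 1, by omega⟩
    rw [hh', pow_succ'] at ht
    have hmc : (m : ZMod (p ^ k)) = p * (m / p : ℕ) + μ := by
      rw [← hm]; exact_mod_cast congrArg (Nat.cast : ℕ → ZMod (p ^ k)) (Nat.div_add_mod m p).symm
    have hnc : (n : ZMod (p ^ k)) = p * (n / p : ℕ) + ν := by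
      rw [← hn]; exact_mod_cast congrArg (Nat.cast : ℕ → ZMod (p ^ k)) (Nat.div_add_mod n p).symm
    push_cast at ht
    obtain ⟨i, hi⟩ := ha.exists_left_inv
    obtain ⟨v, hv⟩ : ∃ v, (μ : ZMod (p ^ k)) * ν * (b : ZMod (p ^ k)) ^ 2 = a + p * v := by
      refine ⟨(p : ZMod (p ^ k)) ^ h' * (t : ZMod (p ^ k)) * (b : ZMod (p ^ k)) -
        (((m / p : ℕ) : ZMod (p ^ k)) * n + μ * ((n / p : ℕ) : ZMod (p ^ k))) *
          (b : ZMod (p ^ k)) ^ 2, ?_⟩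
      have e : (m : ZMod (p ^ k)) * n =
          μ * ν + p * (((m / p : ℕ) : ZMod (p ^ k)) * n + μ * ((n / p : ℕ) : ZMod (p ^ k))) := by
        rw [hnc]; rw [hmc]; ring
      linear_combination b * ht - b ^ 2 * e + a * hbb
    obtain ⟨f, hf⟩ := (isUnit_four_zmod (k := k) hodd).2.exists_left_inv
    set w : ZMod (p ^ k) := -(p * (v * i * f)) with hw
    have hwk : w ^ k = 0 := by
      rw [hw, neg_pow, mul_pow, natCast_pow_eq_zero]; ring
    have hs := sqrtTaylor_sq hwk
    have hau : IsUnit ((μ : ZMod (p ^ k)) * ν) := by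
      have h1 : IsUnit ((a : ZMod (p ^ k)) + p * v) := by
        rcases isUnit_or_dvd_zmod hp ((a : ZMod (p ^ k)) + (p : ZMod (p ^ k)) * v) with h | h
        · exact h
        · have := (dvd_add_left (dvd_mul_right (p : ZMod (p ^ k)) v)).1 h
          exact absurd ha (not_isUnit_of_dvd_zmod hp (by omega) this)
      rw [← hv] at h1
      exact isUnit_of_mul_isUnit_left h1
    have hnz : ∀ r : ℕ, IsUnit (r : ZMod (p ^ k)) → 0 < r := by
      intro r hr
      rcases Nat.eq_zero_or_pos r with rfl | h
      · rw [Nat.cast_zero] at hr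
        exact absurd hr (not_isUnit_of_dvd_zmod hp (by omega) (dvd_zero _))
      · exact h
    have hfin : (a : ZMod (p ^ k)) *
        (sqrtTaylor k w * ((b⁻¹ : (ZMod (p ^ k))ˣ) : ZMod (p ^ k))) ^ 2 = μ * ν := by
      rw [mul_pow, hs, hw]
      set c := ((b⁻¹ : (ZMod (p ^ k))ˣ) : ZMod (p ^ k)) with hc
      linear_combination c ^ 2 * p * v * (a * i * hf + hi) - c ^ 2 * hv +
        (μ * ν : ZMod (p ^ k)) * (b * c + 1) * hbb
    have hxu : IsUnit (sqrtTaylor k w * ((b⁻¹ : (ZMod (p ^ k))ˣ) : ZMod (p ^ k))) := by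
      rw [← hfin, sq] at hau
      exact isUnit_of_mul_isUnit_left (isUnit_of_mul_isUnit_right hau)
    refine ⟨hnz μ (isUnit_of_mul_isUnit_left hau), hnz ν (isUnit_of_mul_isUnit_right hau),
      hxu.unit, ?_⟩
    rw [IsUnit.unit_spec]
    exact hfin

end Kloosterman

/-! ### Bilinear sums over dyadic boxes -/

section Blocks

/-- Cauchy's inequality for a bilinear form over a region `rel`, smoothing the first variable. -/
theorem norm_bilinear_sq_le {S T : Finset ℕ} (rel : ℕ → ℕ → Prop) [∀ m n, Decidable (rel m n)]
    {α β : ℕ → ℂ} (hα : ∀ m ∈ S, ‖α m‖ ≤ 1) (hβ : ∀ n ∈ T, ‖β n‖ ≤ 1) (φ : ℕ → ℕ → ℂ) :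
    ‖∑ m ∈ S, ∑ n ∈ T with rel m n, α m * β n * φ m n‖ ^ 2 ≤
      #S * ∑ n ∈ T, ∑ n' ∈ T, ‖∑ m ∈ S with rel m n ∧ rel m n', φ m n * star (φ m n')‖ := by
  set c : ℕ → ℂ := fun m => ∑ n ∈ T with rel m n, β n * φ m n with hc
  have h1 : ‖∑ m ∈ S, ∑ n ∈ T with rel m n, α m * β n * φ m n‖ ≤ ∑ m ∈ S, ‖c m‖ := by
    refine (norm_sum_le _ _).trans (sum_le_sum fun m hm => ?_)
    simp_rw [mul_assoc, ← mul_sum]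
    rw [norm_mul]
    exact mul_le_of_le_one_left (norm_nonneg _) (hα m hm)
  have h2 : (∑ m ∈ S, ‖c m‖) ^ 2 ≤ #S * ∑ m ∈ S, ‖c m‖ ^ 2 := sq_sum_le_card_mul_sum_sq
  have h3 : ((∑ m ∈ S, ‖c m‖ ^ 2 : ℝ) : ℂ) = ∑ n ∈ T, ∑ n' ∈ T, β n * star (β n') *
      ∑ m ∈ S with rel m n ∧ rel m n', φ m n * star (φ m n') := by
    rw [Complex.ofReal_sum]
    have e : ∀ m ∈ S, ((‖c m‖ ^ 2 : ℝ) : ℂ) = ∑ n ∈ T, ∑ n' ∈ T,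
        if rel m n ∧ rel m n' then β n * star (β n') * (φ m n * star (φ m n')) else 0 := by
      intro m _
      rw [Complex.ofReal_pow, ← Complex.mul_conj']
      simp only [hc, map_sum, sum_filter, sum_mul_sum]
      refine sum_congr rfl fun n _ => sum_congr rfl fun n' _ => ?_
      by_cases ha : rel m n <;> by_cases hb : rel m n' <;> simp [ha, hb]
      ring
    rw [sum_congr rfl e, sum_comm]
    refine sum_congr rfl fun n _ => ?_
    rw [sum_comm]
    refine sum_congr rfl fun n' _ => ?_
    rw [mul_sum, sum_filter]
  have h4 : ∑ m ∈ S, ‖c m‖ ^ 2 ≤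
      ∑ n ∈ T, ∑ n' ∈ T, ‖∑ m ∈ S with rel m n ∧ rel m n', φ m n * star (φ m n')‖ := by
    have e : ∑ m ∈ S, ‖c m‖ ^ 2 = ‖((∑ m ∈ S, ‖c m‖ ^ 2 : ℝ) : ℂ)‖ := by
      rw [Complex.norm_real, Real.norm_of_nonneg]
      exact sum_nonneg fun _ _ => by positivity
    rw [e, h3]
    refine (norm_sum_le _ _).trans (sum_le_sum fun n hn => ?_)
    refine (norm_sum_le _ _).trans (sum_le_sum fun n' hn' => ?_)
    rw [norm_mul, norm_mul, norm_star]
    exact mul_le_of_le_one_left (norm_nonneg _)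
      (mul_le_one₀ (hβ n hn) (norm_nonneg _) (hβ n' hn'))
  exact (pow_le_pow_left₀ (norm_nonneg _) h1 2).trans
    (h2.trans (mul_le_mul_of_nonneg_left h4 (by positivity)))

theorem card_filter_dvd_sub_le {T : Finset ℕ} {N Q : ℕ} (hT : ∀ n ∈ T, n ≤ N) (n : ℕ) :
    #{n' ∈ T | (Q : ℤ) ∣ (n : ℤ) - (n' : ℕ)} ≤ N / Q + 1 := by
  rw [← card_range (N / Q + 1)]
  have hmod : ∀ n' : ℕ, (Q : ℤ) ∣ (n : ℤ) - n' → n' % Q = n % Q := fun n' h =>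
    Nat.modEq_iff_dvd.2 h
  refine card_le_card_of_injOn (fun n' => n' / Q) ?_ ?_
  · intro n' hn'
    have := (mem_filter.1 hn').1
    exact mem_coe.2 (mem_range.2 (Nat.lt_succ_of_le (Nat.div_le_div_right (hT _ this))))
  · intro x hx y hy h
    have h1 := hmod x (mem_filter.1 hx).2
    have h2 := hmod y (mem_filter.1 hy).2
    simp only at h
    rw [← Nat.div_add_mod x Q, ← Nat.div_add_mod y Q, h, h1, h2]

/-- The differences of the values of a branch are those of the arguments, up to units. -/
theorem IsSqrtBranch.exists_sub_eq {p k ν : ℕ} {G : ℕ → ZMod (p ^ k)}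
    (hG : IsSqrtBranch p (p ^ k) ν G) (hp : p.Prime) (hodd : Odd p) (hν : 0 < ν) (hνp : ν < p)
    {n n' : ℕ} (hn : n % p = ν) (hn' : n' % p = ν) :
    ∃ g : ZMod (p ^ k), IsUnit g ∧ G n - G n' = g * (((n : ℤ) - n' : ℤ) : ZMod (p ^ k)) := by
  obtain ⟨e1, t1, h1⟩ := hG n hn
  obtain ⟨e2, t2, h2⟩ := hG n' hn'
  have hu : IsUnit (G n + G n') := by
    have e : G n + G n' = 2 + p * (t1 + t2) := by rw [h1, h2]; ring
    have hnil : IsNilpotent ((p : ZMod (p ^ k)) * (t1 + t2)) :=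
      (Commute.all _ _).isNilpotent_mul_right ⟨k, natCast_pow_eq_zero p k⟩
    rw [e]
    exact hnil.isUnit_add_left_of_commute (isUnit_four_zmod hodd).1 (Commute.all _ _)
  obtain ⟨g, hg⟩ := (hu.mul (isUnit_natCast_of_mod (k := k) hp hν
    (Nat.mod_eq_of_lt hνp))).exists_left_inv
  refine ⟨g, IsUnit.of_mul_eq_one _ hg, ?_⟩
  push_cast
  linear_combination g * e1 - g * e2 - (G n - G n') * hg

/-- The bilinear sum over a dyadic block `M ≤ m < 2 M` of the hyperbolic region. After Cauchy's
inequality, the pairs `(n, n')` with `n ≡ n'` modulo `p ^ (k / 10 + 1)` are estimated trivially, and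
for the others the sum over `m` is a short sum with `D = n - n'`. -/
theorem exists_norm_block_sq_le {e : ℕ} (he : 0 < e) :
    ∃ C : ℝ, 0 < C ∧ ∀ (p k s μ ν : ℕ) [NeZero (p ^ k)], p.Prime → Odd p → 44 ≤ s →
      k ≤ 20 * e * s → 20 * e * s ≤ k + 20 * e → 0 < μ → μ < p → 0 < ν → ν < p →
      ∀ F, IsSqrtBranch p (p ^ k) μ F → ∀ G, IsSqrtBranch p (p ^ k) ν G →
      ∀ (A : ZMod (p ^ k)), IsUnit A → ∀ (M Y M₀ N₀ : ℕ), 0 < M →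
      ∀ α β : ℕ → ℂ, (∀ m : ℕ, 1 ≤ m → ‖α m‖ ≤ 1) → (∀ n : ℕ, 1 ≤ n → ‖β n‖ ≤ 1) →
        ‖∑ m ∈ Ico (max M M₀) (2 * M) with m % p = μ,
            ∑ n ∈ {n ∈ Icc 1 (Y / M) | N₀ ≤ n ∧ n % p = ν} with m * n ≤ Y,
              α m * β n * ZMod.stdAddChar (A * F m * G n)‖ ^ 2 ≤
          M * ((Y / M : ℕ) * (((Y / M : ℕ) : ℝ) / (p : ℝ) ^ (k / 10 + 1) + 1) * M +
            ((Y / M : ℕ) : ℝ) ^ 2 * (2 * (p : ℝ) ^ (3 * s) +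
              M * (C * ((p : ℝ) ^ s) ^ (-(1 / (4608000 * e ^ 2)) : ℝ)))) := by
  obtain ⟨C, hC, hshort⟩ := exists_norm_short_sum_le he
  refine ⟨C, hC, ?_⟩
  intro p k s μ ν _ hp hodd hs hks hsk hμ hμp hν hνp F hF G hG A hA M Y M₀ N₀ hM α β hα hβ
  set N := Y / M with hN
  set S := {m ∈ Ico (max M M₀) (2 * M) | m % p = μ} with hS
  set T := {n ∈ Icc 1 N | N₀ ≤ n ∧ n % p = ν} with hT
  set Q := p ^ (k / 10 + 1) with hQ
  set E : ℝ := 2 * (p : ℝ) ^ (3 * s) +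
    M * (C * ((p : ℝ) ^ s) ^ (-(1 / (4608000 * e ^ 2)) : ℝ)) with hE
  have hE0 : 0 ≤ E := by positivity
  have hScard : #S ≤ M := by
    refine (card_filter_le _ _).trans ?_
    rw [Nat.card_Ico]; omega
  have hTcard : #T ≤ N := by
    refine (card_filter_le _ _).trans ?_
    rw [Nat.card_Icc, Nat.add_sub_cancel]
  have hS1 : ∀ m ∈ S, 1 ≤ m := by
    intro m hm
    have := Finset.mem_Ico.1 (mem_filter.1 hm).1
    omega
  have hT1 : ∀ n ∈ T, 1 ≤ n := fun n hn => (Finset.mem_Icc.1 (mem_filter.1 hn).1).1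
  have hTN : ∀ n ∈ T, n ≤ N := fun n hn => (Finset.mem_Icc.1 (mem_filter.1 hn).1).2
  refine (norm_bilinear_sq_le (fun m n => m * n ≤ Y) (fun m hm => hα m (hS1 m hm))
    (fun n hn => hβ n (hT1 n hn)) _).trans ?_
  refine mul_le_mul (by exact_mod_cast hScard) ?_
    (sum_nonneg fun _ _ => sum_nonneg fun _ _ => norm_nonneg _) (by positivity)
  -- a single pair `(n, n')`
  have hpair : ∀ n ∈ T, ∀ n' ∈ T,
      ‖∑ m ∈ S with m * n ≤ Y ∧ m * n' ≤ Y, ZMod.stdAddChar (A * F m * G n) *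
        star (ZMod.stdAddChar (A * F m * G n'))‖ ≤
      (if (Q : ℤ) ∣ (n : ℤ) - n' then (M : ℝ) else 0) + E := by
    intro n hn n' hn'
    split_ifs with hdvd
    · refine (norm_sum_le _ _).trans ?_
      have : ∀ m ∈ {m ∈ S | m * n ≤ Y ∧ m * n' ≤ Y}, ‖ZMod.stdAddChar (A * F m * G n) *
          star (ZMod.stdAddChar (A * F m * G n'))‖ = 1 := by
        intro m _
        rw [norm_mul, norm_star, AddChar.norm_apply, AddChar.norm_apply, mul_one]
      rw [sum_congr rfl this, sum_const, nsmul_eq_mul, mul_one]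
      have h1 : (#{m ∈ S | m * n ≤ Y ∧ m * n' ≤ Y} : ℝ) ≤ M := by
        exact_mod_cast (card_filter_le _ _).trans hScard
      linarith
    · rw [zero_add]
      obtain ⟨g, hg, hgn⟩ := hG.exists_sub_eq hp hodd hν hνp (mem_filter.1 hn).2.2
        (mem_filter.1 hn').2.2
      have hset : {m ∈ S | m * n ≤ Y ∧ m * n' ≤ Y} =
          {m ∈ Ico (max M M₀) (min (2 * M) (Y / max n n' + 1)) | m % p = μ} := by
        ext m
        have hn1 := hT1 n hn
        have hn1' := hT1 n' hn'
        have e : m < Y / max n n' + 1 ↔ m * n ≤ Y ∧ m * n' ≤ Y := by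
          rw [Nat.lt_succ_iff, Nat.le_div_iff_mul_le (by omega), mul_max_of_nonneg _ _ (by omega),
            max_le_iff]
        simp only [hS, mem_filter, Finset.mem_Ico, lt_min_iff, e]
        tauto
      have hterm : ∀ m, ZMod.stdAddChar (A * F m * G n) *
          star (ZMod.stdAddChar (A * F m * G n')) =
          ZMod.stdAddChar ((A * g) * (((n : ℤ) - n' : ℤ) : ZMod (p ^ k)) * F m) := by
        intro m
        have : star (ZMod.stdAddChar (A * F m * G n')) =
            ZMod.stdAddChar (-(A * F m * G n')) := by
          rw [AddChar.map_neg_eq_conj]; rfl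
        rw [this, ← AddChar.map_add_eq_mul]
        congr 1
        linear_combination (A * F m) * hgn
      simp_rw [hterm]
      rw [hset]
      have hD : ¬ (p : ℤ) ^ (k / 10 + 1) ∣ (n : ℤ) - n' := by
        intro h; exact hdvd (by rw [hQ]; push_cast; exact h)
      refine (hshort p k s μ hp hodd hs hks hsk hμ hμp F hF (A * g) _ (hA.mul hg) hD _ _).trans ?_
      rw [hE]
      gcongr
      omega
  calc _ ≤ ∑ n ∈ T, ∑ n' ∈ T, ((if (Q : ℤ) ∣ (n : ℤ) - n' then (M : ℝ) else 0) + E) :=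
        sum_le_sum fun n hn => sum_le_sum fun n' hn' => hpair n hn n' hn'
    _ ≤ ∑ _n ∈ T, (((N : ℝ) / (p : ℝ) ^ (k / 10 + 1) + 1) * M + N * E) := by
        refine sum_le_sum fun n _ => ?_
        rw [sum_add_distrib, ← sum_filter, sum_const, sum_const, nsmul_eq_mul, nsmul_eq_mul]
        have h1 : (#{n' ∈ T | (Q : ℤ) ∣ (n : ℤ) - (n' : ℕ)} : ℝ) ≤
            (N : ℝ) / (p : ℝ) ^ (k / 10 + 1) + 1 := by
          have h2 := card_filter_dvd_sub_le (Q := Q) hTN n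
          have h3 : ((N / Q : ℕ) : ℝ) ≤ (N : ℝ) / Q := Nat.cast_div_le
          have h4 : (Q : ℝ) = (p : ℝ) ^ (k / 10 + 1) := by rw [hQ]; push_cast; rfl
          rw [← h4]
          have h5 : (#{n' ∈ T | (Q : ℤ) ∣ (n : ℤ) - (n' : ℕ)} : ℝ) ≤ ((N / Q + 1 : ℕ) : ℝ) := by
            exact_mod_cast h2
          push_cast at h5
          linarith
        have h6 : (#T : ℝ) ≤ N := by exact_mod_cast hTcard
        gcongr
    _ = #T * (((N : ℝ) / (p : ℝ) ^ (k / 10 + 1) + 1) * M + N * E) := by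
        rw [sum_const, nsmul_eq_mul]
    _ ≤ N * (((N : ℝ) / (p : ℝ) ^ (k / 10 + 1) + 1) * M + N * E) := by
        have h6 : (#T : ℝ) ≤ N := by exact_mod_cast hTcard
        gcongr
    _ = _ := by ring

end Blocks

/-! ### Bilinear sums over the hyperbolic region -/

section Hyperbola

/-- The three contributions to a block (diagonal pairs, shift error and main term) each save a
factor `ε`. -/
theorem block_arith {M N Q P₃ W C ε X : ℝ} (hM : 0 < M) (hN : 0 < N) (hC : 0 < C) (hQ0 : 0 < Q)
    (hε : 0 ≤ ε)
    (hMN : M * N ≤ X) (hQ : 1 ≤ ε * Q) (hN' : 1 ≤ ε * N) (hP : P₃ ≤ 2 * ε * M) (hW : W ≤ ε) :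
    M * (N * (N / Q + 1) * M + N ^ 2 * (2 * P₃ + M * (C * W))) ≤ (6 + C) * (X ^ 2 * ε) := by
  have h1 : N / Q ≤ ε * N := by
    rw [div_le_iff₀ hQ0]; nlinarith
  have h2 : N * (N / Q + 1) * M ≤ N * (ε * N + ε * N) * M := by gcongr
  have h3 : N ^ 2 * (2 * P₃ + M * (C * W)) ≤ N ^ 2 * (2 * (2 * ε * M) + M * (C * ε)) := by gcongr
  have h4 : (M * N) ^ 2 ≤ X ^ 2 := pow_le_pow_left₀ (by positivity) hMN 2
  calc _ ≤ M * (N * (ε * N + ε * N) * M + N ^ 2 * (2 * (2 * ε * M) + M * (C * ε))) := by gcongr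
    _ = (6 + C) * ((M * N) ^ 2 * ε) := by ring
    _ ≤ _ := by gcongr

/-- The dyadic decomposition of a residue class of the hyperbolic region. -/
theorem sum_hyperbolicRegion_eq {U V X : ℝ} (hX : 0 ≤ X) (p μ ν : ℕ) (f : ℕ → ℕ → ℂ) :
    ∑ z ∈ hyperbolicRegion U V X with z.1 % p = μ ∧ z.2 % p = ν, f z.1 z.2 =
      ∑ i ∈ range (Nat.log 2 ⌊X⌋₊ + 1),
        ∑ m ∈ Ico (max (2 ^ i) ⌈U⌉₊) (2 * 2 ^ i) with m % p = μ,
          ∑ n ∈ {n ∈ Icc 1 (⌊X⌋₊ / 2 ^ i) | ⌈V⌉₊ ≤ n ∧ n % p = ν} with m * n ≤ ⌊X⌋₊, f m n := by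
  set Y := ⌊X⌋₊ with hY
  have hle : ∀ m n : ℕ, (m : ℝ) * n ≤ X ↔ m * n ≤ Y := by
    intro m n
    rw [hY, Nat.le_floor_iff hX]; push_cast; rfl
  have hmaps : ∀ z ∈ {z ∈ hyperbolicRegion U V X | z.1 % p = μ ∧ z.2 % p = ν},
      Nat.log 2 z.1 ∈ range (Nat.log 2 Y + 1) := by
    rintro ⟨m, n⟩ hz
    have h := mem_hyperbolicRegion.1 (mem_filter.1 hz).1
    rw [hle] at h
    refine mem_range.2 (Nat.lt_succ_of_le (Nat.log_mono_right ?_))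
    exact le_trans (Nat.le_mul_of_pos_right m h.2.1) h.2.2.2.2
  rw [← sum_fiberwise_of_maps_to hmaps]
  refine sum_congr rfl fun i _ => ?_
  simp_rw [sum_filter (s := {n ∈ Icc 1 (Y / 2 ^ i) | ⌈V⌉₊ ≤ n ∧ n % p = ν})]
  rw [← sum_product', ← sum_filter]
  refine sum_congr ?_ fun _ _ => rfl
  ext ⟨m, n⟩
  have h2i : 0 < 2 ^ i := by positivity
  simp only [mem_filter, mem_product, mem_hyperbolicRegion, hle, Finset.mem_Ico, Finset.mem_Icc,
    max_le_iff, Nat.ceil_le, Nat.le_div_iff_mul_le h2i]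
  constructor
  · rintro ⟨⟨⟨h1, h2, h3, h4, h5⟩, h6, h7⟩, h8⟩
    have h9 := (Nat.log_eq_iff (Or.inr ⟨one_lt_two, by omega⟩)).1 h8
    rw [pow_succ'] at h9
    refine ⟨⟨⟨⟨⟨h9.1, h3⟩, h9.2⟩, h6⟩, ⟨h2, ?_⟩, h4, h7⟩, h5⟩
    calc n * 2 ^ i ≤ n * m := Nat.mul_le_mul_left n h9.1
      _ ≤ Y := by rw [mul_comm]; exact h5
  · rintro ⟨⟨⟨⟨⟨h1, h3⟩, h9⟩, h6⟩, ⟨h2, h10⟩, h4, h7⟩, h5⟩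
    refine ⟨⟨⟨by omega, h2, h3, h4, h5⟩, h6, h7⟩, ?_⟩
    refine (Nat.log_eq_iff (Or.inr ⟨one_lt_two, by omega⟩)).2 ⟨h1, ?_⟩
    rw [pow_succ']; exact h9

/-- The bilinear sum over a pair of residue classes modulo `p`. The shifts have length `p ^ s`,
about `q ^ (1 / (20 e))`, so that the short sums save `q ^ θ` with `θ = 1 / (20 e * 4608000 e ^ 2)`;
Cauchy's inequality leaves half of the exponent. -/
theorem exists_norm_class_le {e : ℕ} (he : 0 < e) {lam : ℝ} (h0 : 0 < lam)
    (hel : 1 / (e : ℝ) ≤ lam) :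
    ∃ C : ℝ, 0 < C ∧ ∀ (p k μ ν : ℕ) [NeZero (p ^ k)], p.Prime → Odd p → 880 * e ≤ k →
      12 / lam ≤ k → 0 < μ → μ < p → 0 < ν → ν < p →
      ∀ F, IsSqrtBranch p (p ^ k) μ F → ∀ G, IsSqrtBranch p (p ^ k) ν G →
      ∀ A : ZMod (p ^ k), IsUnit A → ∀ U V X : ℝ, ((p ^ k : ℕ) : ℝ) ^ lam < U →
      ((p ^ k : ℕ) : ℝ) ^ lam < V → 0 ≤ X →
      ∀ α β : ℕ → ℂ, (∀ m : ℕ, 1 ≤ m → ‖α m‖ ≤ 1) → (∀ n : ℕ, 1 ≤ n → ‖β n‖ ≤ 1) →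
        ‖∑ z ∈ hyperbolicRegion U V X with z.1 % p = μ ∧ z.2 % p = ν,
          α z.1 * β z.2 * ZMod.stdAddChar (A * F z.1 * G z.2)‖ ≤
        (Nat.log 2 ⌊X⌋₊ + 1) *
          (C * (X * ((p ^ k : ℕ) : ℝ) ^ (-(1 / (184320000 * e ^ 3)) : ℝ))) := by
  obtain ⟨C, hC, hblock⟩ := exists_norm_block_sq_le he
  refine ⟨Real.sqrt (6 + C), Real.sqrt_pos.2 (by linarith), ?_⟩
  intro p k μ ν _ hp hodd hk1 hk2 hμ hμp hν hνp F hF G hG A hA U V X hU hV hX α β hα hβ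
  have heR : (1 : ℝ) ≤ e := by exact_mod_cast he
  have hpR : (1 : ℝ) ≤ p := by exact_mod_cast hp.one_lt.le
  have hp0 : (0 : ℝ) < p := by linarith
  have hk0 : (0 : ℝ) ≤ k := by positivity
  set q : ℝ := ((p ^ k : ℕ) : ℝ) with hq
  have hqpow : ∀ x : ℝ, q ^ x = (p : ℝ) ^ (k * x) := by
    intro x
    rw [hq, Nat.cast_pow, ← Real.rpow_natCast, ← Real.rpow_mul hp0.le]
  have hq1 : 1 ≤ q := by rw [hq]; exact_mod_cast Nat.one_le_pow _ _ hp.pos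
  have hq0 : 0 < q := by linarith
  set θ : ℝ := 1 / (92160000 * e ^ 3) with hθ
  have hθ0 : 0 < θ := by positivity
  have he3 : (e : ℝ) ≤ e ^ 3 := by
    calc (e : ℝ) = e ^ 1 := (pow_one _).symm
      _ ≤ e ^ 3 := pow_le_pow_right₀ heR (by norm_num)
  have hθe : θ ≤ 1 / (92160000 * e) := by
    rw [hθ]; gcongr
  have hθ1 : θ ≤ 1 / 10 := by
    refine hθe.trans ?_
    gcongr
    linarith
  have hθ2 : θ ≤ lam / 2 := by
    refine hθe.trans ?_
    have : (1 : ℝ) / (92160000 * e) = 1 / 92160000 * (1 / e) := by field_simp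
    rw [this]
    nlinarith
  -- the length `p ^ s` of the shifts
  obtain ⟨s, hs, hks, hsk⟩ : ∃ s, 44 ≤ s ∧ k ≤ 20 * e * s ∧ 20 * e * s ≤ k + 20 * e := by
    refine ⟨(k + 20 * e - 1) / (20 * e), ?_, ?_, ?_⟩
    · rw [Nat.le_div_iff_mul_le (by omega)]; omega
    all_goals
      have h1 := Nat.div_add_mod (k + 20 * e - 1) (20 * e)
      have h2 := Nat.mod_lt (k + 20 * e - 1) (show 0 < 20 * e by omega)
      generalize (k + 20 * e - 1) / (20 * e) = s at *
      generalize 20 * e * s = w at *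
      omega
  have hsk' : (20 * e * s : ℝ) ≤ k + 20 * e := by exact_mod_cast hsk
  have hks' : (k : ℝ) ≤ 20 * e * s := by exact_mod_cast hks
  have hP3 : (p : ℝ) ^ (3 * s) ≤ q ^ (lam / 2) := by
    rw [hqpow, ← Real.rpow_natCast]
    refine Real.rpow_le_rpow_of_exponent_le hpR ?_
    have h1 : (12 : ℝ) ≤ k * lam := by rwa [div_le_iff₀ h0] at hk2
    have h2 : (s : ℝ) ≤ k * (1 / e) / 20 + 1 := by
      have : (20 * e * s : ℝ) ≤ 20 * e * (k * (1 / e) / 20 + 1) := by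
        refine hsk'.trans (le_of_eq ?_); field_simp
      exact le_of_mul_le_mul_left this (by positivity)
    have h3 : (k : ℝ) * (1 / e) ≤ k * lam := by gcongr
    push_cast
    nlinarith
  have hW : ((p : ℝ) ^ s) ^ (-(1 / (4608000 * e ^ 2)) : ℝ) ≤ q ^ (-θ) := by
    rw [hqpow, ← Real.rpow_natCast, ← Real.rpow_mul hp0.le]
    refine Real.rpow_le_rpow_of_exponent_le hpR ?_
    have : (k : ℝ) * θ ≤ s * (1 / (4608000 * e ^ 2)) := by
      calc (k : ℝ) * θ ≤ (20 * e * s) * θ := by gcongr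
        _ = s * (1 / (4608000 * e ^ 2)) := by rw [hθ]; field_simp; norm_num
    linarith
  have hQ : 1 ≤ q ^ (-θ) * (p : ℝ) ^ (k / 10 + 1) := by
    rw [hqpow, ← Real.rpow_natCast, ← Real.rpow_add hp0]
    refine Real.one_le_rpow hpR ?_
    have h1 : (k : ℝ) ≤ 10 * ((k / 10 + 1 : ℕ) : ℝ) := by
      have : k ≤ 10 * (k / 10 + 1) := by omega
      exact_mod_cast this
    nlinarith
  -- the individual blocks
  have hB : ∀ i, ‖∑ m ∈ Ico (max (2 ^ i) ⌈U⌉₊) (2 * 2 ^ i) with m % p = μ,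
      ∑ n ∈ {n ∈ Icc 1 (⌊X⌋₊ / 2 ^ i) | ⌈V⌉₊ ≤ n ∧ n % p = ν} with m * n ≤ ⌊X⌋₊,
        α m * β n * ZMod.stdAddChar (A * F m * G n)‖ ≤
      Real.sqrt (6 + C) * (X * q ^ (-(1 / (184320000 * e ^ 3)) : ℝ)) := by
    intro i
    by_cases hne : ∃ m ∈ Ico (max (2 ^ i) ⌈U⌉₊) (2 * 2 ^ i), ∃ n ∈ Icc 1 (⌊X⌋₊ / 2 ^ i), ⌈V⌉₊ ≤ n
    swap
    · have hz : ∑ m ∈ Ico (max (2 ^ i) ⌈U⌉₊) (2 * 2 ^ i) with m % p = μ,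
          ∑ n ∈ {n ∈ Icc 1 (⌊X⌋₊ / 2 ^ i) | ⌈V⌉₊ ≤ n ∧ n % p = ν} with m * n ≤ ⌊X⌋₊,
            α m * β n * ZMod.stdAddChar (A * F m * G n) = 0 := by
        refine sum_eq_zero fun m hm => ?_
        rw [sum_eq_zero]
        intro n hn
        have h1 := mem_filter.1 (mem_filter.1 hn).1
        exact absurd ⟨m, (mem_filter.1 hm).1, n, h1.1, h1.2.1⟩ hne
      rw [hz, norm_zero]
      positivity
    obtain ⟨m, hm, n, hn, hVn⟩ := hne
    rw [Finset.mem_Ico, max_le_iff, Nat.ceil_le] at hm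
    rw [Finset.mem_Icc] at hn
    rw [Nat.ceil_le] at hVn
    set N := ⌊X⌋₊ / 2 ^ i with hN
    have hM2 : q ^ lam ≤ 2 * (2 : ℝ) ^ i := by
      have : (m : ℝ) ≤ 2 * (2 : ℝ) ^ i := by exact_mod_cast hm.2.le
      linarith [hm.1.2]
    have hNq : q ^ lam ≤ N := by
      have : (n : ℝ) ≤ N := by exact_mod_cast hn.2
      linarith
    have hql : 0 < q ^ lam := Real.rpow_pos_of_pos hq0 _
    have hMN : (2 : ℝ) ^ i * N ≤ X := by
      have h1 : 2 ^ i * N ≤ ⌊X⌋₊ := Nat.mul_div_le _ _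
      have h2 : ((2 ^ i * N : ℕ) : ℝ) ≤ X := (Nat.le_floor_iff hX).1 h1
      push_cast at h2
      exact h2
    have hsq := hblock p k s μ ν hp hodd hs hks hsk hμ hμp hν hνp F hF G hG A hA (2 ^ i) ⌊X⌋₊
      ⌈U⌉₊ ⌈V⌉₊ (by positivity) α β hα hβ
    have hfin := block_arith (M := (2 : ℝ) ^ i) (N := N) (Q := (p : ℝ) ^ (k / 10 + 1))
      (P₃ := (p : ℝ) ^ (3 * s)) (W := ((p : ℝ) ^ s) ^ (-(1 / (4608000 * e ^ 2)) : ℝ)) (C := C)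
      (ε := q ^ (-θ)) (X := X) (by positivity) (by linarith) hC (by positivity) (by positivity)
      hMN hQ ?_ ?_ hW
    · rw [← hN] at hsq
      push_cast at hsq
      have h1 := hsq.trans hfin
      have h2 : (6 + C) * (X ^ 2 * q ^ (-θ)) =
          (Real.sqrt (6 + C) * (X * q ^ (-(1 / (184320000 * e ^ 3)) : ℝ))) ^ 2 := by
        rw [mul_pow, mul_pow, Real.sq_sqrt (by linarith), ← Real.rpow_natCast (q ^ _),
          ← Real.rpow_mul hq0.le]
        congr 3
        rw [hθ]
        push_cast
        field_simp
        norm_num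
      rw [h2] at h1
      exact le_of_sq_le_sq h1 (by positivity)
    · calc (1 : ℝ) ≤ q ^ (-θ) * q ^ lam := by
            rw [← Real.rpow_add hq0]
            exact Real.one_le_rpow hq1 (by linarith)
        _ ≤ _ := by gcongr
    · calc (p : ℝ) ^ (3 * s) ≤ q ^ (lam / 2) := hP3
        _ = q ^ (-(lam / 2)) * q ^ lam := by rw [← Real.rpow_add hq0]; congr 1; ring
        _ ≤ q ^ (-θ) * (2 * (2 : ℝ) ^ i) := by
            gcongr
        _ = _ := by ring
  rw [sum_hyperbolicRegion_eq hX p μ ν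
    (fun m n => α m * β n * ZMod.stdAddChar (A * F m * G n))]
  refine (norm_sum_le _ _).trans ((sum_le_sum fun i _ => hB i).trans (le_of_eq ?_))
  rw [sum_const, card_range, nsmul_eq_mul]
  push_cast
  rfl

end Hyperbola

/-! ### Recombination of the residue classes -/

section Assembly

/-- On a pair of residue classes modulo `p`, the Kloosterman sum is a combination, with constant
coefficients of size at most `√p`, of the two characters `ψ(±A F(m) G(n))`, so that its bilinear
sums inherit any bound `B` valid for all such characters. -/
theorem norm_sum_kloosterman_class_le {p k μ ν : ℕ} [NeZero (p ^ k)] (hp : p.Prime) (hodd : Odd p)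
    (hk : 3 ≤ k) (hμp : μ < p) (hνp : ν < p) {a : ℤ} (ha : IsUnit (a : ZMod (p ^ k)))
    (S : Finset (ℕ × ℕ)) (hS : ∀ z ∈ S, z.1 % p = μ ∧ z.2 % p = ν) (α β : ℕ → ℂ) {B : ℝ}
    (hB0 : 0 ≤ B)
    (hB : 0 < μ → 0 < ν → ∀ F, IsSqrtBranch p (p ^ k) μ F → ∀ G, IsSqrtBranch p (p ^ k) ν G →
      ∀ A : ZMod (p ^ k), IsUnit A →
        ‖∑ z ∈ S, α z.1 * β z.2 * ZMod.stdAddChar (A * F z.1 * G z.2)‖ ≤ B) :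
    ‖∑ z ∈ S, α z.1 * β z.2 * kloosterman ((z.1 : ℤ) * z.2) a (p ^ k)‖ ≤ 2 * √p * B := by
  rcases kloosterman_eq_zero_or_exists_sq hp hodd (by omega) ha μ ν with h | ⟨hμ, hν, x, hx⟩
  · rw [Finset.sum_eq_zero]
    · simp only [norm_zero]; positivity
    · intro z hz
      rw [h _ _ (hS z hz).1 (hS z hz).2, mul_zero]
  obtain ⟨F, hF⟩ := exists_isSqrtBranch (k := k) hp hodd hμ hμp
  obtain ⟨G, hG⟩ := exists_isSqrtBranch (k := k) hp hodd hν hνp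
  set A : ZMod (p ^ k) := a * x with hA
  have hAu : IsUnit (2 * A) := (isUnit_four_zmod hodd).1.mul (ha.mul x.isUnit)
  have key : ∀ z ∈ S, α z.1 * β z.2 * kloosterman ((z.1 : ℤ) * z.2) a (p ^ k) =
      localGauss p k A * (α z.1 * β z.2 * ZMod.stdAddChar (2 * A * F z.1 * G z.2)) +
      localGauss p k (-A) * (α z.1 * β z.2 * ZMod.stdAddChar (-(2 * A) * F z.1 * G z.2)) := by
    intro z hz
    obtain ⟨h1, h2⟩ := hS z hz
    obtain ⟨hF1, t, hFt⟩ := hF z.1 h1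
    obtain ⟨hG1, s, hGs⟩ := hG z.2 h2
    obtain ⟨u, hu⟩ := hF.isUnit hp hμ h1
    obtain ⟨v, hv⟩ := hG.isUnit hp hν h2
    have hM : (((z.1 : ℤ) * z.2 : ℤ) : ZMod (p ^ k)) =
        a * ((x * u * v : (ZMod (p ^ k))ˣ) : ZMod (p ^ k)) ^ 2 := by
      push_cast
      rw [hu, hv, ← hF1, ← hG1]
      linear_combination -(F z.1 ^ 2 * G z.2 ^ 2) * hx
    have hval : (a : ZMod (p ^ k)) * ((x * u * v : (ZMod (p ^ k))ˣ) : ZMod (p ^ k)) =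
        A * F z.1 * G z.2 := by
      push_cast
      rw [hu, hv, hA]; ring
    rw [kloosterman_eq_of_sq hp hodd hk (x * u * v) ha hM, hval,
      localGauss_congr hp (y := A * F z.1 * G z.2) (z := A) (t := A * (t + s + p * t * s))
        (by rw [hFt, hGs]; ring),
      localGauss_congr hp (y := -(A * F z.1 * G z.2)) (z := -A)
        (t := -A * (t + s + p * t * s)) (by rw [hFt, hGs]; ring),
      show 2 * (A * F z.1 * G z.2) = 2 * A * F z.1 * G z.2 by ring,
      show -(2 * A * F z.1 * G z.2) = -(2 * A) * F z.1 * G z.2 by ring]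
    ring
  rw [Finset.sum_congr rfl key, Finset.sum_add_distrib, ← Finset.mul_sum, ← Finset.mul_sum]
  refine (norm_add_le _ _).trans ?_
  rw [norm_mul, norm_mul]
  have e1 := mul_le_mul (norm_localGauss_le (k := k) hp A) (hB hμ hν F hF G hG _ hAu)
    (norm_nonneg _) (Real.sqrt_nonneg _)
  have e2 := mul_le_mul (norm_localGauss_le (k := k) hp (-A)) (hB hμ hν F hF G hG _ hAu.neg)
    (norm_nonneg _) (Real.sqrt_nonneg _)
  linarith

theorem natLog_floor_add_one_le {X q ε : ℝ} (hX : 0 < X) (hXq : X ≤ q) (hq : 1 ≤ q) (hε : 0 < ε) :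
    (Nat.log 2 ⌊X⌋₊ + 1 : ℝ) ≤ (2 / ε + 1) * q ^ ε := by
  have hq0 : 0 < q := by linarith
  have h1 : (1 : ℝ) ≤ q ^ ε := Real.one_le_rpow hq hε.le
  have h2 : (Nat.log 2 ⌊X⌋₊ : ℝ) ≤ 2 / ε * q ^ ε := by
    have h3 : (2 : ℝ) ^ Nat.log 2 ⌊X⌋₊ ≤ q := by
      rcases Nat.eq_zero_or_pos ⌊X⌋₊ with h | h
      · rw [h]; simpa using hq
      · calc (2 : ℝ) ^ Nat.log 2 ⌊X⌋₊ ≤ (⌊X⌋₊ : ℝ) := by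
              exact_mod_cast Nat.pow_log_le_self 2 h.ne'
          _ ≤ X := Nat.floor_le hX.le
          _ ≤ q := hXq
    have h4 := Real.log_le_log (by positivity) h3
    rw [Real.log_pow] at h4
    have h5 := Real.log_le_rpow_div hq0.le hε
    have h6 : (1 / 2 : ℝ) ≤ Real.log 2 := by linarith [Real.log_two_gt_d9]
    have h7 : (Nat.log 2 ⌊X⌋₊ : ℝ) * (1 / 2) ≤ Nat.log 2 ⌊X⌋₊ * Real.log 2 := by gcongr
    calc (Nat.log 2 ⌊X⌋₊ : ℝ) ≤ 2 * (q ^ ε / ε) := by linarith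
      _ = _ := by ring
  linarith

/-- The factor `p³`, lost by splitting into residue classes modulo `p`, is a small power of `q`
when `k` is large. -/
theorem prime_cube_le_rpow {p k : ℕ} (hp : 1 ≤ p) {ε : ℝ} (hk : 3 ≤ ε * k) :
    (p : ℝ) ^ 3 ≤ ((p ^ k : ℕ) : ℝ) ^ ε := by
  have h1 : (1 : ℝ) ≤ p := by exact_mod_cast hp
  rw [Nat.cast_pow, ← Real.rpow_natCast, ← Real.rpow_natCast, ← Real.rpow_mul (by positivity)]
  exact Real.rpow_le_rpow_of_exponent_le h1 (by push_cast; linarith)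

end Assembly

end Vinogradov

open Vinogradov in
theorem corollary1p2 :
    ∃ c : ℝ, 0 < c ∧
      ∀ lam : ℝ, 0 < lam → lam < 1 →
        ∃ H : ℝ, 0 < H ∧ ∃ C : ℝ, 0 < C ∧
          ∀ (p k q : ℕ), p.Prime → Odd p → H < (k : ℝ) → q = p ^ k →
          ∀ a : ℤ, Int.gcd a (p : ℤ) = 1 →
          ∀ U V X : ℝ, (q : ℝ) ^ lam < U → U < X → (q : ℝ) ^ lam < V → V < X → X < (q : ℝ) →
          ∀ α β : ℕ → ℂ, (∀ m : ℕ, 1 ≤ m → ‖α m‖ ≤ 1) → (∀ n : ℕ, 1 ≤ n → ‖β n‖ ≤ 1) →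
            ‖hyperbolicSum α β a q U V X‖ ≤ C * (X * (q : ℝ) ^ (-(c * lam ^ 3))) := by
  refine ⟨1 / 2949120000, by norm_num, fun lam h0 h1 => ?_⟩
  -- `e` is of exact order `1 / lam`, so that a saving `q ^ (-θ / 2)` with `θ` of order `e ^ (-3)`
  -- is a power saving of order `lam ^ 3`.
  set e : ℕ := ⌈1 / lam⌉₊ with he
  have he0 : 0 < e := Nat.ceil_pos.2 (by positivity)
  have he1 : 1 / lam ≤ e := Nat.le_ceil _
  have heR : (0 : ℝ) < e := by exact_mod_cast he0
  have hel : 1 / (e : ℝ) ≤ lam := by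
    rw [div_le_iff₀ heR]; rw [div_le_iff₀ h0] at he1; linarith
  have he2 : (e : ℝ) * lam ≤ 2 := by
    have h2 : (e : ℝ) < 1 / lam + 1 := Nat.ceil_lt_add_one (by positivity)
    have h3 := mul_lt_mul_of_pos_right h2 h0
    have h4 : (1 / lam + 1) * lam = 1 + lam := by field_simp
    linarith
  obtain ⟨C, hC, hclass⟩ := exists_norm_class_le he0 h0 hel
  set θ : ℝ := 1 / (92160000 * e ^ 3) with hθ
  have hθ0 : 0 < θ := by positivity
  have hθ2 : (1 / (184320000 * e ^ 3) : ℝ) = θ / 2 := by rw [hθ]; field_simp; norm_num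
  have hθc : 1 / 2949120000 * lam ^ 3 ≤ θ / 4 := by
    have h3 : ((e : ℝ) * lam) ^ 3 ≤ 2 ^ 3 := by gcongr
    rw [hθ, div_div, le_div_iff₀ (by positivity)]
    nlinarith
  rw [hθ2] at hclass
  refine ⟨880 * e + 12 / lam + 24 / θ + 3, by positivity,
    2 * ((2 / (θ / 8) + 1) * C), by positivity, ?_⟩
  intro p k q hp hodd hk hq a ha U V X hU hUX hV hVX hXq α β hα hβ
  subst hq
  have hp0 : 0 < p := hp.pos
  have : NeZero (p ^ k) := ⟨(pow_pos hp0 k).ne'⟩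
  have hlampos : 0 < 12 / lam := by positivity
  have hθpos : 0 < 24 / θ := by positivity
  have hk1 : 880 * e ≤ k := by
    have : ((880 * e : ℕ) : ℝ) ≤ k := by push_cast; linarith
    exact_mod_cast this
  have hk3 : 3 ≤ k := by
    have : ((3 : ℕ) : ℝ) ≤ k := by push_cast; nlinarith
    exact_mod_cast this
  have hk2 : 12 / lam ≤ k := by nlinarith
  have hk4 : 3 ≤ θ / 8 * k := by
    have h5 : 24 / θ ≤ k := by nlinarith
    rw [div_le_iff₀ hθ0] at h5
    linarith
  have hau : IsUnit (a : ZMod (p ^ k)) := by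
    refine isUnit_intCast_zmod_pow hp fun hd => ?_
    have h5 : (p : ℤ) ∣ Int.gcd a p := Int.dvd_coe_gcd hd dvd_rfl
    rw [ha] at h5
    exact hp.one_lt.ne' (by simpa using Int.eq_one_of_dvd_one (by positivity) h5)
  set Q : ℝ := ((p ^ k : ℕ) : ℝ) with hQ
  have hQ1 : 1 ≤ Q := by rw [hQ]; exact_mod_cast Nat.one_le_pow _ _ hp0
  have hQ0 : 0 < Q := by linarith
  have hX : 0 < X := ((Real.rpow_pos_of_pos hQ0 lam).trans hU).trans hUX
  set B : ℝ := (Nat.log 2 ⌊X⌋₊ + 1) * (C * (X * Q ^ (-(θ / 2)))) with hB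
  have hB0 : 0 ≤ B := by positivity
  have hsplit : hyperbolicSum α β a (p ^ k) U V X =
      ∑ w ∈ Finset.range p ×ˢ Finset.range p,
        ∑ z ∈ hyperbolicRegion U V X with z.1 % p = w.1 ∧ z.2 % p = w.2,
        α z.1 * β z.2 * kloosterman ((z.1 : ℤ) * z.2) a (p ^ k) := by
    unfold hyperbolicSum
    rw [← Finset.sum_fiberwise_of_maps_to (t := Finset.range p ×ˢ Finset.range p)
      (g := fun z : ℕ × ℕ => (z.1 % p, z.2 % p))
      (fun z _ => by simp [Nat.mod_lt _ hp0])]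
    simp only [Prod.ext_iff]
  have hbound : ‖hyperbolicSum α β a (p ^ k) U V X‖ ≤ (p : ℝ) ^ 2 * (2 * √p * B) := by
    rw [hsplit]
    refine (norm_sum_le_of_le _ (f := fun w => _) (n := fun _ => 2 * √p * B) ?_).trans ?_
    · rintro ⟨μ, ν⟩ hw
      simp only [Finset.mem_product, Finset.mem_range] at hw
      refine norm_sum_kloosterman_class_le hp hodd hk3 hw.1 hw.2 hau _
        (fun z hz => (Finset.mem_filter.1 hz).2) α β hB0 ?_
      intro hμ hν F hF G hG A hA
      exact hclass p k μ ν hp hodd hk1 hk2 hμ hw.1 hν hw.2 F hF G hG A hA U V X hU hV hX.le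
        α β hα hβ
    · simp [pow_two]
  have hsqrt : √(p : ℝ) ≤ p := by
    rw [Real.sqrt_le_left (by positivity)]
    have : (1 : ℝ) ≤ p := by exact_mod_cast hp0
    nlinarith
  calc ‖hyperbolicSum α β a (p ^ k) U V X‖ ≤ (p : ℝ) ^ 2 * (2 * √p * B) := hbound
    _ ≤ (p : ℝ) ^ 2 * (2 * p * B) := by gcongr
    _ = 2 * ((p : ℝ) ^ 3 * (Nat.log 2 ⌊X⌋₊ + 1) * (C * (X * Q ^ (-(θ / 2))))) := by
        rw [hB]; ring
    _ ≤ 2 * (Q ^ (θ / 8) * ((2 / (θ / 8) + 1) * Q ^ (θ / 8)) * (C * (X * Q ^ (-(θ / 2))))) := by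
        have h5 := prime_cube_le_rpow hp0 hk4
        have h6 := natLog_floor_add_one_le hX hXq.le hQ1 (by positivity : 0 < θ / 8)
        gcongr
    _ = 2 * ((2 / (θ / 8) + 1) * C) * (X * Q ^ (-(θ / 4))) := by
        have h5 : Q ^ (-(θ / 4)) = Q ^ (θ / 8) * Q ^ (θ / 8) * Q ^ (-(θ / 2)) := by
          rw [← Real.rpow_add hQ0, ← Real.rpow_add hQ0]; congr 1; ring
        rw [h5]; ring
    _ ≤ _ := by
        gcongr
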